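/- Let $n\ge 2$, let $\Omega\subset\mathbb{R}^n$ be a domain (a nonempty connected open set), and let $p,q\in[1,\infty]$ with $p^{-1}+q^{-1}<1$ (where $\infty^{-1}=0$). Let $K:\Omega\to[0,\infty)$ and $\Sigma:\Omega\to[0,\infty)$ be measurable functions such that $$K\in L^p_{\mathrm{loc}}(\Omega)\qquad\text{and}\qquad \frac{\Sigma}{K}\in L^q_{\mathrm{loc}}(\Omega),$$ where $\Sigma/K$ takes values in $[0,\infty]$ with $0/0=0$ and $s/0=\infty$ for $s>0$. Let $f\in W^{1,n}_{\mathrm{loc}}(\Omega,\mathbb{R}^n)$, and denote by $|Df(x)|$ the operator norm of its weak differential and by $J_f(x)=\det Df(x)$ its Jacobian. Suppose that either $f$ satisfies the $(K,\Sigma)$-distortion inequality with defect, $$|Df(x)|^n\le K(x)J_f(x)+\Sigma(x)\qquad\text{for a.e. }x\in\Omega,$$ or $f$ has a value of finite distortion at some point $y_0\in\mathbb{R}^n$ with data $(K,\Sigma)$, $$|Df(x)|^n\le K(x)J_f(x)+\Sigma(x)\,|f(x)-y_0|^n\qquad\text{for a.e. }x\in\Omega.$$ Then $f$ has a continuous representative,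 and this representative satisfies the Lusin (N) property: it maps every subset of $\Omega$ of Lebesgue measure zero to a set of Lebesgue measure zero. -/

import Mathlib

open MeasureTheory Set
open scoped ENNReal NNReal ContDiff

/-- `f ∈ L^p_loc(Ω)`: `f` belongs to `L^p(C)` for every compact `C ⊆ Ω`. Only the values of `f` on
`Ω` matter. -/
def MemLpLoc {n : ℕ} {F : Type*} [TopologicalSpace F] [ContinuousENorm F]
    (Ω : Set (EuclideanSpace ℝ (Fin n))) (p : ℝ≥0∞) (f : EuclideanSpace ℝ (Fin n) → F) : Prop :=
  ∀ C ⊆ Ω, IsCompact C → MemLp f p (volume.restrict C)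

/-- `Df` is the weak differential of `f` in the open set `Ω`: both are locally integrable in `Ω`,
and `∫_Ω (∂_v φ) f = - ∫_Ω φ (Df v)` for every test function `φ ∈ C_c^∞(Ω)` and every direction
`v`. It is unique up to equality almost everywhere in `Ω`. -/
structure HasWeakDifferential {n : ℕ} (Ω : Set (EuclideanSpace ℝ (Fin n)))
    (f : EuclideanSpace ℝ (Fin n) → EuclideanSpace ℝ (Fin n))
    (Df : EuclideanSpace ℝ (Fin n) → EuclideanSpace ℝ (Fin n) →L[ℝ] EuclideanSpace ℝ (Fin n)) :
    Prop where
  locallyIntegrableOn : LocallyIntegrableOn f Ω volume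
  locallyIntegrableOn_deriv : LocallyIntegrableOn Df Ω volume
  integral_eq : ∀ φ : EuclideanSpace ℝ (Fin n) → ℝ, ContDiff ℝ ∞ φ → HasCompactSupport φ →
    tsupport φ ⊆ Ω → ∀ v : EuclideanSpace ℝ (Fin n),
      ∫ x in Ω, (fderiv ℝ φ x v) • f x = - ∫ x in Ω, φ x • (Df x v)

/-- The local Sobolev space `W^{1,p}_loc(Ω, ℝⁿ)`. -/
def MemSobolevLoc {n : ℕ} (Ω : Set (EuclideanSpace ℝ (Fin n))) (p : ℝ≥0∞)
    (f : EuclideanSpace ℝ (Fin n) → EuclideanSpace ℝ (Fin n)) : Prop :=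
  MemLpLoc Ω p f ∧ ∃ Df, HasWeakDifferential Ω f Df ∧ MemLpLoc Ω p Df

/-- The `(K, S)`-distortion inequality with defect: `|Df|ⁿ ≤ K J_f + S` a.e. in `Ω`, where `|Df|`
is the operator norm of the weak differential and `J_f` is its determinant. -/
def SatisfiesDistortionWithDefect {n : ℕ} (Ω : Set (EuclideanSpace ℝ (Fin n)))
    (K S : EuclideanSpace ℝ (Fin n) → ℝ≥0)
    (f : EuclideanSpace ℝ (Fin n) → EuclideanSpace ℝ (Fin n)) : Prop :=
  ∃ Df, HasWeakDifferential Ω f Df ∧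
    ∀ᵐ x ∂(volume.restrict Ω), ‖Df x‖ ^ n ≤ (K x : ℝ) * (Df x).det + (S x : ℝ)

/-- `f` has a value of finite distortion at `y₀` with data `(K, S)`:
`|Df|ⁿ ≤ K J_f + S |f - y₀|ⁿ` a.e. in `Ω`. -/
def HasValueOfFiniteDistortion {n : ℕ} (Ω : Set (EuclideanSpace ℝ (Fin n)))
    (K S : EuclideanSpace ℝ (Fin n) → ℝ≥0)
    (f : EuclideanSpace ℝ (Fin n) → EuclideanSpace ℝ (Fin n))
    (y₀ : EuclideanSpace ℝ (Fin n)) : Prop :=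
  ∃ Df, HasWeakDifferential Ω f Df ∧
    ∀ᵐ x ∂(volume.restrict Ω),
      ‖Df x‖ ^ n ≤ (K x : ℝ) * (Df x).det + (S x : ℝ) * ‖f x - y₀‖ ^ n

/-- The Lusin (N) property: `f` maps Lebesgue null subsets of `Ω` to Lebesgue null sets. -/
def LusinN {n : ℕ} (Ω : Set (EuclideanSpace ℝ (Fin n)))
    (f : EuclideanSpace ℝ (Fin n) → EuclideanSpace ℝ (Fin n)) : Prop :=
  ∀ E ⊆ Ω, volume E = 0 → volume (f '' E) = 0

/-! With σ = S/K, multiplied by |f - y₀|ⁿ in the second case, both hypotheses become |Df|ⁿ ≤ K(J_f +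
σ). Maps in W^{1,n}_loc lie in every L^s_loc with s finite, so after a slight loss of exponents K ∈
L^p_loc and σ ∈ L^q_loc with p, q finite and 1/p + 1/q < 1. The inequality also forces J_f + σ ≥ 0.

The Jacobian is a null Lagrangian: ∫_P θ(f_i) J_f = 0 whenever the truncation θ(f_i) vanishes near
∂P. If θ is a ramp from level k to level h, then ∫ θ(f_i)(J_f + σ) = ∫ θ(f_i)σ is at most the
integral of σ over {f_i > k}. Hölder's inequality against K^p and the Sobolev inequality give, with
v bounding ∫_P K^p and ∫_P σ^q, (h - k)^{np} |{f_i > h}| ≤ C v^{1+p/q} |{f_i > k}|^{p - p/q}. The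
last exponent exceeds 1 exactly when 1/p + 1/q < 1, so Stampacchia's iteration bounds f_i on P by
its boundary values plus C v^{1/n}, once v also bounds |P|. The lower bound comes from -f_i.

The boundary values are controlled by Morrey's inequality in dimension n - 1 with exponent n: most
hyperplane slices of a cube carry a small share of ∫|Df|ⁿ, and a box can be built from such slices.
Since f has no pointwise values there, the argument runs on mollifications with one common majorant
of |DF_j|ⁿ.

Thus (osc f)ⁿ ≤ C ν(larger ball), where ν has density |Df|ⁿ + K^p + σ^q + 1. This measure is locally
finite and absolutely continuous. Continuity follows because ν of shrinking balls tends to zero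
(`IsOscillationBound.exists_continuousOn_ae_eq`). Lusin (N) follows from a Vitali covering by balls
with doubling radii inside open sets of small ν-measure (`IsOscillationBound.lusinN`). -/

/-! ### The Jacobian as a null Lagrangian -/

/-- The expansion of `det (1 + t A)` in powers of `t`. -/
theorem exists_det_one_add_smul_expansion {E : Type*} [NormedAddCommGroup E] [NormedSpace ℝ E]
    [FiniteDimensional ℝ E] :
    ∃ c : Finset (Fin (Module.finrank ℝ E)) → (E →L[ℝ] E) → ℝ,
      (∀ s, Continuous (c s)) ∧ (∀ A, c Finset.univ A = A.det) ∧
      ∀ (t : ℝ) (A : E →L[ℝ] E),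
        (ContinuousLinearMap.id ℝ E + t • A).det = ∑ s, t ^ s.card * c s A := by
  let b := Module.finBasis ℝ E
  let T : (E →L[ℝ] E) →ₗ[ℝ] Matrix (Fin (Module.finrank ℝ E)) (Fin (Module.finrank ℝ E)) ℝ :=
    (LinearMap.toMatrix b b).toLinearMap ∘ₗ ContinuousLinearMap.coeLM ℝ
  have hT : Continuous T := T.continuous_of_finiteDimensional
  have hdet : ∀ A : E →L[ℝ] E, A.det = (T A).det := fun A => by
    simp only [T, LinearMap.coe_comp, Function.comp_apply, LinearEquiv.coe_coe,
      ContinuousLinearMap.coeLM_apply]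
    rw [LinearMap.det_toMatrix]
  obtain ⟨I, hI⟩ : ∃ I : Matrix (Fin (Module.finrank ℝ E)) (Fin (Module.finrank ℝ E)) ℝ, I = 1 :=
    ⟨1, rfl⟩
  refine ⟨fun s A => Matrix.det (s.piecewise (T A) I), fun s => ?_, fun A => ?_,
    fun t A => ?_⟩
  · refine Continuous.matrix_det ?_
    refine continuous_pi fun i => ?_
    by_cases hi : i ∈ s
    · simpa [Finset.piecewise, hi] using (continuous_pi_iff.1 hT) i
    · simpa [Finset.piecewise, hi] using continuous_const
  · rw [hdet]
    exact congrArg Matrix.det (Finset.piecewise_univ _ _)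
  · have h1 : T (ContinuousLinearMap.id ℝ E + t • A) = t • T A + I := by
      rw [hI, map_add, map_smul, add_comm]
      congr 1
      simp [T]
    rw [hdet, h1]
    -- The determinant is multilinear in the rows; `s` records the rows taken from `t • T A`.
    have h2 : (t • T A + I).det = ∑ s : Finset _, Matrix.det (s.piecewise (t • T A) I) :=
      Matrix.detRowAlternating.map_add_univ (t • T A) I
    rw [h2]
    refine Finset.sum_congr rfl fun s _ => ?_
    have h3 := (Matrix.detRowAlternating (n := Fin (Module.finrank ℝ E))
      (R := ℝ)).toMultilinearMap.map_piecewise_smul (fun _ => t) (s.piecewise (T A) I) s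
    have h4 : s.piecewise (fun i => t • s.piecewise (T A) I i)
        (s.piecewise (T A) I) = s.piecewise (t • T A) I := by
      ext i j
      by_cases hi : i ∈ s <;> simp [Finset.piecewise, hi]
    rw [h4, Finset.prod_const, smul_eq_mul] at h3
    exact h3

/-- Small perturbations of the identity with compact support are bijective. -/
theorem bijective_id_add_smul {E : Type*} [NormedAddCommGroup E] [NormedSpace ℝ E]
    [CompleteSpace E] {F : E → E} {L : ℝ≥0} (hL : LipschitzWith L F) {t : ℝ}
    (ht0 : 0 ≤ t) (ht : t * L < 1) : Function.Bijective fun x => x + t • F x := by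
  rcases subsingleton_or_nontrivial E with hE | hE
  · exact ⟨fun x y _ => Subsingleton.elim _ _, fun y => ⟨y, Subsingleton.elim _ _⟩⟩
  have hA : ApproximatesLinearOn (fun x => x + t • F x)
      ((ContinuousLinearEquiv.refl ℝ E : E ≃L[ℝ] E) : E →L[ℝ] E) univ (t.toNNReal * L) := by
    intro x _ y _
    have : (x + t • F x) - (y + t • F y)
        - ((ContinuousLinearEquiv.refl ℝ E : E ≃L[ℝ] E) : E →L[ℝ] E) (x - y)
        = t • (F x - F y) := by
      simp [smul_sub]; abel
    rw [this, norm_smul, Real.norm_of_nonneg ht0, NNReal.coe_mul, Real.coe_toNNReal _ ht0,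
      mul_assoc]
    gcongr
    exact hL.norm_sub_le x y
  have hc : Subsingleton E ∨ t.toNNReal * L
      < ‖(((ContinuousLinearEquiv.refl ℝ E).symm : E ≃L[ℝ] E) : E →L[ℝ] E)‖₊⁻¹ := by
    right
    have : ‖(((ContinuousLinearEquiv.refl ℝ E).symm : E ≃L[ℝ] E) : E →L[ℝ] E)‖₊ = 1 := by
      ext; simp
    rw [this, inv_one, ← NNReal.coe_lt_coe]
    simpa [Real.coe_toNNReal _ ht0] using ht
  exact (hA.toHomeomorph _ hc).bijective

/-- The Jacobian determinant of a compactly supported `C¹` map has integral zero. -/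
theorem integral_det_fderiv_eq_zero {E : Type*} [NormedAddCommGroup E] [NormedSpace ℝ E]
    [FiniteDimensional ℝ E] [MeasurableSpace E] [BorelSpace E] (μ : Measure E)
    [μ.IsAddHaarMeasure] (hE : 0 < Module.finrank ℝ E) {F : E → E} (hF : ContDiff ℝ 1 F)
    (hFc : HasCompactSupport F) : ∫ x, (fderiv ℝ F x).det ∂μ = 0 := by
  classical
  obtain ⟨c, hcc, hcd, hexp⟩ := exists_det_one_add_smul_expansion (E := E)
  obtain ⟨L, hL⟩ := ContDiff.lipschitzWith_of_hasCompactSupport hFc hF one_ne_zero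
  obtain ⟨R, hR⟩ := hFc.isCompact.isBounded.subset_ball 0
  set B := Metric.ball (0 : E) R
  have hDF : Continuous (fderiv ℝ F) := hF.continuous_fderiv one_ne_zero
  have hDb : ∀ x, ‖fderiv ℝ F x‖ ≤ L := fun x => norm_fderiv_le_of_lipschitz ℝ hL
  obtain ⟨δ, hδ0, hδ⟩ : ∃ δ > 0, ∀ A : E →L[ℝ] E, ‖A‖ < δ →
      0 < (ContinuousLinearMap.id ℝ E + A).det := by
    have h1 : Continuous fun A : E →L[ℝ] E => (ContinuousLinearMap.id ℝ E + A).det :=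
      ContinuousLinearMap.continuous_det.comp (continuous_const.add continuous_id)
    have h2 : ∀ᶠ A in nhds (0 : E →L[ℝ] E), 0 < (ContinuousLinearMap.id ℝ E + A).det := by
      refine h1.continuousAt.eventually (lt_mem_nhds ?_)
      have : (ContinuousLinearMap.id ℝ E).det = 1 := LinearMap.det_id
      simp [this]
    obtain ⟨δ, h, h'⟩ := Metric.eventually_nhds_iff.1 h2
    exact ⟨δ, h, fun A hA => h' (by simpa using hA)⟩
  have hint : ∀ s, IntegrableOn (fun x => c s (fderiv ℝ F x)) B μ := fun s =>
    (((hcc s).comp hDF).continuousOn.integrableOn_compact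
      (isCompact_closedBall (0 : E) R)).mono_set Metric.ball_subset_closedBall
  -- For small t the map x + tF(x) is a bijection that is the identity off B, so it maps B onto B.
  -- The change of variables formula then makes the integral over B of det(1 + t DF), a polynomial
  -- in t, equal to the volume of B.
  have key : ∀ t : ℝ, 0 < t → t * L < 1 → t * L < δ →
      ∑ s, t ^ s.card * ∫ x in B, c s (fderiv ℝ F x) ∂μ = (μ B).toReal := by
    intro t ht0 ht1 htδ
    set φ : E → E := fun x => x + t • F x
    have hbij : Function.Bijective φ := bijective_id_add_smul hL ht0.le ht1
    have hφB : φ '' B = B := by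
      have hc : φ '' Bᶜ = Bᶜ := by
        have : ∀ x ∈ Bᶜ, φ x = x := fun x hx => by
          have : F x = 0 := image_eq_zero_of_notMem_tsupport fun h => hx (hR h)
          simp [φ, this]
        rw [image_congr this, image_id']
      have := image_compl_eq hbij (s := Bᶜ)
      rw [compl_compl, hc, compl_compl] at this
      exact this
    have hder : ∀ x ∈ B, HasFDerivWithinAt φ
        (ContinuousLinearMap.id ℝ E + t • fderiv ℝ F x) B x := fun x _ =>
      ((hasFDerivAt_id x).add
        (((hF.differentiable one_ne_zero) x).hasFDerivAt.const_smul t)).hasFDerivWithinAt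
    have hcv := integral_image_eq_integral_abs_det_fderiv_smul μ Metric.isOpen_ball.measurableSet
      hder hbij.injective.injOn (fun _ => (1 : ℝ))
    rw [hφB] at hcv
    have hpos : ∀ x, |(ContinuousLinearMap.id ℝ E + t • fderiv ℝ F x).det| • (1 : ℝ)
        = ∑ s, t ^ s.card * c s (fderiv ℝ F x) := fun x => by
      rw [abs_of_pos, hexp, smul_eq_mul, mul_one]
      apply hδ
      rw [norm_smul, Real.norm_of_nonneg ht0.le]
      exact (mul_le_mul_of_nonneg_left (hDb x) ht0.le).trans_lt htδ
    simp_rw [hpos] at hcv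
    rw [integral_finsetSum _ fun s _ => (hint s).const_mul _] at hcv
    simp_rw [integral_const_mul] at hcv
    rw [← hcv]
    simp [Measure.real]
  let P : Polynomial ℝ := ∑ s : Finset (Fin (Module.finrank ℝ E)),
    Polynomial.C (∫ x in B, c s (fderiv ℝ F x) ∂μ) * Polynomial.X ^ s.card
      - Polynomial.C (μ B).toReal
  have hP0 : P = 0 := by
    apply Polynomial.eq_zero_of_infinite_isRoot
    obtain ⟨τ, hτ0, hτ⟩ : ∃ τ : ℝ, 0 < τ ∧ ∀ t, 0 < t → t < τ → t * L < 1 ∧ t * L < δ := by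
      refine ⟨min 1 δ / (L + 1), by positivity, fun t ht0 ht => ?_⟩
      rw [lt_div_iff₀ (by positivity)] at ht
      have h1 : t * L < min 1 δ := by nlinarith [ht0]
      exact ⟨h1.trans_le (min_le_left _ _), h1.trans_le (min_le_right _ _)⟩
    refine (Ioo_infinite hτ0).mono fun t ht => ?_
    have hk := key t ht.1 (hτ t ht.1 ht.2).1 (hτ t ht.1 ht.2).2
    simp only [mem_ofPred_eq, Polynomial.IsRoot.def, P, Polynomial.eval_sub,
      Polynomial.eval_finsetSum, Polynomial.eval_mul, Polynomial.eval_C, Polynomial.eval_pow,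
      Polynomial.eval_X]
    rw [← hk, sub_eq_zero]
    exact Finset.sum_congr rfl fun s _ => mul_comm _ _
  -- Only the full set of rows contributes to the top degree, and the constant term does not
  -- interfere because the dimension is positive.
  have hco : P.coeff (Module.finrank ℝ E) = ∫ x in B, c Finset.univ (fderiv ℝ F x) ∂μ := by
    simp only [P, Polynomial.coeff_sub, Polynomial.finsetSum_coeff, Polynomial.coeff_C_mul,
      Polynomial.coeff_X_pow, Polynomial.coeff_C, hE.ne', if_false, sub_zero]
    rw [Finset.sum_eq_single Finset.univ]
    · simp
    · intro s _ hs
      rw [if_neg, mul_zero]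
      intro h
      apply hs
      rw [← Finset.card_eq_iff_eq_univ, ← h, Fintype.card_fin]
    · simp
  rw [hP0, Polynomial.coeff_zero] at hco
  simp_rw [hcd] at hco
  rw [hco, setIntegral_eq_integral_of_forall_compl_eq_zero]
  intro x hx
  have h0 : fderiv ℝ F x = 0 := by
    have : x ∉ tsupport (fderiv ℝ F) := fun h => hx (hR (tsupport_fderiv_subset ℝ h))
    exact image_eq_zero_of_notMem_tsupport this
  rw [h0]
  have : Nontrivial E := Module.finrank_pos_iff.1 hE
  change LinearMap.det (0 : E →ₗ[ℝ] E) = 0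
  rw [LinearMap.det_zero, zero_pow hE.ne']

/-- A `C¹` function vanishing near the frontier of an open set stays `C¹` when extended by zero. -/
theorem contDiff_indicator_of_frontier {E F : Type*} [NormedAddCommGroup E] [NormedSpace ℝ E]
    [NormedAddCommGroup F] [NormedSpace ℝ F] {P : Set E} {u : E → F} (hu : ContDiff ℝ 1 u)
    (hP : IsOpen P) (hb : ∀ z ∈ frontier P, ∀ᶠ y in nhds z, u y = 0) :
    ContDiff ℝ 1 (P.indicator u) ∧
      ∀ x, fderiv ℝ (P.indicator u) x = P.indicator (fderiv ℝ u) x := by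
  have hcase : ∀ x, (x ∈ P ∧ P.indicator u =ᶠ[nhds x] u) ∨
      (x ∉ P ∧ P.indicator u =ᶠ[nhds x] fun _ => 0) := by
    intro x
    by_cases hx : x ∈ P
    · left
      refine ⟨hx, ?_⟩
      filter_upwards [hP.mem_nhds hx] with y hy
      exact indicator_of_mem hy u
    · right
      refine ⟨hx, ?_⟩
      by_cases hx' : x ∈ closure P
      · have : x ∈ frontier P := by rw [hP.frontier_eq]; exact ⟨hx', hx⟩
        filter_upwards [hb x this] with y hy
        by_cases hyP : y ∈ P <;> simp [hyP, hy]
      · filter_upwards [isClosed_closure.isOpen_compl.mem_nhds hx'] with y hy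
        exact indicator_of_notMem (fun h => hy (subset_closure h)) u
  refine ⟨contDiff_iff_contDiffAt.2 fun x => ?_, fun x => ?_⟩
  · rcases hcase x with ⟨_, h⟩ | ⟨_, h⟩
    · exact hu.contDiffAt.congr_of_eventuallyEq h
    · exact contDiffAt_const.congr_of_eventuallyEq h
  · rcases hcase x with ⟨hx, h⟩ | ⟨hx, h⟩
    · rw [h.fderiv_eq, indicator_of_mem hx]
    · rw [h.fderiv_eq, indicator_of_notMem hx]
      simp

/-- Scaling one coordinate of the values of a linear map by `c` scales its determinant by `c`. -/
theorem det_eq_mul_det_of_scaled_coord {n : ℕ}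
    {A B : EuclideanSpace ℝ (Fin n) →L[ℝ] EuclideanSpace ℝ (Fin n)} {i : Fin n} {c : ℝ}
    (hi : ∀ v, B v i = c * A v i) (hj : ∀ j ≠ i, ∀ v, B v j = A v j) : B.det = c * A.det := by
  classical
  let b := (EuclideanSpace.basisFun (Fin n) ℝ).toBasis
  have hdet : ∀ A : EuclideanSpace ℝ (Fin n) →L[ℝ] EuclideanSpace ℝ (Fin n),
      A.det = (LinearMap.toMatrix b b (A : _ →ₗ[ℝ] _)).det := fun A => by
    rw [LinearMap.det_toMatrix]
  have hBA : LinearMap.toMatrix b b (B : _ →ₗ[ℝ] _)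
      = (LinearMap.toMatrix b b (A : _ →ₗ[ℝ] _)).updateRow i
        (c • (LinearMap.toMatrix b b (A : _ →ₗ[ℝ] _)) i) := by
    ext k l
    by_cases hk : k = i
    · subst hk
      simp [LinearMap.toMatrix_apply, b, hi]
    · simp [LinearMap.toMatrix_apply, b, hk, hj k hk]
  rw [hdet, hdet, hBA, Matrix.det_updateRow_smul, Matrix.updateRow_eq_self]

/-- The Jacobian determinant of a `C¹` map has integral zero as soon as one of its coordinate
functions has compact support. -/
theorem integral_det_fderiv_eq_zero_of_coord {n : ℕ}
    {F : EuclideanSpace ℝ (Fin n) → EuclideanSpace ℝ (Fin n)} (hF : ContDiff ℝ 1 F) (i : Fin n)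
    (hFi : HasCompactSupport fun x => F x i) : ∫ x, (fderiv ℝ F x).det = 0 := by
  have hn : 0 < Module.finrank ℝ (EuclideanSpace ℝ (Fin n)) := by
    simpa using (Nat.zero_le _).trans_lt i.2
  obtain ⟨R, hR0, hR⟩ := hFi.isCompact.isBounded.subset_ball_lt 0 0
  let χ : ContDiffBump (0 : EuclideanSpace ℝ (Fin n)) := ⟨R, R + 1, hR0, by linarith⟩
  have hχ : ContDiff ℝ 1 χ := χ.contDiff
  have hcoord : ∀ (G : EuclideanSpace ℝ (Fin n) → EuclideanSpace ℝ (Fin n)) x,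
      ContDiff ℝ 1 G → ((fun y => G y i) =ᶠ[nhds x] fun _ => 0) → (fderiv ℝ G x).det = 0 := by
    intro G x hG h
    have hd := (hG.differentiable one_ne_zero x).hasFDerivAt
    have h1 := ((EuclideanSpace.proj (𝕜 := ℝ) i).hasFDerivAt.comp x hd).fderiv
    have h2 : fderiv ℝ (fun y => G y i) x = 0 := by
      rw [h.fderiv_eq]; simp
    have h3 : ∀ v, fderiv ℝ G x v i = 0 := fun v => by
      have := DFunLike.congr_fun (h1.symm.trans h2) v
      simpa using this
    have := det_eq_mul_det_of_scaled_coord (A := fderiv ℝ G x) (B := fderiv ℝ G x) (i := i)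
      (c := 0) (fun v => by rw [h3, zero_mul]) (fun _ _ _ => rfl)
    simpa using this
  -- The cutoff equals 1 near the support of the `i`-th coordinate. Off that support the coordinate
  -- vanishes locally, for F and for χF alike, so both Jacobians are zero there.
  have hF' : ContDiff ℝ 1 fun x => χ x • F x := hχ.smul hF
  have h0 := integral_det_fderiv_eq_zero volume hn hF'
    (χ.hasCompactSupport.smul_right (f' := F))
  rw [← h0]
  refine integral_congr_ae (Filter.Eventually.of_forall fun x => ?_)
  by_cases hx : x ∈ tsupport fun x => F x i
  · have h1 : (fun x => χ x • F x) =ᶠ[nhds x] F := by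
      filter_upwards [Metric.isOpen_ball.mem_nhds (hR hx)] with y hy
      rw [χ.one_of_mem_closedBall (Metric.ball_subset_closedBall hy), one_smul]
    simp only [h1.fderiv_eq]
  · have h1 : (fun x => F x i) =ᶠ[nhds x] fun _ => 0 := notMem_tsupport_iff_eventuallyEq.1 hx
    have h2 : (fun x => (χ x • F x) i) =ᶠ[nhds x] fun _ => 0 := by
      filter_upwards [h1] with y hy
      simp [hy]
    simp only [hcoord F x hF h1, hcoord _ x hF' h2]

/-- If `Ψ ∘ gᵢ` vanishes near the frontier of a bounded open set `P`, then
`∫_P Ψ'(gᵢ) J_g = 0`. -/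
theorem setIntegral_deriv_comp_mul_det_eq_zero {n : ℕ}
    {g : EuclideanSpace ℝ (Fin n) → EuclideanSpace ℝ (Fin n)} (hg : ContDiff ℝ 1 g) (i : Fin n)
    {P : Set (EuclideanSpace ℝ (Fin n))} (hP : IsOpen P) (hPb : Bornology.IsBounded P)
    {Ψ : ℝ → ℝ} (hΨ : ContDiff ℝ 1 Ψ)
    (hb : ∀ z ∈ frontier P, ∀ᶠ y in nhds z, Ψ (g y i) = 0) :
    ∫ x in P, deriv Ψ (g x i) * (fderiv ℝ g x).det = 0 := by
  have hgi : ContDiff ℝ 1 fun x => g x i := (EuclideanSpace.proj (𝕜 := ℝ) i).contDiff.comp hg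
  have hu : ContDiff ℝ 1 fun x => Ψ (g x i) := hΨ.comp hgi
  obtain ⟨hw, hwd⟩ := contDiff_indicator_of_frontier hu hP hb
  set w := P.indicator fun x => Ψ (g x i)
  -- The `i`-th coordinate of `g` is replaced by the compactly supported function 1_P Ψ(g_i), which
  -- multiplies the Jacobian by 1_P Ψ'(g_i).
  let F : EuclideanSpace ℝ (Fin n) → EuclideanSpace ℝ (Fin n) :=
    fun x => g x + (w x - g x i) • EuclideanSpace.single i (1 : ℝ)
  have hF : ContDiff ℝ 1 F := hg.add ((hw.sub hgi).smul contDiff_const)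
  have hFi : (fun x => F x i) = w := by
    ext x; simp [F]
  have hwc : HasCompactSupport w :=
    hPb.isCompact_closure.of_isClosed_subset (isClosed_tsupport w)
      (closure_mono support_indicator_subset)
  have h0 := integral_det_fderiv_eq_zero_of_coord hF i (hFi ▸ hwc)
  rw [← integral_indicator hP.measurableSet, ← h0]
  refine integral_congr_ae (Filter.Eventually.of_forall fun x => ?_)
  have hgd := (hg.differentiable one_ne_zero x).hasFDerivAt
  have hgid : HasFDerivAt (fun x => g x i)
      ((EuclideanSpace.proj (𝕜 := ℝ) i).comp (fderiv ℝ g x)) x :=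
    (EuclideanSpace.proj (𝕜 := ℝ) i).hasFDerivAt.comp x hgd
  have hwd' := (hw.differentiable one_ne_zero x).hasFDerivAt
  have hFd : HasFDerivAt F _ x :=
    hgd.add ((hwd'.sub hgid).smul_const (EuclideanSpace.single i (1 : ℝ)))
  have hud : HasFDerivAt (fun x => Ψ (g x i)) _ x :=
    ((hΨ.differentiable one_ne_zero (g x i)).hasDerivAt.comp_hasFDerivAt x hgid)
  have hdet := det_eq_mul_det_of_scaled_coord (A := fderiv ℝ g x) (B := fderiv ℝ F x) (i := i)
    (c := P.indicator (fun x => deriv Ψ (g x i)) x) (fun v => ?_) (fun j hj v => ?_)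
  · simp only [hdet]
    by_cases hx : x ∈ P <;> simp [hx]
  · rw [hFd.fderiv, hwd]
    by_cases hx : x ∈ P
    · simp [hx, hud.fderiv]
    · simp [hx]
  · rw [hFd.fderiv]
    simp [hj]

/-! ### Morrey's inequality on convex sets -/

/-- Jensen's inequality for powers, on a set. -/
theorem setLIntegral_le_rpow_mul_rpow_measure {α : Type*} [MeasurableSpace α] {μ : Measure α}
    {Q : Set α} {g : α → ℝ≥0∞} (hg : AEMeasurable g (μ.restrict Q)) {p q : ℝ}
    (hpq : p.HolderConjugate q) :
    ∫⁻ y in Q, g y ∂μ ≤ (∫⁻ y in Q, g y ^ p ∂μ) ^ (1 / p) * μ Q ^ (1 / q) := by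
  have := ENNReal.lintegral_mul_le_Lp_mul_Lq (μ.restrict Q) hpq hg
    (aemeasurable_const (b := (1 : ℝ≥0∞)))
  simpa using this

/-- Integration along a homothety of a convex set into itself. -/
theorem setLIntegral_comp_homothety_le {E : Type*} [NormedAddCommGroup E] [NormedSpace ℝ E]
    [FiniteDimensional ℝ E] [MeasurableSpace E] [BorelSpace E] (μ : Measure E)
    [μ.IsAddHaarMeasure] {Q : Set E} (hQ : Convex ℝ Q) (hQm : MeasurableSet Q) {g : E → ℝ≥0∞}
    (hg : Measurable g) {x : E} (hx : x ∈ Q) {t : ℝ} (ht0 : 0 < t) (ht1 : t ≤ 1) :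
    ∫⁻ y in Q, g (x + t • (y - x)) ∂μ
      ≤ ENNReal.ofReal ((t ^ Module.finrank ℝ E)⁻¹) * ∫⁻ y in Q, g y ∂μ := by
  have hG : Measurable (Q.indicator g) := hg.indicator hQm
  calc ∫⁻ y in Q, g (x + t • (y - x)) ∂μ
      ≤ ∫⁻ y in Q, Q.indicator g ((x - t • x) + t • y) ∂μ := by
        refine setLIntegral_mono' hQm fun y hy => ?_
        have h1 : x + t • (y - x) ∈ Q := hQ.add_smul_sub_mem hx hy ⟨ht0.le, ht1⟩
        have h2 : (x - t • x) + t • y = x + t • (y - x) := by rw [smul_sub]; abel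
        rw [h2, indicator_of_mem h1]
    _ ≤ ∫⁻ y, Q.indicator g ((x - t • x) + t • y) ∂μ := setLIntegral_le_lintegral _ _
    _ = ∫⁻ z, Q.indicator g ((x - t • x) + z) ∂(Measure.map (t • ·) μ) := by
        rw [lintegral_map (f := fun z => Q.indicator g ((x - t • x) + z))
          (hG.comp (measurable_const_add _)) (measurable_const_smul t)]
    _ = ENNReal.ofReal ((t ^ Module.finrank ℝ E)⁻¹) * ∫⁻ y in Q, g y ∂μ := by
        rw [Measure.map_addHaar_smul μ ht0.ne', lintegral_smul_measure,
          lintegral_add_left_eq_self (Q.indicator g), lintegral_indicator hQm,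
          abs_of_pos (by positivity), smul_eq_mul]

/-- The homothety y ↦ x + t(y - x) costs a factor t^{-d}, of which Hölder's inequality keeps the
power 1/(d + 1). Since d/(d + 1) < 1, the resulting weight is integrable at 0; this is where an
exponent above the dimension is needed. -/
theorem lintegral_Ioc_rpow_inv (d : ℕ) :
    ∫⁻ t in Ioc (0 : ℝ) 1, ENNReal.ofReal ((t ^ d)⁻¹) ^ (1 / ((d : ℝ) + 1))
      = ENNReal.ofReal (d + 1) := by
  have hd : (0 : ℝ) < d + 1 := by positivity
  have hr : -1 < -((d : ℝ) / (d + 1)) := by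
    rw [neg_lt_neg_iff, div_lt_one hd]; linarith
  have h1 : ∀ t ∈ Ioc (0 : ℝ) 1, ENNReal.ofReal ((t ^ d)⁻¹) ^ (1 / ((d : ℝ) + 1))
      = ENNReal.ofReal (t ^ (-((d : ℝ) / (d + 1)))) := by
    intro t ht
    rw [ENNReal.ofReal_rpow_of_nonneg (inv_nonneg.2 (pow_nonneg ht.1.le _)) (by positivity),
      ← Real.rpow_natCast, ← Real.rpow_neg ht.1.le, ← Real.rpow_mul ht.1.le]
    congr 2
    ring
  rw [setLIntegral_congr_fun measurableSet_Ioc h1]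
  have hi : IntervalIntegrable (fun t : ℝ => t ^ (-((d : ℝ) / (d + 1)))) volume 0 1 :=
    intervalIntegral.intervalIntegrable_rpow' hr
  rw [← ofReal_integral_eq_lintegral_ofReal
    ((intervalIntegrable_iff_integrableOn_Ioc_of_le zero_le_one).1 hi),
    ← intervalIntegral.integral_of_le zero_le_one, integral_rpow (Or.inl hr)]
  · congr 1
    have h2 : -((d : ℝ) / (d + 1)) + 1 = 1 / (d + 1) := by field_simp; ring
    rw [h2, Real.one_rpow, Real.zero_rpow (by positivity)]
    simp
  · filter_upwards [ae_restrict_mem measurableSet_Ioc] with t ht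
    exact Real.rpow_nonneg ht.1.le _

/-- The averaged form of Morrey's inequality on a convex set in dimension `d`, with exponent
`d + 1`. -/
theorem setLIntegral_enorm_sub_le_morrey {E F : Type*} [NormedAddCommGroup E] [NormedSpace ℝ E]
    [FiniteDimensional ℝ E] [MeasurableSpace E] [BorelSpace E] (μ : Measure E)
    [μ.IsAddHaarMeasure] [NormedAddCommGroup F] [NormedSpace ℝ F] [CompleteSpace F]
    (hd : 0 < Module.finrank ℝ E)
    {Q : Set E} (hQ : Convex ℝ Q) (hQm : MeasurableSet Q) {L : ℝ≥0∞}
    (hL : ∀ x ∈ Q, ∀ y ∈ Q, ‖y - x‖ₑ ≤ L) {h : E → F} (hh : ContDiff ℝ 1 h) {x : E}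
    (hx : x ∈ Q) :
    ∫⁻ y in Q, ‖h y - h x‖ₑ ∂μ ≤ L * (ENNReal.ofReal (Module.finrank ℝ E + 1) *
      ((∫⁻ y in Q, ‖fderiv ℝ h y‖ₑ ^ ((Module.finrank ℝ E : ℝ) + 1) ∂μ)
        ^ (1 / ((Module.finrank ℝ E : ℝ) + 1)) *
      μ Q ^ ((Module.finrank ℝ E : ℝ) / (Module.finrank ℝ E + 1)))) := by
  set d := Module.finrank ℝ E
  have hd' : (0 : ℝ) < d := by exact_mod_cast hd
  set D : E → ℝ≥0∞ := fun y => ‖fderiv ℝ h y‖ₑ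
  have hDc : Continuous D := (hh.continuous_fderiv one_ne_zero).enorm
  have hline : Continuous fun z : E × ℝ => x + z.2 • (z.1 - x) := by fun_prop
  have hpt : ∀ y ∈ Q, ‖h y - h x‖ₑ ≤ ∫⁻ t in Ioc (0 : ℝ) 1, D (x + t • (y - x)) * L := by
    intro y hy
    have hder : ∀ t ∈ uIcc (0 : ℝ) 1, HasDerivAt (fun t : ℝ => h (x + t • (y - x)))
        (fderiv ℝ h (x + t • (y - x)) (y - x)) t := by
      intro t _
      have h1 : HasDerivAt (fun t : ℝ => x + t • (y - x)) (y - x) t := by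
        simpa using ((hasDerivAt_id t).smul_const (y - x)).const_add x
      exact ((hh.differentiable one_ne_zero) _).hasFDerivAt.comp_hasDerivAt t h1
    have hcont : Continuous fun t : ℝ => fderiv ℝ h (x + t • (y - x)) (y - x) :=
      ((hh.continuous_fderiv one_ne_zero).comp (by fun_prop)).clm_apply continuous_const
    have hftc := intervalIntegral.integral_eq_sub_of_hasDerivAt hder
      (hcont.intervalIntegrable 0 1)
    simp only [one_smul, zero_smul, add_zero, add_sub_cancel] at hftc
    rw [← hftc, intervalIntegral.integral_of_le zero_le_one]
    refine (enorm_integral_le_lintegral_enorm _).trans (lintegral_mono fun t => ?_)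
    exact (ContinuousLinearMap.le_opENorm _ _).trans (by gcongr; exact hL x hx y hy)
  -- The fundamental theorem of calculus on segments from x is integrated over Q. After Tonelli,
  -- each fixed t is handled by Hölder with exponents d + 1 and (d + 1)/d, followed by the homothety
  -- estimate.
  calc ∫⁻ y in Q, ‖h y - h x‖ₑ ∂μ
      ≤ ∫⁻ y in Q, ∫⁻ t in Ioc (0 : ℝ) 1, D (x + t • (y - x)) * L ∂volume ∂μ :=
        setLIntegral_mono' hQm hpt
    _ = ∫⁻ t in Ioc (0 : ℝ) 1, (∫⁻ y in Q, D (x + t • (y - x)) ∂μ) * L := by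
        rw [lintegral_lintegral_swap]
        · refine lintegral_congr fun t => ?_
          rw [lintegral_mul_const]
          exact (hDc.comp (by fun_prop)).measurable
        · exact ((hDc.comp hline).measurable.mul_const L).aemeasurable
    _ ≤ ∫⁻ t in Ioc (0 : ℝ) 1, ENNReal.ofReal ((t ^ d)⁻¹) ^ (1 / ((d : ℝ) + 1)) *
          ((∫⁻ y in Q, D y ^ ((d : ℝ) + 1) ∂μ) ^ (1 / ((d : ℝ) + 1)) *
            μ Q ^ ((d : ℝ) / (d + 1)) * L) := by
        refine setLIntegral_mono' measurableSet_Ioc fun t ht => ?_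
        rw [← mul_assoc]
        gcongr
        have hpq : ((d : ℝ) + 1).HolderConjugate (((d : ℝ) + 1) / d) := by
          rw [Real.holderConjugate_iff]
          constructor
          · linarith
          · field_simp; ring
        refine (setLIntegral_le_rpow_mul_rpow_measure
          (hDc.comp (by fun_prop)).measurable.aemeasurable hpq).trans ?_
        rw [one_div_div, ← mul_assoc, ← ENNReal.mul_rpow_of_nonneg _ _ (by positivity)]
        gcongr
        exact setLIntegral_comp_homothety_le μ hQ hQm
          (hDc.measurable.pow_const _) hx ht.1 ht.2
    _ = _ := by
        rw [lintegral_mul_const _ (by fun_prop), lintegral_Ioc_rpow_inv]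
        ring

/-- Morrey's inequality on a convex set in dimension `d`, with exponent `d + 1`. -/
theorem enorm_sub_pow_mul_le_morrey {E F : Type*} [NormedAddCommGroup E] [NormedSpace ℝ E]
    [FiniteDimensional ℝ E] [MeasurableSpace E] [BorelSpace E] (μ : Measure E)
    [μ.IsAddHaarMeasure] [NormedAddCommGroup F] [NormedSpace ℝ F] [CompleteSpace F]
    (hd : 0 < Module.finrank ℝ E)
    {Q : Set E} (hQ : Convex ℝ Q) (hQm : MeasurableSet Q) (hQ0 : μ Q ≠ 0) (hQt : μ Q ≠ ⊤)
    {L : ℝ≥0∞} (hL : ∀ x ∈ Q, ∀ y ∈ Q, ‖y - x‖ₑ ≤ L) {h : E → F} (hh : ContDiff ℝ 1 h)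
    {x y : E} (hx : x ∈ Q) (hy : y ∈ Q) :
    ‖h x - h y‖ₑ ^ (Module.finrank ℝ E + 1) * μ Q ≤
      (2 * (Module.finrank ℝ E + 1) * L) ^ (Module.finrank ℝ E + 1) *
        ∫⁻ z in Q, ‖fderiv ℝ h z‖ₑ ^ (Module.finrank ℝ E + 1) ∂μ := by
  have hX := setLIntegral_enorm_sub_le_morrey μ hd hQ hQm hL hh hx
  have hY := setLIntegral_enorm_sub_le_morrey μ hd hQ hQm hL hh hy
  set d := Module.finrank ℝ E
  have hm : Measurable fun z => ‖h z - h x‖ₑ :=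
    (hh.continuous.sub continuous_const).enorm.measurable
  -- The triangle inequality through an intermediate point z, averaged over z in Q.
  have h1 : ‖h x - h y‖ₑ * μ Q
      ≤ ∫⁻ z in Q, ‖h z - h x‖ₑ ∂μ + ∫⁻ z in Q, ‖h z - h y‖ₑ ∂μ := by
    rw [← setLIntegral_const, ← lintegral_add_left hm]
    refine lintegral_mono fun z => ?_
    have : h x - h y = -(h z - h x) + (h z - h y) := by abel
    rw [this]
    exact (enorm_add_le _ _).trans (by rw [enorm_neg])
  have hof : ENNReal.ofReal ((d : ℝ) + 1) = (d : ℝ≥0∞) + 1 := by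
    rw [ENNReal.ofReal_add (by positivity) zero_le_one]; simp
  rw [hof] at hX hY
  set I := ∫⁻ z in Q, ‖fderiv ℝ h z‖ₑ ^ ((d : ℝ) + 1) ∂μ
  have hI : ∫⁻ z in Q, ‖fderiv ℝ h z‖ₑ ^ (d + 1) ∂μ = I := by
    refine lintegral_congr fun z => ?_
    rw [← ENNReal.rpow_natCast]; push_cast; rfl
  rw [hI]
  have h2 : ‖h x - h y‖ₑ * μ Q ≤ 2 * (d + 1) * L * (I ^ (1 / ((d : ℝ) + 1)) *
      μ Q ^ ((d : ℝ) / (d + 1))) := by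
    refine h1.trans ((add_le_add hX hY).trans (le_of_eq ?_))
    ring
  have h3 := pow_le_pow_left' h2 (d + 1)
  have hroot : ∀ (a : ℝ≥0∞) (s : ℝ), (a ^ (s / ((d : ℝ) + 1))) ^ (d + 1) = a ^ s := by
    intro a s
    rw [← ENNReal.rpow_natCast, ← ENNReal.rpow_mul]
    congr 1
    push_cast
    field_simp
  rw [mul_pow _ (μ Q), mul_pow (2 * ((d : ℝ≥0∞) + 1) * L), mul_pow (I ^ _), hroot, hroot, ENNReal.rpow_one,
    ENNReal.rpow_natCast, pow_succ (μ Q)] at h3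
  -- After raising to the power d + 1 the left side carries μ(Q)^{d+1} and the right side μ(Q)^d, so
  -- one factor of μ(Q) survives on the left.
  have h4 : μ Q ^ d ≠ 0 := pow_ne_zero _ hQ0
  have h5 : μ Q ^ d ≠ ⊤ := ENNReal.pow_ne_top hQt
  rw [← ENNReal.mul_le_mul_iff_left h4 h5]
  calc _ = ‖h x - h y‖ₑ ^ (d + 1) * (μ Q ^ d * μ Q) := by ring
    _ ≤ _ := h3
    _ = _ := by ring

/-! ### Cubes, coordinate slices and good boxes -/

/-- The closed cube with centre `x` and half side `R`. -/
def closedCube {n : ℕ} (x : EuclideanSpace ℝ (Fin n)) (R : ℝ) : Set (EuclideanSpace ℝ (Fin n)) :=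
  {z | ∀ k, |z k - x k| ≤ R}

theorem isClosed_closedCube {n : ℕ} (x : EuclideanSpace ℝ (Fin n)) (R : ℝ) :
    IsClosed (closedCube x R) := by
  rw [closedCube, ofPred_forall]
  exact isClosed_iInter fun k => isClosed_le (by fun_prop) continuous_const

theorem closedCube_subset_closedBall {n : ℕ} (x : EuclideanSpace ℝ (Fin n)) {R : ℝ} (hR : 0 ≤ R) :
    closedCube x R ⊆ Metric.closedBall x (n * R) := by
  intro z hz
  rw [mem_closedBall_iff_norm]
  have h1 : ‖z - x‖ ^ 2 ≤ (n * R) ^ 2 := by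
    rw [EuclideanSpace.norm_sq_eq]
    calc ∑ i, ‖(z - x) i‖ ^ 2 ≤ ∑ _i : Fin n, R ^ 2 := by
          refine Finset.sum_le_sum fun i _ => ?_
          gcongr
          exact hz i
      _ = n * R ^ 2 := by simp
      _ ≤ (n * R) ^ 2 := by
          rw [mul_pow]
          gcongr
          exact_mod_cast Nat.le_self_pow two_ne_zero n
  exact le_of_sq_le_sq h1 (by positivity)

theorem isCompact_closedCube {n : ℕ} (x : EuclideanSpace ℝ (Fin n)) {R : ℝ} (hR : 0 ≤ R) :
    IsCompact (closedCube x R) :=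
  (isCompact_closedBall x (n * R)).of_isClosed_subset (isClosed_closedCube x R)
    (closedCube_subset_closedBall x hR)

/-- The linear part of the embedding of `ℝᵈ` as a slice of `ℝᵈ⁺¹` orthogonal to the `i`-th axis. -/
noncomputable def sliceCLM {d : ℕ} (i : Fin (d + 1)) :
    (Fin d → ℝ) →L[ℝ] EuclideanSpace ℝ (Fin (d + 1)) :=
  ((EuclideanSpace.equiv (Fin (d + 1)) ℝ).symm : (Fin (d + 1) → ℝ) →L[ℝ] _).comp
    (ContinuousLinearMap.pi (i.insertNth (α := fun _ => (Fin d → ℝ) →L[ℝ] ℝ) 0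
      fun j => ContinuousLinearMap.proj j))

/-- The embedding of `ℝᵈ` as the slice `zᵢ = c` of `ℝᵈ⁺¹`. -/
noncomputable def sliceEmb {d : ℕ} (i : Fin (d + 1)) (c : ℝ) (y : Fin d → ℝ) :
    EuclideanSpace ℝ (Fin (d + 1)) :=
  WithLp.toLp 2 (i.insertNth (α := fun _ => ℝ) c y)

theorem sliceEmb_eq {d : ℕ} (i : Fin (d + 1)) (c : ℝ) (y : Fin d → ℝ) :
    sliceEmb i c y = sliceEmb i c 0 + sliceCLM i y := by
  ext k
  refine Fin.succAboveCases i ?_ (fun j => ?_) k <;> simp [sliceEmb, sliceCLM]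

theorem sliceEmb_removeNth {d : ℕ} (i : Fin (d + 1)) (z : EuclideanSpace ℝ (Fin (d + 1))) :
    sliceEmb i (z i) (fun j => z (i.succAbove j)) = z := by
  ext k
  refine Fin.succAboveCases i ?_ (fun j => ?_) k <;> simp [sliceEmb]

theorem sliceEmb_mem_closedCube {d : ℕ} (i : Fin (d + 1)) {x : EuclideanSpace ℝ (Fin (d + 1))}
    {R c : ℝ} (hR : 0 ≤ R) (hc : |c - x i| ≤ R) {y : Fin d → ℝ} :
    sliceEmb i c y ∈ closedCube x R ↔
      y ∈ Metric.closedBall (fun j => x (i.succAbove j)) R := by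
  rw [mem_closedBall_iff_norm, pi_norm_le_iff_of_nonneg hR]
  constructor
  · intro h j
    simpa [sliceEmb] using h (i.succAbove j)
  · intro h k
    refine Fin.succAboveCases i ?_ (fun j => ?_) k
    · simpa [sliceEmb] using hc
    · simpa [sliceEmb] using h j

theorem continuous_sliceEmb {d : ℕ} (i : Fin (d + 1)) :
    Continuous fun w : ℝ × (Fin d → ℝ) => sliceEmb i w.1 w.2 := by
  refine (PiLp.continuous_toLp 2 _).comp (continuous_pi fun k => ?_)
  refine Fin.succAboveCases i ?_ (fun j => ?_) k
  · simpa using continuous_fst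
  · simpa using (continuous_pi_iff.1 continuous_snd) j

/-- Fubini's theorem for the slices orthogonal to the `i`-th axis. -/
theorem lintegral_eq_lintegral_sliceEmb {d : ℕ} (i : Fin (d + 1))
    {G : EuclideanSpace ℝ (Fin (d + 1)) → ℝ≥0∞} (hG : Measurable G) :
    ∫⁻ z, G z = ∫⁻ c, ∫⁻ y, G (sliceEmb i c y) := by
  have h1 := (volume_preserving_piFinSuccAbove (fun _ : Fin (d + 1) => ℝ) i).symm
  have h2 := (EuclideanSpace.volume_preserving_symm_measurableEquiv_toLp (Fin (d + 1))).symm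
  have h3 := h2.comp h1
  rw [← h3.lintegral_comp hG]
  rw [Measure.volume_eq_prod, lintegral_prod]
  · rfl
  · exact (hG.comp h3.measurable).aemeasurable

/-- In each slab of thickness `R / 2` of a cube of half side `R`, there is a slice on which every
`C¹` map with `|Dh|ⁿ ≤ H` has oscillation controlled by the integral of `H` over the cube. -/
theorem exists_good_slice {d : ℕ} (hd : 0 < d) (i : Fin (d + 1)) :
    ∃ C : ℝ≥0, ∀ (x : EuclideanSpace ℝ (Fin (d + 1))) (R : ℝ), 0 < R →
      ∀ H : EuclideanSpace ℝ (Fin (d + 1)) → ℝ≥0∞, Measurable H →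
      ∀ α : ℝ, x i - R ≤ α → α + R / 2 ≤ x i + R →
      ∃ c ∈ Ioo α (α + R / 2),
        ∀ h : EuclideanSpace ℝ (Fin (d + 1)) → EuclideanSpace ℝ (Fin (d + 1)), ContDiff ℝ 1 h →
        (∀ z ∈ closedCube x R, ‖fderiv ℝ h z‖ₑ ^ (d + 1) ≤ H z) →
        ∀ z ∈ closedCube x R, ∀ z' ∈ closedCube x R, z i = c → z' i = c →
          ‖h z - h z'‖ₑ ^ (d + 1) ≤ C * ∫⁻ w in closedCube x R, H w := by
  -- Morrey's constant is 2(d + 1) times the diameter 2R in the sup norm, and 2R is 4 times the slab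
  -- thickness R/2. All powers of R cancel at the end because the exponent equals the ambient
  -- dimension d + 1.
  refine ⟨(8 * (d + 1)) ^ (d + 1) * ‖sliceCLM i‖₊ ^ (d + 1), ?_⟩
  intro x R hR H hH α hα1 hα2
  set Q := closedCube x R
  have hQm : MeasurableSet Q := (isClosed_closedCube x R).measurableSet
  set Y : Set (Fin d → ℝ) := Metric.closedBall (fun j => x (i.succAbove j)) R
  set S : ℝ → ℝ≥0∞ := fun c => ∫⁻ y : Fin d → ℝ in Y, H (sliceEmb i c y)
  have hSm : Measurable S := by
    have : Measurable fun w : ℝ × (Fin d → ℝ) => H (sliceEmb i w.1 w.2) :=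
      hH.comp (continuous_sliceEmb i).measurable
    exact this.lintegral_prod_right'
  have hcx : ∀ c ∈ Ioo α (α + R / 2), |c - x i| ≤ R := fun c hc => by
    rw [abs_le]; constructor <;> linarith [hc.1, hc.2]
  have hS : ∫⁻ c in Ioo α (α + R / 2), S c ≤ ∫⁻ w in Q, H w := by
    rw [← lintegral_indicator hQm, lintegral_eq_lintegral_sliceEmb i (hH.indicator hQm)]
    refine (setLIntegral_mono' measurableSet_Ioo fun c hc => ?_).trans
      (setLIntegral_le_lintegral _ _)
    change ∫⁻ y in Y, H (sliceEmb i c y) ≤ _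
    rw [← lintegral_indicator (measurableSet_closedBall : MeasurableSet Y)]
    refine lintegral_mono fun y => ?_
    by_cases hy : y ∈ Y
    · rw [indicator_of_mem hy,
        indicator_of_mem ((sliceEmb_mem_closedCube i hR.le (hcx c hc)).2 hy)]
    · rw [indicator_of_notMem hy]; exact zero_le
  set μI := (volume : Measure ℝ).restrict (Ioo α (α + R / 2))
  have hμI : μI univ = ENNReal.ofReal (R / 2) := by
    simp [μI]
  have : IsFiniteMeasure μI := ⟨by rw [hμI]; exact ENNReal.ofReal_lt_top⟩
  have hμ0 : μI ≠ 0 := by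
    rw [← Measure.measure_univ_ne_zero, hμI]
    simpa using hR
  -- The slice is one on which the integral of H does not exceed its average over the slab. The
  -- choice depends on H alone, so one slice serves every map of an approximating sequence.
  obtain ⟨c, hc, hcS⟩ := exists_notMem_null_le_laverage (N := (Ioo α (α + R / 2))ᶜ) hμ0
    hSm.aemeasurable (by rw [Measure.restrict_apply measurableSet_Ioo.compl]; simp)
  rw [notMem_compl_iff] at hc
  refine ⟨c, hc, fun h hh hhH z hz z' hz' hzc hzc' => ?_⟩
  have hS2 : S c * ENNReal.ofReal (R / 2) ≤ ∫⁻ w in Q, H w := by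
    rw [laverage_eq, hμI] at hcS
    exact (ENNReal.mul_le_of_le_div hcS).trans hS
  have hmem : ∀ w ∈ Q, w i = c → ∃ y ∈ Y, sliceEmb i c y = w := by
    intro w hw hwc
    have := sliceEmb_removeNth i w
    rw [hwc] at this
    refine ⟨_, ?_, this⟩
    rw [← sliceEmb_mem_closedCube i hR.le (hcx c hc), this]
    exact hw
  obtain ⟨y, hy, rfl⟩ := hmem z hz hzc
  obtain ⟨y', hy', rfl⟩ := hmem z' hz' hzc'
  have hemb : ∀ y, HasFDerivAt (sliceEmb i c) (sliceCLM i) y := fun y => by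
    have := (sliceCLM i).hasFDerivAt (x := y) |>.const_add (sliceEmb i c 0)
    exact this.congr_of_eventuallyEq (Filter.Eventually.of_forall fun y => sliceEmb_eq i c y)
  have hembC : ContDiff ℝ 1 (sliceEmb i c) := by
    rw [funext (sliceEmb_eq i c)]
    exact contDiff_const.add (sliceCLM i).contDiff
  have hYv : volume Y = ENNReal.ofReal ((2 * R) ^ d) := by
    simp [Y, Real.volume_pi_closedBall _ hR.le]
  have hYc : Convex ℝ Y := convex_closedBall _ _
  have hL : ∀ y ∈ Y, ∀ y' ∈ Y, ‖y' - y‖ₑ ≤ ENNReal.ofReal (2 * R) := fun y hy y' hy' => by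
    rw [← ofReal_norm, ← dist_eq_norm]
    exact ENNReal.ofReal_le_ofReal ((dist_triangle_right _ _ _).trans
      (by linarith [Metric.mem_closedBall.1 hy, Metric.mem_closedBall.1 hy']))
  have hfin : Module.finrank ℝ (Fin d → ℝ) = d := by simp
  have key := enorm_sub_pow_mul_le_morrey (volume : Measure (Fin d → ℝ)) (by rwa [hfin]) hYc
    measurableSet_closedBall (by rw [hYv]; simpa using by positivity)
    (by rw [hYv]; exact ENNReal.ofReal_ne_top) hL (hh.comp hembC) hy hy'
  rw [hfin, hYv] at key
  have hder : ∫⁻ w in Y, ‖fderiv ℝ (h ∘ sliceEmb i c) w‖ₑ ^ (d + 1)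
      ≤ ‖sliceCLM i‖ₑ ^ (d + 1) * S c := by
    rw [← lintegral_const_mul' _ _ (ENNReal.pow_ne_top enorm_ne_top)]
    refine setLIntegral_mono' measurableSet_closedBall fun w hw => ?_
    rw [(((hh.differentiable one_ne_zero) _).hasFDerivAt.comp w (hemb w)).fderiv]
    calc _ ≤ (‖fderiv ℝ h (sliceEmb i c w)‖ₑ * ‖sliceCLM i‖ₑ) ^ (d + 1) := by
          gcongr
          exact ContinuousLinearMap.opENorm_comp_le _ _
      _ ≤ _ := by
          rw [mul_pow, mul_comm]
          gcongr
          exact hhH _ ((sliceEmb_mem_closedCube i hR.le (hcx c hc)).2 hw)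
  have hR2 : ENNReal.ofReal (R / 2) ≠ 0 := by simpa using hR
  have hR3 : ENNReal.ofReal ((2 * R) ^ d) ≠ 0 := by simpa using by positivity
  rw [← ENNReal.mul_le_mul_iff_left hR3 ENNReal.ofReal_ne_top,
    ← ENNReal.mul_le_mul_iff_left hR2 ENNReal.ofReal_ne_top]
  set s := ENNReal.ofReal (R / 2)
  have e1 : ENNReal.ofReal (2 * R) = 4 * s := by
    rw [show (4 : ℝ≥0∞) = ENNReal.ofReal 4 by simp, ← ENNReal.ofReal_mul (by norm_num)]
    congr 1; ring
  calc ‖h (sliceEmb i c y) - h (sliceEmb i c y')‖ₑ ^ (d + 1) * ENNReal.ofReal ((2 * R) ^ d) * s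
      ≤ (2 * ((d : ℝ≥0∞) + 1) * ENNReal.ofReal (2 * R)) ^ (d + 1) *
        (‖sliceCLM i‖ₑ ^ (d + 1) * S c) * s :=
        mul_le_mul_left (key.trans (mul_le_mul_right hder _)) _
    _ = (2 * ((d : ℝ≥0∞) + 1) * (4 * s)) ^ (d + 1) * ‖sliceCLM i‖ₑ ^ (d + 1) * (S c * s) := by
        rw [e1]; ring
    _ ≤ (2 * ((d : ℝ≥0∞) + 1) * (4 * s)) ^ (d + 1) * ‖sliceCLM i‖ₑ ^ (d + 1) *
        ∫⁻ w in Q, H w := by gcongr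
    _ = (8 * ((d : ℝ≥0∞) + 1)) ^ (d + 1) * ‖sliceCLM i‖ₑ ^ (d + 1) * (∫⁻ w in Q, H w) *
        s ^ d * s := by
        rw [show 2 * ((d : ℝ≥0∞) + 1) * (4 * s) = 8 * ((d : ℝ≥0∞) + 1) * s by ring, mul_pow _ s]
        ring
    _ ≤ (8 * ((d : ℝ≥0∞) + 1)) ^ (d + 1) * ‖sliceCLM i‖ₑ ^ (d + 1) * (∫⁻ w in Q, H w) *
        (4 * s) ^ d * s := by
        gcongr
        exact le_mul_of_one_le_left zero_le (by norm_num)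
    _ = _ := by
        rw [ENNReal.ofReal_pow (by positivity), e1, enorm_eq_nnnorm]
        push_cast
        ring

/-- Every cube contains a box, with the same centre and at least half the size, on whose faces every
`C¹` map with `|Dh|ⁿ ≤ H` has oscillation controlled by the integral of `H` over the cube. -/
theorem exists_good_box {d : ℕ} (hd : 0 < d) :
    ∃ C : ℝ≥0, ∀ (x : EuclideanSpace ℝ (Fin (d + 1))) (R : ℝ), 0 < R →
      ∀ H : EuclideanSpace ℝ (Fin (d + 1)) → ℝ≥0∞, Measurable H →
      ∃ a b : Fin (d + 1) → ℝ, (∀ i, a i ∈ Ioo (x i - R) (x i - R / 2)) ∧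
        (∀ i, b i ∈ Ioo (x i + R / 2) (x i + R)) ∧
        ∀ h : EuclideanSpace ℝ (Fin (d + 1)) → EuclideanSpace ℝ (Fin (d + 1)), ContDiff ℝ 1 h →
        (∀ z ∈ closedCube x R, ‖fderiv ℝ h z‖ₑ ^ (d + 1) ≤ H z) →
        ∀ z ∈ closedCube x R, ∀ z' ∈ closedCube x R, (∃ i, z i = a i ∨ z i = b i) →
          (∃ i, z' i = a i ∨ z' i = b i) →
          ‖h z - h z'‖ₑ ^ (d + 1) ≤ C * ∫⁻ w in closedCube x R, H w := by
  choose C hC using exists_good_slice hd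
  refine ⟨3 ^ (d + 1) * ∑ i, C i, fun x R hR H hH => ?_⟩
  have hA := fun i => hC i x R hR H hH (x i - R) le_rfl (by linarith)
  have hB := fun i => hC i x R hR H hH (x i + R / 2) (by linarith) (by linarith)
  choose a ha ha' using hA
  choose b hb hb' using hB
  refine ⟨a, b, fun i => ⟨(ha i).1, by linarith [(ha i).2]⟩,
    fun i => ⟨(hb i).1, by linarith [(hb i).2]⟩, fun h hh hhH => ?_⟩
  set Q := closedCube x R
  set D : ℝ≥0∞ := ((∑ i, C i : ℝ≥0) * ∫⁻ w in Q, H w) ^ (1 / ((d + 1 : ℕ) : ℝ))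
  have hD : D ^ (d + 1) = (∑ i, C i : ℝ≥0) * ∫⁻ w in Q, H w := by
    rw [← ENNReal.rpow_natCast, ← ENNReal.rpow_mul, one_div_mul_cancel (by positivity),
      ENNReal.rpow_one]
  have hslice : ∀ i c, (c = a i ∨ c = b i) → ∀ z ∈ Q, ∀ z' ∈ Q, z i = c → z' i = c →
      ‖h z - h z'‖ₑ ≤ D := by
    intro i c hc z hz z' hz' hzc hzc'
    rw [← ENNReal.pow_le_pow_left_iff (n := d + 1) (by omega), hD]
    have hCi : (C i : ℝ≥0∞) ≤ (∑ i, C i : ℝ≥0) := by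
      exact_mod_cast Finset.single_le_sum (fun _ _ => zero_le) (Finset.mem_univ i)
    refine le_trans ?_ (mul_le_mul_left hCi _)
    rcases hc with rfl | rfl
    · exact ha' i h hh hhH z hz z' hz' hzc hzc'
    · exact hb' i h hh hhH z hz z' hz' hzc hzc'
  have habs : ∀ i c, (c = a i ∨ c = b i) → |c - x i| ≤ R := by
    rintro i c (rfl | rfl)
    · rw [abs_le]; constructor <;> linarith [(ha i).1, (ha i).2]
    · rw [abs_le]; constructor <;> linarith [(hb i).1, (hb i).2]
  -- Faces orthogonal to different axes meet inside the cube, so oscillation bounds can be chained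
  -- through a common point.
  have hcross : ∀ i j c c', i ≠ j → (c = a i ∨ c = b i) → (c' = a j ∨ c' = b j) →
      ∃ w ∈ Q, w i = c ∧ w j = c' := by
    intro i j c c' hij hc hc'
    refine ⟨WithLp.toLp 2 (Function.update (Function.update x i c) j c'), fun k => ?_, ?_, ?_⟩
    · by_cases hk : k = j
      · subst hk; simpa using habs _ _ hc'
      · by_cases hk' : k = i
        · subst hk'; simpa [hk] using habs _ _ hc
        · simpa [hk, hk'] using hR.le
    · simp [hij]
    · simp
  have htri : ∀ u v w, ‖h u - h w‖ₑ ≤ ‖h u - h v‖ₑ + ‖h v - h w‖ₑ := fun u v w => by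
    rw [← sub_add_sub_cancel (h u) (h v) (h w)]
    exact enorm_add_le _ _
  have htwo : ∀ i j c c', i ≠ j → (c = a i ∨ c = b i) → (c' = a j ∨ c' = b j) →
      ∀ z ∈ Q, ∀ z' ∈ Q, z i = c → z' j = c' → ‖h z - h z'‖ₑ ≤ 2 * D := by
    intro i j c c' hij hc hc' z hz z' hz' hzc hzc'
    obtain ⟨w, hw, hwi, hwj⟩ := hcross i j c c' hij hc hc'
    rw [two_mul]
    exact (htri z w z').trans (add_le_add (hslice i c hc z hz w hw hzc hwi)
      (hslice j c' hc' w hw z' hz' hwj hzc'))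
  intro z hz z' hz' ⟨i, hi⟩ ⟨j, hj⟩
  -- Two opposite faces are joined through a face orthogonal to a third coordinate index `k ≠ i`,
  -- which exists because the dimension is at least 2. At most three slices are used, whence the
  -- factor 3^{d+1}.
  have hthree : ‖h z - h z'‖ₑ ≤ 3 * D := by
    by_cases hij : i = j
    · subst hij
      have : Nontrivial (Fin (d + 1)) := Fin.nontrivial_iff_two_le.2 (by omega)
      obtain ⟨k, hk⟩ := exists_ne i
      obtain ⟨w, hw, hwi, hwk⟩ := hcross i k (z' i) (a k) hk.symm hj (Or.inl rfl)
      rw [show (3 : ℝ≥0∞) = 2 + 1 by norm_num, add_mul, one_mul]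
      exact (htri z w z').trans (add_le_add
        (htwo i k _ _ hk.symm hi (Or.inl rfl) z hz w hw rfl hwk)
        (hslice i _ hj w hw z' hz' hwi rfl))
    · refine (htwo i j _ _ hij hi hj z hz z' hz' rfl rfl).trans ?_
      gcongr
      norm_num
  calc ‖h z - h z'‖ₑ ^ (d + 1) ≤ (3 * D) ^ (d + 1) := by gcongr
    _ = _ := by
        rw [mul_pow, hD]
        push_cast
        ring

/-! ### Mollification and dominated smooth approximation -/

open scoped Convolution in
/-- Convolution with a normalised bump function does not increase the `Lᵖ` norm. -/
theorem lintegral_enorm_convolution_normed_rpow_le {E F : Type*} [NormedAddCommGroup E]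
    [NormedSpace ℝ E] [FiniteDimensional ℝ E] [MeasurableSpace E] [BorelSpace E]
    {μ : Measure E} [μ.IsAddHaarMeasure] [NormedAddCommGroup F] [NormedSpace ℝ F]
    (φ : ContDiffBump (0 : E)) {k : E → F} (hk : AEStronglyMeasurable k μ) {p : ℝ} (hp : 1 < p) :
    ∫⁻ x, ‖(φ.normed μ ⋆[ContinuousLinearMap.lsmul ℝ ℝ, μ] k) x‖ₑ ^ p ∂μ
      ≤ ∫⁻ x, ‖k x‖ₑ ^ p ∂μ := by
  have hp0 : 0 < p := by linarith
  obtain ⟨k', hk', hkk'⟩ := hk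
  rw [convolution_congr _ (Filter.EventuallyEq.refl _ _) hkk',
    lintegral_congr_ae (f := fun x => ‖k x‖ₑ ^ p) (g := fun x => ‖k' x‖ₑ ^ p) (by filter_upwards [hkk'] with x hx; rw [hx])]
  set w : E → ℝ≥0∞ := fun t => ENNReal.ofReal (φ.normed μ t)
  have hw : Measurable w := φ.continuous_normed.measurable.ennreal_ofReal
  have hw1 : ∫⁻ t, w t ∂μ = 1 := by
    rw [← ofReal_integral_eq_lintegral_ofReal φ.integrable_normed
      (Filter.Eventually.of_forall φ.nonneg_normed), φ.integral_normed, ENNReal.ofReal_one]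
  have hmeas : Measurable fun z : E × E => ‖k' (z.1 - z.2)‖ₑ :=
    (hk'.comp_measurable (measurable_fst.sub measurable_snd)).enorm
  -- Jensen's inequality for the probability measure with density φ; Tonelli and translation
  -- invariance then finish.
  have hpt : ∀ x, ‖(φ.normed μ ⋆[ContinuousLinearMap.lsmul ℝ ℝ, μ] k') x‖ₑ ^ p
      ≤ ∫⁻ t, w t * ‖k' (x - t)‖ₑ ^ p ∂μ := by
    intro x
    have hx : Measurable fun t => ‖k' (x - t)‖ₑ := hmeas.comp (measurable_const.prodMk measurable_id)
    have h1 : ‖(φ.normed μ ⋆[ContinuousLinearMap.lsmul ℝ ℝ, μ] k') x‖ₑ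
        ≤ ∫⁻ t, ‖k' (x - t)‖ₑ ∂(μ.withDensity w) := by
      rw [lintegral_withDensity_eq_lintegral_mul _ hw hx]
      refine (enorm_integral_le_lintegral_enorm _).trans (lintegral_mono fun t => ?_)
      simp only [ContinuousLinearMap.lsmul_apply, enorm_smul, Pi.mul_apply, w]
      rw [Real.enorm_of_nonneg (φ.nonneg_normed _)]
    have h2 := setLIntegral_le_rpow_mul_rpow_measure (μ := μ.withDensity w) (Q := univ)
      hx.aemeasurable (Real.HolderConjugate.conjExponent hp)
    simp only [Measure.restrict_univ, withDensity_apply _ MeasurableSet.univ, hw1,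
      ENNReal.one_rpow, mul_one] at h2
    refine le_of_le_of_eq ?_ (lintegral_withDensity_eq_lintegral_mul _ hw (hx.pow_const p))
    calc _ ≤ ((∫⁻ t, ‖k' (x - t)‖ₑ ^ p ∂(μ.withDensity w)) ^ (1 / p)) ^ p := by
          gcongr
          exact h1.trans h2
      _ = _ := by
          rw [← ENNReal.rpow_mul, one_div_mul_cancel hp0.ne', ENNReal.rpow_one]
  calc _ ≤ ∫⁻ x, ∫⁻ t, w t * ‖k' (x - t)‖ₑ ^ p ∂μ ∂μ := lintegral_mono hpt
    _ = ∫⁻ t, ∫⁻ x, w t * ‖k' (x - t)‖ₑ ^ p ∂μ ∂μ :=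
        lintegral_lintegral_swap ((hw.comp measurable_snd).mul (hmeas.pow_const p)).aemeasurable
    _ = ∫⁻ t, w t * ∫⁻ x, ‖k' x‖ₑ ^ p ∂μ ∂μ := by
        refine lintegral_congr fun t => ?_
        have ht : Measurable fun x => ‖k' (x - t)‖ₑ :=
          hmeas.comp (measurable_id.prodMk measurable_const)
        rw [lintegral_const_mul _ (ht.pow_const p),
          lintegral_sub_right_eq_self (fun x => ‖k' x‖ₑ ^ p) t]
    _ = _ := by rw [lintegral_mul_const _ hw, hw1, one_mul]

open scoped Convolution in
/-- Mollifications converge in `Lᵖ`. -/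
theorem exists_forall_lintegral_convolution_normed_sub_rpow_le {E F : Type*}
    [NormedAddCommGroup E] [NormedSpace ℝ E] [FiniteDimensional ℝ E] [MeasurableSpace E]
    [BorelSpace E] {μ : Measure E} [μ.IsAddHaarMeasure] [NormedAddCommGroup F] [NormedSpace ℝ F]
    [CompleteSpace F] {p : ℝ} (hp : 1 < p) {G : E → F} (hG : MemLp G (ENNReal.ofReal p) μ)
    {η : ℝ≥0∞} (hη : η ≠ 0) :
    ∃ ε > 0, ∀ φ : ContDiffBump (0 : E), φ.rOut < ε →
      ∫⁻ x, ‖(φ.normed μ ⋆[ContinuousLinearMap.lsmul ℝ ℝ, μ] G) x - G x‖ₑ ^ p ∂μ ≤ η := by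
  have hp0 : 0 < p := by linarith
  have hP0 : ENNReal.ofReal p ≠ 0 := by simpa using hp0
  have hP1 : 1 ≤ ENNReal.ofReal p := by simpa using hp.le
  have hnorm : ∀ u : E → F, eLpNorm u (ENNReal.ofReal p) μ = (∫⁻ x, ‖u x‖ₑ ^ p ∂μ) ^ (1 / p) := by
    intro u
    rw [eLpNorm_eq_lintegral_rpow_enorm_toReal hP0 ENNReal.ofReal_ne_top,
      ENNReal.toReal_ofReal hp0.le]
  obtain ⟨δ, hδ0, hδ⟩ : ∃ δ : ℝ≥0∞, δ ≠ 0 ∧ (3 * δ) ^ p ≤ η := by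
    have hcont : Filter.Tendsto (fun δ : ℝ≥0∞ => (3 * δ) ^ p) (nhds 0) (nhds 0) := by
      have h1 : Continuous fun δ : ℝ≥0∞ => (3 * δ) ^ p :=
        (ENNReal.continuous_rpow_const).comp (ENNReal.continuous_const_mul (by norm_num))
      simpa [hp0] using h1.tendsto 0
    obtain ⟨δ, hδ, hδ'⟩ := (((hcont.eventually (gt_mem_nhds (pos_iff_ne_zero.2 hη))).filter_mono
      (nhdsWithin_le_nhds (s := Ioi 0))).and self_mem_nhdsWithin).exists
    exact ⟨δ, (pos_iff_ne_zero.1 hδ'), hδ.le⟩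
  -- G is replaced by a continuous compactly supported g. Mollification converges uniformly for g on
  -- a compact neighbourhood of its support and is a contraction on G - g. The three errors are each
  -- at most δ.
  obtain ⟨g, hgc, hgG, hgcont, hgL⟩ := hG.exists_hasCompactSupport_eLpNorm_sub_le
    ENNReal.ofReal_ne_top hδ0
  have hGl : LocallyIntegrable G μ := hG.locallyIntegrable hP1
  have hgl : LocallyIntegrable g μ := hgcont.locallyIntegrable
  set K := Metric.cthickening 1 (tsupport g)
  have hK : IsCompact K := hgc.isCompact.cthickening
  obtain ⟨τ, hτ0, hτ⟩ : ∃ τ : ℝ, 0 < τ ∧ ENNReal.ofReal τ ^ p * μ K ≤ δ ^ p := by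
    have hcont : Filter.Tendsto (fun τ : ℝ => ENNReal.ofReal τ ^ p * μ K) (nhds 0) (nhds 0) := by
      have h1 : Continuous fun τ : ℝ => ENNReal.ofReal τ ^ p * μ K :=
        (ENNReal.continuous_mul_const hK.measure_lt_top.ne).comp
          (ENNReal.continuous_rpow_const.comp ENNReal.continuous_ofReal)
      simpa [hp0] using h1.tendsto 0
    have hδp : 0 < δ ^ p := by
      refine pos_iff_ne_zero.2 fun h => hδ0 ?_
      rcases ENNReal.rpow_eq_zero_iff.1 h with h | h
      · exact h.1
      · linarith [h.2]
    obtain ⟨τ, h, h'⟩ := (((hcont.eventually (gt_mem_nhds hδp)).filter_mono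
      (nhdsWithin_le_nhds (s := Ioi 0))).and self_mem_nhdsWithin).exists
    exact ⟨τ, h', h.le⟩
  obtain ⟨ε, hε0, hε⟩ := Metric.uniformContinuous_iff.1
    (hgcont.uniformContinuous_of_tendsto_cocompact (x := 0)
      hgc.is_zero_at_infty) τ hτ0
  refine ⟨min ε 1, by positivity, fun φ hφ => ?_⟩
  have hlc : ∀ u : E → F, LocallyIntegrable u μ →
      Continuous (φ.normed μ ⋆[ContinuousLinearMap.lsmul ℝ ℝ, μ] u) := fun u hu =>
    φ.hasCompactSupport_normed.continuous_convolution_left _ φ.continuous_normed hu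
  have hex : ∀ u : E → F, LocallyIntegrable u μ → ConvolutionExists (φ.normed μ) u
      (ContinuousLinearMap.lsmul ℝ ℝ) μ := fun u hu =>
    φ.hasCompactSupport_normed.convolutionExists_left _ φ.continuous_normed hu
  have hgbound : eLpNorm (fun x => (φ.normed μ ⋆[ContinuousLinearMap.lsmul ℝ ℝ, μ] g) x - g x)
      (ENNReal.ofReal p) μ ≤ δ := by
    rw [hnorm, one_div, ENNReal.rpow_inv_le_iff hp0]
    refine le_trans ?_ hτ
    rw [← setLIntegral_const, ← lintegral_indicator hK.measurableSet]
    refine lintegral_mono fun x => ?_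
    by_cases hx : x ∈ K
    · rw [indicator_of_mem hx]
      gcongr
      rw [← ofReal_norm, ← dist_eq_norm]
      refine ENNReal.ofReal_le_ofReal (φ.dist_normed_convolution_le
        hgcont.aestronglyMeasurable fun y hy => ?_)
      exact (hε ((Metric.mem_ball.1 hy).trans (hφ.trans_le (min_le_left _ _)))).le
    · have hz : ∀ y ∈ Metric.ball x φ.rOut, g y = 0 := by
        intro y hy
        by_contra hgy
        exact hx (Metric.mem_cthickening_of_dist_le x y 1 _
          (subset_tsupport _ hgy) (by
            rw [dist_comm]
            exact ((Metric.mem_ball.1 hy).trans (hφ.trans_le (min_le_right _ _))).le))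
      have hxx := hz x (Metric.mem_ball_self φ.rOut_pos)
      rw [φ.normed_convolution_eq_right fun y hy => (hz y hy).trans hxx.symm]
      simp [hp0]
  have hdecomp : (fun x => (φ.normed μ ⋆[ContinuousLinearMap.lsmul ℝ ℝ, μ] G) x - G x)
      = (φ.normed μ ⋆[ContinuousLinearMap.lsmul ℝ ℝ, μ] (G - g))
        + ((fun x => (φ.normed μ ⋆[ContinuousLinearMap.lsmul ℝ ℝ, μ] g) x - g x) + (g - G)) := by
    have h1 := (hex _ (hGl.sub hgl)).distrib_add (hex _ hgl)
    rw [sub_add_cancel] at h1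
    ext x
    rw [h1]
    simp only [Pi.add_apply, Pi.sub_apply]
    abel
  have hY : eLpNorm (φ.normed μ ⋆[ContinuousLinearMap.lsmul ℝ ℝ, μ] (G - g)) (ENNReal.ofReal p) μ
      ≤ δ := by
    refine le_trans ?_ hgG
    rw [hnorm, hnorm]
    refine ENNReal.rpow_le_rpow ?_ (by positivity)
    exact lintegral_enorm_convolution_normed_rpow_le φ
      (hG.aestronglyMeasurable.sub hgL.aestronglyMeasurable) hp
  have htot : eLpNorm (fun x => (φ.normed μ ⋆[ContinuousLinearMap.lsmul ℝ ℝ, μ] G) x - G x)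
      (ENNReal.ofReal p) μ ≤ 3 * δ := by
    rw [hdecomp]
    refine (eLpNorm_add_le (hlc _ (hGl.sub hgl)).aestronglyMeasurable
      (((hlc _ hgl).sub hgcont).aestronglyMeasurable.add
        (hgL.aestronglyMeasurable.sub hG.aestronglyMeasurable)) hP1).trans ?_
    refine (add_le_add hY (eLpNorm_add_le ((hlc _ hgl).sub hgcont).aestronglyMeasurable
        (hgL.aestronglyMeasurable.sub hG.aestronglyMeasurable) hP1)).trans ?_
    refine (add_le_add le_rfl (add_le_add hgbound
      ((eLpNorm_sub_comm g G _ _).trans_le hgG))).trans (le_of_eq ?_)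
    ring
  rw [hnorm] at htot
  refine le_trans ?_ hδ
  calc _ = ((∫⁻ x, ‖(φ.normed μ ⋆[ContinuousLinearMap.lsmul ℝ ℝ, μ] G) x - G x‖ₑ ^ p ∂μ)
        ^ (1 / p)) ^ p := by
        rw [← ENNReal.rpow_mul, one_div_mul_cancel hp0.ne', ENNReal.rpow_one]
    _ ≤ _ := by gcongr

/-- The mollification of the restriction of `G` to `C`. -/
noncomputable def mollification {n : ℕ} {F : Type*} [NormedAddCommGroup F] [NormedSpace ℝ F]
    (φ : ContDiffBump (0 : EuclideanSpace ℝ (Fin n))) (C : Set (EuclideanSpace ℝ (Fin n)))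
    (G : EuclideanSpace ℝ (Fin n) → F) (x : EuclideanSpace ℝ (Fin n)) : F :=
  ∫ t in C, φ.normed volume (x - t) • G t

open scoped Convolution in
theorem mollification_eq_convolution {n : ℕ} {F : Type*} [NormedAddCommGroup F] [NormedSpace ℝ F]
    (φ : ContDiffBump (0 : EuclideanSpace ℝ (Fin n))) {C : Set (EuclideanSpace ℝ (Fin n))}
    (hC : MeasurableSet C) (G : EuclideanSpace ℝ (Fin n) → F) :
    mollification φ C G
      = φ.normed volume ⋆[ContinuousLinearMap.lsmul ℝ ℝ, volume] C.indicator G := by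
  ext x
  rw [convolution_lsmul_swap, mollification, ← integral_indicator hC]
  congr 1
  ext t
  by_cases ht : t ∈ C <;> simp [ht]

theorem contDiff_mollification {n : ℕ} {F : Type*} [NormedAddCommGroup F] [NormedSpace ℝ F]
    [CompleteSpace F] (φ : ContDiffBump (0 : EuclideanSpace ℝ (Fin n)))
    {C : Set (EuclideanSpace ℝ (Fin n))} (hC : MeasurableSet C)
    {G : EuclideanSpace ℝ (Fin n) → F} (hG : IntegrableOn G C) :
    ContDiff ℝ 1 (mollification φ C G) := by
  rw [mollification_eq_convolution φ hC]
  exact φ.hasCompactSupport_normed.contDiff_convolution_left (n := 1) _ φ.contDiff_normed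
    (hG.integrable_indicator hC).locallyIntegrable

theorem exists_forall_lintegral_mollification_sub_rpow_le {n : ℕ} {F : Type*}
    [NormedAddCommGroup F] [NormedSpace ℝ F] [CompleteSpace F] {p : ℝ} (hp : 1 < p)
    {C C' : Set (EuclideanSpace ℝ (Fin n))} (hC : MeasurableSet C) (hC' : MeasurableSet C')
    (hCC' : C ⊆ C') {G : EuclideanSpace ℝ (Fin n) → F}
    (hG : MemLp G (ENNReal.ofReal p) (volume.restrict C')) {η : ℝ≥0∞} (hη : η ≠ 0) :
    ∃ ε > 0, ∀ φ : ContDiffBump (0 : EuclideanSpace ℝ (Fin n)), φ.rOut < ε →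
      ∫⁻ x in C, ‖mollification φ C' G x - G x‖ₑ ^ p ≤ η := by
  have hG' : MemLp (C'.indicator G) (ENNReal.ofReal p) volume :=
    (memLp_indicator_iff_restrict hC').2 hG
  obtain ⟨ε, hε0, hε⟩ := exists_forall_lintegral_convolution_normed_sub_rpow_le hp hG' hη
  refine ⟨ε, hε0, fun φ hφ => le_trans (le_trans (le_of_eq ?_)
    (setLIntegral_le_lintegral C _)) (hε φ hφ)⟩
  refine setLIntegral_congr_fun hC fun x hx => ?_
  rw [mollification_eq_convolution φ hC', indicator_of_mem (hCC' hx)]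

/-- The derivative of a mollification is the mollification of the weak differential. -/
theorem HasWeakDifferential.hasFDerivAt_mollification {n : ℕ}
    {Ω : Set (EuclideanSpace ℝ (Fin n))}
    {f : EuclideanSpace ℝ (Fin n) → EuclideanSpace ℝ (Fin n)}
    {Df : EuclideanSpace ℝ (Fin n) → EuclideanSpace ℝ (Fin n) →L[ℝ] EuclideanSpace ℝ (Fin n)}
    (hf : HasWeakDifferential Ω f Df) {C : Set (EuclideanSpace ℝ (Fin n))} (hC : IsCompact C)
    (hCΩ : C ⊆ Ω) (φ : ContDiffBump (0 : EuclideanSpace ℝ (Fin n)))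
    {x : EuclideanSpace ℝ (Fin n)} (hx : Metric.closedBall x φ.rOut ⊆ C) :
    HasFDerivAt (mollification φ C f) (mollification φ C Df x) x := by
  have hfC : Integrable (C.indicator f) :=
    (hf.locallyIntegrableOn.integrableOn_compact_subset hCΩ hC).integrable_indicator
      hC.measurableSet
  have hDfC : IntegrableOn Df C := hf.locallyIntegrableOn_deriv.integrableOn_compact_subset hCΩ hC
  have hφs := φ.hasCompactSupport_normed (μ := (volume : Measure (EuclideanSpace ℝ (Fin n))))
  have hφC : ContDiff ℝ ∞ (φ.normed (volume : Measure (EuclideanSpace ℝ (Fin n)))) :=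
    φ.contDiff_normed
  have hmE := mollification_eq_convolution φ hC.measurableSet f
  have hmD : mollification φ C Df x = ∫ t in C, φ.normed volume (x - t) • Df t := rfl
  have hsuppφ := φ.support_normed_eq (μ := (volume : Measure (EuclideanSpace ℝ (Fin n))))
  rw [hmE, hmD]
  generalize φ.normed (volume : Measure (EuclideanSpace ℝ (Fin n))) = Φ at *
  have h1 := hφs.hasFDerivAt_convolution_left (ContinuousLinearMap.lsmul ℝ ℝ)
    (hφC.of_le (by exact_mod_cast le_top)) hfC.locallyIntegrable x
  refine h1.congr_fderiv (Eq.symm ?_)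
  have hΦd : ContDiff ℝ 0 (fderiv ℝ Φ) :=
    hφC.fderiv_right (m := 0) (by exact_mod_cast le_top)
  have hex1 : ConvolutionExistsAt (fderiv ℝ Φ) (C.indicator f) x
      ((ContinuousLinearMap.lsmul ℝ ℝ).precompL (EuclideanSpace ℝ (Fin n))) volume :=
    (hφs.fderiv ℝ).convolutionExists_left _ hΦd.continuous hfC.locallyIntegrable x
  have hex2 : IntegrableOn (fun t => Φ (x - t) • Df t) C :=
    hDfC.continuousOn_smul (hφC.continuous.comp (continuous_const.sub continuous_id)).continuousOn
      hC
  have hsupp : tsupport (fun t => Φ (x - t)) ⊆ Metric.closedBall x φ.rOut := by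
    refine closure_minimal (fun t ht => ?_) Metric.isClosed_closedBall
    have : x - t ∈ Function.support Φ := ht
    rw [hsuppφ, mem_ball_zero_iff] at this
    rw [mem_closedBall_iff_norm, norm_sub_rev]
    exact this.le
  have hcomp : HasCompactSupport fun t => Φ (x - t) :=
    (isCompact_closedBall x φ.rOut).of_isClosed_subset (isClosed_tsupport _) hsupp
  -- The reflected bump t ↦ Φ(x - t) is an admissible test function. Reflection changes the sign of
  -- its derivative, which cancels the minus sign in the definition of the weak differential.
  have hψ : ContDiff ℝ ∞ fun t => Φ (x - t) := hφC.comp (contDiff_const.sub contDiff_id)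
  ext1 v
  have hdψ : ∀ t, fderiv ℝ (fun t => Φ (x - t)) t v = -(fderiv ℝ Φ (x - t) v) := fun t => by
    have h2 : HasFDerivAt (fun t => Φ (x - t)) _ t :=
      ((hφC.differentiable (by simp)) (x - t)).hasFDerivAt.comp t
        ((hasFDerivAt_id t).const_sub x)
    rw [h2.fderiv]
    simp
  have hweak := hf.integral_eq _ hψ hcomp (hsupp.trans (hx.trans hCΩ)) v
  have hzero : ∀ t ∉ C, Φ (x - t) = 0 ∧ fderiv ℝ Φ (x - t) v = 0 := by
    intro t ht
    have ht' : t ∉ tsupport fun t => Φ (x - t) := fun h => ht (hx (hsupp h))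
    refine ⟨image_eq_zero_of_notMem_tsupport (f := fun t => Φ (x - t)) ht', ?_⟩
    have h2 : t ∉ tsupport (fderiv ℝ fun t => Φ (x - t)) :=
      fun h => ht' (tsupport_fderiv_subset ℝ h)
    have h3 := hdψ t
    rw [image_eq_zero_of_notMem_tsupport h2] at h3
    simpa using h3.symm
  have hL : ∫ t in Ω, fderiv ℝ (fun t => Φ (x - t)) t v • f t
      = -∫ t, fderiv ℝ Φ (x - t) v • C.indicator f t := by
    have h2 : ∀ t, fderiv ℝ (fun t => Φ (x - t)) t v • f t
        = -(fderiv ℝ Φ (x - t) v • C.indicator f t) := fun t => by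
      rw [hdψ]
      by_cases ht : t ∈ C
      · simp [ht]
      · simp [(hzero t ht).2]
    simp_rw [h2]
    rw [← integral_neg, setIntegral_eq_integral_of_forall_compl_eq_zero fun t ht => ?_]
    simp [indicator_of_notMem fun h => ht (hCΩ h)]
  have hR : ∫ t in Ω, Φ (x - t) • Df t v = ∫ t in C, Φ (x - t) • Df t v := by
    have h0 : ∀ t ∉ C, Φ (x - t) • Df t v = 0 := fun t ht => by
      rw [(hzero t ht).1, zero_smul]
    rw [setIntegral_eq_integral_of_forall_compl_eq_zero h0,
      setIntegral_eq_integral_of_forall_compl_eq_zero fun t ht => h0 t fun h => ht (hCΩ h)]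
  rw [hL, hR, neg_inj] at hweak
  rw [convolution_eq_swap, ContinuousLinearMap.integral_apply hex2,
    ContinuousLinearMap.integral_apply hex1.integrable_swap]
  simpa using hweak.symm

/-- By monotone convergence the sum of the pointwise errors is integrable, hence finite almost
everywhere, so its terms tend to zero. Summability of the errors makes it unnecessary to extract a
subsequence. -/
theorem ae_tendsto_of_tsum_lintegral_enorm_sub_rpow_ne_top {α F : Type*} [MeasurableSpace α]
    {μ : Measure α} [NormedAddCommGroup F] {u : ℕ → α → F} {v : α → F} {p : ℝ} (hp : 0 < p)
    (hu : ∀ j, AEStronglyMeasurable (u j) μ) (hv : AEStronglyMeasurable v μ)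
    (h : ∑' j, ∫⁻ x, ‖u j x - v x‖ₑ ^ p ∂μ ≠ ⊤) :
    ∀ᵐ x ∂μ, Filter.Tendsto (fun j => u j x) Filter.atTop (nhds (v x)) := by
  have hm : ∀ j, AEMeasurable (fun x => ‖u j x - v x‖ₑ ^ p) μ := fun j =>
    ((hu j).sub hv).enorm.pow_const p
  rw [← lintegral_tsum hm] at h
  filter_upwards [ae_lt_top' (AEMeasurable.tsum hm) h] with x hx
  have h1 := ENNReal.tendsto_atTop_zero_of_tsum_ne_top hx.ne
  have h2 : Filter.Tendsto (fun j => (‖u j x - v x‖ₑ ^ p) ^ (1 / p)) Filter.atTop (nhds 0) := by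
    have := (ENNReal.continuous_rpow_const (y := 1 / p)).tendsto 0
    rw [ENNReal.zero_rpow_of_pos (by positivity)] at this
    exact this.comp h1
  have h3 : ∀ j, (‖u j x - v x‖ₑ ^ p) ^ (1 / p) = ‖u j x - v x‖ₑ := fun j => by
    rw [← ENNReal.rpow_mul, mul_one_div_cancel hp.ne', ENNReal.rpow_one]
  simp_rw [h3] at h2
  rw [tendsto_iff_edist_tendsto_0]
  simpa [edist_eq_enorm_sub] using h2

theorem enorm_pow_le_of_sub {F : Type*} [NormedAddCommGroup F] (a b : F) (n : ℕ) :
    ‖a‖ₑ ^ n ≤ 2 ^ n * (‖b‖ₑ ^ n + ‖a - b‖ₑ ^ n) := by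
  have h : ‖a‖ₑ ≤ 2 * max ‖b‖ₑ ‖a - b‖ₑ := by
    calc ‖a‖ₑ = ‖b + (a - b)‖ₑ := by rw [add_sub_cancel]
      _ ≤ ‖b‖ₑ + ‖a - b‖ₑ := enorm_add_le _ _
      _ ≤ _ := by rw [two_mul]; gcongr <;> simp
  calc ‖a‖ₑ ^ n ≤ (2 * max ‖b‖ₑ ‖a - b‖ₑ) ^ n := by gcongr
    _ = 2 ^ n * max (‖b‖ₑ ^ n) (‖a - b‖ₑ ^ n) := by
        rw [mul_pow]
        congr 1
        exact (pow_left_mono n).map_max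
    _ ≤ _ := by gcongr; exact max_le_add_of_nonneg zero_le zero_le

/-- Smooth approximation of a `W^{1,n}_loc` map on a compact set, with an integrable majorant of
the `n`-th powers of the differentials. -/
theorem HasWeakDifferential.exists_smooth_approx {n : ℕ} (hn : 2 ≤ n)
    {Ω : Set (EuclideanSpace ℝ (Fin n))} (hΩ : IsOpen Ω)
    {f : EuclideanSpace ℝ (Fin n) → EuclideanSpace ℝ (Fin n)}
    {Df : EuclideanSpace ℝ (Fin n) → EuclideanSpace ℝ (Fin n) →L[ℝ] EuclideanSpace ℝ (Fin n)}
    (hf : HasWeakDifferential Ω f Df) (hfn : MemLpLoc Ω n f) (hDfn : MemLpLoc Ω n Df)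
    {C : Set (EuclideanSpace ℝ (Fin n))} (hC : IsCompact C) (hCΩ : C ⊆ Ω) {η : ℝ≥0∞}
    (hη : η ≠ 0) :
    ∃ (F : ℕ → EuclideanSpace ℝ (Fin n) → EuclideanSpace ℝ (Fin n))
      (H : EuclideanSpace ℝ (Fin n) → ℝ≥0∞), (∀ j, ContDiff ℝ 1 (F j)) ∧ Measurable H ∧
      ∫⁻ x in C, H x ≤ 2 ^ n * (∫⁻ x in C, ‖Df x‖ₑ ^ n) + η ∧
      (∀ j, ∀ x ∈ C, ‖fderiv ℝ (F j) x‖ₑ ^ n ≤ H x) ∧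
      (∀ j, ∫⁻ x in C, ‖F j x‖ₑ ^ n ≤ 2 ^ n * (∫⁻ x in C, ‖f x‖ₑ ^ n) + η) ∧
      (∀ᵐ x ∂volume.restrict C, Filter.Tendsto (fun j => F j x) Filter.atTop (nhds (f x))) ∧
      ∀ᵐ x ∂volume.restrict C,
        Filter.Tendsto (fun j => fderiv ℝ (F j) x) Filter.atTop (nhds (Df x)) := by
  have hn1 : (1 : ℝ) < n := by exact_mod_cast hn
  have hn0 : (0 : ℝ) < n := by linarith
  obtain ⟨C', hC', hCC', hC'Ω⟩ := exists_compact_between hC hΩ hCΩ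
  obtain ⟨ρ, hρ0, hρ⟩ := hC.exists_cthickening_subset_open isOpen_interior hCC'
  have hball : ∀ x ∈ C, ∀ r ≤ ρ, Metric.closedBall x r ⊆ C' := fun x hx r hr =>
    (Metric.closedBall_subset_closedBall hr).trans
      ((Metric.closedBall_subset_cthickening hx ρ).trans (hρ.trans interior_subset))
  have hCsub : C ⊆ C' := hCC'.trans interior_subset
  have hp : ENNReal.ofReal (n : ℝ) = n := ENNReal.ofReal_natCast n
  have hG0 : MemLp f (ENNReal.ofReal (n : ℝ)) (volume.restrict C') := hp ▸ hfn C' hC'Ω hC'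
  have hG1 : MemLp Df (ENNReal.ofReal (n : ℝ)) (volume.restrict C') := hp ▸ hDfn C' hC'Ω hC'
  have hCm := hC.measurableSet
  have hC'm := hC'.measurableSet
  obtain ⟨η', hη'0, hη'⟩ : ∃ η' : ℝ≥0∞, η' ≠ 0 ∧ 2 ^ n * η' ≤ η := by
    refine ⟨η / 2 ^ n, ?_, ?_⟩
    · simp [ENNReal.div_eq_zero_iff, hη]
    · rw [ENNReal.mul_div_cancel (by positivity) (by simp)]
  -- Summable errors serve twice: they give almost everywhere convergence, and they make |Df|ⁿ + Σ_j
  -- |DF_j - Df|ⁿ an integrable function dominating every |DF_j|ⁿ up to the factor 2ⁿ.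
  obtain ⟨e, he0, he⟩ := ENNReal.exists_pos_sum_of_countable hη'0 ℕ
  have hec : ∀ j, (e j : ℝ≥0∞) ≠ 0 := fun j => by simpa using (he0 j).ne'
  choose ε0 hε00 hε0 using fun j =>
    exists_forall_lintegral_mollification_sub_rpow_le hn1 hCm hC'm hCsub hG0 (hec j)
  choose ε1 hε10 hε1 using fun j =>
    exists_forall_lintegral_mollification_sub_rpow_le hn1 hCm hC'm hCsub hG1 (hec j)
  have hr : ∀ j, 0 < min (min (ε0 j) (ε1 j)) ρ / 2 := fun j =>
    half_pos (lt_min (lt_min (hε00 j) (hε10 j)) hρ0)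
  let φ : ℕ → ContDiffBump (0 : EuclideanSpace ℝ (Fin n)) := fun j =>
    ⟨min (min (ε0 j) (ε1 j)) ρ / 2 / 2, min (min (ε0 j) (ε1 j)) ρ / 2, half_pos (hr j),
      half_lt_self (hr j)⟩
  have hφ : ∀ j, (φ j).rOut < min (min (ε0 j) (ε1 j)) ρ := fun j =>
    half_lt_self (by have := hr j; linarith)
  let F : ℕ → EuclideanSpace ℝ (Fin n) → EuclideanSpace ℝ (Fin n) := fun j =>
    mollification (φ j) C' f
  have hF : ∀ j, ContDiff ℝ 1 (F j) := fun j => contDiff_mollification (φ j) hC'm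
    (hf.locallyIntegrableOn.integrableOn_compact_subset hC'Ω hC')
  have hD : ∀ j, ∀ x ∈ C, fderiv ℝ (F j) x = mollification (φ j) C' Df x := fun j x hx =>
    (hf.hasFDerivAt_mollification hC' hC'Ω (φ j)
      (hball x hx _ ((hφ j).le.trans (min_le_right _ _)))).fderiv
  have hF1 : ∀ j, ∫⁻ x in C, ‖F j x - f x‖ₑ ^ (n : ℝ) ≤ e j := fun j =>
    hε0 j (φ j) ((hφ j).trans_le ((min_le_left _ _).trans (min_le_left _ _)))
  have hD1 : ∀ j, ∫⁻ x in C, ‖fderiv ℝ (F j) x - Df x‖ₑ ^ (n : ℝ) ≤ e j := fun j => by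
    refine le_of_eq_of_le (setLIntegral_congr_fun hCm fun x hx => ?_)
      (hε1 j (φ j) ((hφ j).trans_le ((min_le_left _ _).trans (min_le_right _ _))))
    rw [hD j x hx]
  have hFc : ∀ j, Continuous (fderiv ℝ (F j)) := fun j => (hF j).continuous_fderiv one_ne_zero
  have hfm : AEStronglyMeasurable f (volume.restrict C) := (hfn C hCΩ hC).aestronglyMeasurable
  have hDfm : AEStronglyMeasurable Df (volume.restrict C) := (hDfn C hCΩ hC).aestronglyMeasurable
  have hsum : ∀ a : ℕ → ℝ≥0∞, (∀ j, a j ≤ e j) → ∑' j, a j ≤ η' := fun a ha =>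
    (ENNReal.tsum_le_tsum ha).trans he.le
  have hη't : ∀ a : ℕ → ℝ≥0∞, (∀ j, a j ≤ e j) → ∑' j, a j ≠ ⊤ := fun a ha =>
    ((ENNReal.tsum_le_tsum ha).trans_lt (he.trans_le le_top)).ne
  -- The majorant is built from an everywhere defined measurable version of Df. It must dominate at
  -- every point, since it will be restricted to slices, which are Lebesgue null.
  obtain ⟨G, hGm, hGe⟩ := hDfm
  refine ⟨F, fun x => 2 ^ n * (‖G x‖ₑ ^ n + ∑' j, ‖fderiv ℝ (F j) x - G x‖ₑ ^ n), hF, ?_, ?_, ?_,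
    ?_, ?_, ?_⟩
  · refine Measurable.const_mul ((hGm.enorm.pow_const n).add (Measurable.tsum fun j => ?_)) _
    exact (((hFc j).stronglyMeasurable.sub hGm).enorm.pow_const n)
  · have hsm : ∀ j, Measurable fun x => ‖fderiv ℝ (F j) x - G x‖ₑ ^ n := fun j =>
      ((hFc j).stronglyMeasurable.sub hGm).enorm.pow_const n
    rw [lintegral_const_mul' _ _ (by simp), lintegral_add_left (hGm.enorm.pow_const n),
      lintegral_tsum fun j => (hsm j).aemeasurable, mul_add]
    refine add_le_add (mul_le_mul_right ?_ _) ?_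
    · refine le_of_eq (lintegral_congr_ae ?_)
      filter_upwards [hGe] with x hx
      rw [hx]
    · refine le_trans (mul_le_mul_right ?_ _) hη'
      refine hsum _ fun j => le_of_eq_of_le (lintegral_congr_ae ?_) (hD1 j)
      filter_upwards [hGe] with x hx
      rw [hx, ENNReal.rpow_natCast]
  · intro j x _
    refine (enorm_pow_le_of_sub _ (G x) n).trans ?_
    refine mul_le_mul_right (add_le_add le_rfl ?_) _
    exact ENNReal.le_tsum (f := fun j => ‖fderiv ℝ (F j) x - G x‖ₑ ^ n) j
  · intro j
    calc ∫⁻ x in C, ‖F j x‖ₑ ^ n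
        ≤ ∫⁻ x in C, 2 ^ n * (‖f x‖ₑ ^ n + ‖F j x - f x‖ₑ ^ n) :=
          lintegral_mono fun x => enorm_pow_le_of_sub _ _ n
      _ = 2 ^ n * (∫⁻ x in C, ‖f x‖ₑ ^ n) + 2 ^ n * ∫⁻ x in C, ‖F j x - f x‖ₑ ^ n := by
          rw [lintegral_const_mul' _ _ (by simp), lintegral_add_left' (hfm.enorm.pow_const n),
            mul_add]
      _ ≤ _ := by
          refine add_le_add le_rfl (le_trans (mul_le_mul_right ?_ _) hη')
          refine le_trans ?_ ((ENNReal.le_tsum j).trans he.le)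
          simpa only [ENNReal.rpow_natCast] using hF1 j
  · exact ae_tendsto_of_tsum_lintegral_enorm_sub_rpow_ne_top hn0
      (fun j => (hF j).continuous.aestronglyMeasurable) hfm (hη't _ hF1)
  · exact ae_tendsto_of_tsum_lintegral_enorm_sub_rpow_ne_top hn0
      (fun j => (hFc j).aestronglyMeasurable) ⟨G, hGm, hGe⟩ (hη't _ hD1)

/-! ### Stampacchia's iteration -/

/-- Stampacchia's iteration lemma. -/
theorem stampacchia_eq_zero {A : ℝ → ℝ} {k₀ N β B v d : ℝ} (hA0 : ∀ k, 0 ≤ A k)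
    (hA : Antitone A) (hN : 0 < N) (hβ : 1 < β) (hB : 0 < B) (hv : 0 < v) (hAv : A k₀ ≤ v)
    (hd0 : 0 < d) (hd : d ^ N = B * 2 ^ N * v ^ (β - 1) * 2 ^ (N / (β - 1)))
    (h : ∀ k h, k₀ ≤ k → k < h → (h - k) ^ N * A h ≤ B * A k ^ β) : A (k₀ + d) = 0 := by
  -- At the levels k_j = k₀ + d(1 - 2^{-j}) the claim is A(k_j) ≤ v τ^j. The ratio τ solves τ^{β-1}
  -- 2^N = 1, which balances the loss 2^{jN} from the shrinking steps, and d is the value for which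
  -- the induction closes.
  set τ : ℝ := 2 ^ (-(N / (β - 1)))
  have hβ' : 0 < β - 1 := by linarith
  have hτ0 : 0 < τ := by positivity
  have hτ1 : τ < 1 := Real.rpow_lt_one_of_one_lt_of_neg one_lt_two (by
    rw [neg_lt_zero]; positivity)
  have hτβ : τ ^ (β - 1) * 2 ^ N = 1 := by
    rw [← Real.rpow_mul two_pos.le, ← Real.rpow_add two_pos,
      show -(N / (β - 1)) * (β - 1) + N = 0 by field_simp; ring, Real.rpow_zero]
  have hdτ : d ^ N * τ = B * 2 ^ N * v ^ (β - 1) := by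
    rw [hd, mul_assoc, ← Real.rpow_add two_pos]
    simp
  have key : ∀ j : ℕ, A (k₀ + d * (1 - (1 / 2) ^ j)) ≤ v * τ ^ j := by
    intro j
    induction j with
    | zero => simpa using hAv
    | succ j ih =>
      have hpos : (0 : ℝ) < d * (1 / 2) ^ (j + 1) := by positivity
      have hj1 : ((1 : ℝ) / 2) ^ j ≤ 1 := pow_le_one₀ (by norm_num) (by norm_num)
      have hstep := h (k₀ + d * (1 - (1 / 2) ^ j)) (k₀ + d * (1 - (1 / 2) ^ (j + 1)))
        (by nlinarith) (by rw [pow_succ] at hpos ⊢; nlinarith)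
      rw [show k₀ + d * (1 - (1 / 2) ^ (j + 1)) - (k₀ + d * (1 - (1 / 2) ^ j))
        = d * (1 / 2) ^ (j + 1) by ring] at hstep
      set a := A (k₀ + d * (1 - (1 / 2) ^ (j + 1)))
      have h1 : (d * (1 / 2) ^ (j + 1)) ^ N * a ≤ B * (v * τ ^ j) ^ β :=
        hstep.trans (by gcongr; exact hA0 _)
      have hpow : (d * (1 / 2) ^ (j + 1)) ^ N = d ^ N * ((2 ^ N)⁻¹) ^ (j + 1) := by
        rw [Real.mul_rpow hd0.le (by positivity), ← Real.rpow_natCast, ← Real.rpow_natCast,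
          ← Real.rpow_mul (by norm_num), mul_comm _ N, Real.rpow_mul (by norm_num),
          one_div, Real.inv_rpow two_pos.le]
      have hrhs : B * (v * τ ^ j) ^ β
          = (d * (1 / 2) ^ (j + 1)) ^ N * (v * τ ^ (j + 1)) := by
        have e1 : (v * τ ^ j) ^ β = v * v ^ (β - 1) * (τ ^ j * (τ ^ (β - 1)) ^ j) := by
          rw [Real.mul_rpow hv.le (by positivity)]
          congr 1
          · rw [← Real.rpow_one_add' hv.le (by linarith)]; congr 1; ring
          · rw [← Real.rpow_natCast (τ ^ (β - 1)), ← Real.rpow_mul hτ0.le, mul_comm (β - 1),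
              Real.rpow_mul hτ0.le, Real.rpow_natCast, ← Real.rpow_one_add' (by positivity)
              (by linarith)]
            congr 1; ring
        have e2 : τ ^ (β - 1) = (2 ^ N)⁻¹ := eq_inv_of_mul_eq_one_left hτβ
        rw [hpow, e1, e2, pow_succ τ]
        calc _ = B * v ^ (β - 1) * v * τ ^ j * ((2 ^ N)⁻¹) ^ j := by ring
          _ = (B * 2 ^ N * v ^ (β - 1)) * v * τ ^ j * ((2 ^ N)⁻¹) ^ (j + 1) := by
            rw [pow_succ]
            have : (2 : ℝ) ^ N ≠ 0 := by positivity
            field_simp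
          _ = _ := by rw [← hdτ]; ring
      rw [hrhs] at h1
      exact le_of_mul_le_mul_left h1 (by positivity)
  have hlim : Filter.Tendsto (fun j : ℕ => v * τ ^ j) Filter.atTop (nhds 0) := by
    simpa using (tendsto_pow_atTop_nhds_zero_of_lt_one hτ0.le hτ1).const_mul v
  refine le_antisymm (ge_of_tendsto' hlim fun j => (hA ?_).trans (key j)) (hA0 _)
  have : (0 : ℝ) < (1 / 2) ^ j := by positivity
  nlinarith

/-! ### Truncated coordinates: null Lagrangian and Sobolev inequality -/

/-- The piecewise linear transition from `0` at `k` to `1` at `h`. -/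
noncomputable def ramp (k h t : ℝ) : ℝ := max 0 (min 1 ((t - k) / (h - k)))

/-- The primitive of `ramp k h` vanishing at `k`. -/
noncomputable def rampPrimitive (k h t : ℝ) : ℝ := ∫ s in k..t, ramp k h s

theorem continuous_ramp (k h : ℝ) : Continuous (ramp k h) := by
  unfold ramp; fun_prop

theorem ramp_nonneg (k h t : ℝ) : 0 ≤ ramp k h t := le_max_left _ _

theorem ramp_le_one (k h t : ℝ) : ramp k h t ≤ 1 := max_le zero_le_one (min_le_left _ _)

theorem ramp_of_le {k h t : ℝ} (hkh : k < h) (ht : t ≤ k) : ramp k h t = 0 :=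
  max_eq_left ((min_le_right _ _).trans
    (div_nonpos_of_nonpos_of_nonneg (by linarith) (by linarith)))

theorem hasDerivAt_rampPrimitive (k h t : ℝ) :
    HasDerivAt (rampPrimitive k h) (ramp k h t) t :=
  intervalIntegral.integral_hasDerivAt_right ((continuous_ramp k h).intervalIntegrable _ _)
    ((continuous_ramp k h).stronglyMeasurableAtFilter _ _) (continuous_ramp k h).continuousAt

theorem contDiff_rampPrimitive (k h : ℝ) : ContDiff ℝ 1 (rampPrimitive k h) := by
  rw [contDiff_one_iff_deriv]
  refine ⟨fun t => (hasDerivAt_rampPrimitive k h t).differentiableAt, ?_⟩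
  rw [show deriv (rampPrimitive k h) = ramp k h from
    funext fun t => (hasDerivAt_rampPrimitive k h t).deriv]
  exact continuous_ramp k h

theorem rampPrimitive_of_le {k h t : ℝ} (hkh : k < h) (ht : t ≤ k) : rampPrimitive k h t = 0 := by
  rw [rampPrimitive, intervalIntegral.integral_symm, intervalIntegral.integral_of_le ht,
    setIntegral_eq_zero_of_forall_eq_zero fun s hs => ramp_of_le hkh hs.2, neg_zero]

theorem le_rampPrimitive {k h t : ℝ} (hkh : k < h) (ht : h ≤ t) :
    (h - k) / 2 ≤ rampPrimitive k h t := by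
  have hi : ∀ a b, IntervalIntegrable (ramp k h) volume a b := fun a b =>
    (continuous_ramp k h).intervalIntegrable a b
  have h1 : (h - k) / 2 ≤ ∫ s in k..h, ramp k h s := by
    have h2 : ∫ s in k..h, (s - k) / (h - k) = (h - k) / 2 := by
      have : h - k ≠ 0 := by linarith
      simp only [intervalIntegral.integral_div, intervalIntegral.integral_comp_sub_right
        (fun s => s) k, integral_id]
      field_simp
      ring
    rw [← h2]
    refine intervalIntegral.integral_mono_on hkh.le
      (Continuous.intervalIntegrable (by fun_prop) _ _) (hi _ _) fun s hs => ?_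
    have h3 : (s - k) / (h - k) ≤ 1 := by
      rw [div_le_one (by linarith)]; linarith [hs.2]
    rw [ramp, min_eq_right h3]
    exact le_max_right _ _
  have h4 : 0 ≤ ∫ s in h..t, ramp k h s :=
    intervalIntegral.integral_nonneg ht fun s _ => ramp_nonneg k h s
  rw [rampPrimitive, ← intervalIntegral.integral_add_adjacent_intervals (hi k h) (hi h t)]
  linarith

/-- Hadamard's inequality. -/
theorem abs_det_le_norm_pow {n : ℕ} (A : EuclideanSpace ℝ (Fin n) →L[ℝ] EuclideanSpace ℝ (Fin n)) :
    |A.det| ≤ ‖A‖ ^ n := by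
  -- The image of the unit ball has |det A| times its volume and lies in a ball of radius ‖A‖.
  have h1 := Measure.addHaar_image_continuousLinearMap
    (volume : Measure (EuclideanSpace ℝ (Fin n))) A (Metric.closedBall 0 1)
  have h2 : A '' Metric.closedBall 0 1 ⊆ Metric.closedBall 0 ‖A‖ := by
    rintro _ ⟨x, hx, rfl⟩
    rw [mem_closedBall_zero_iff] at hx ⊢
    exact (A.le_opNorm x).trans (mul_le_of_le_one_right (norm_nonneg _) hx)
  have h3 := measure_mono (μ := volume) h2
  rw [h1, Measure.addHaar_closedBall' volume (0 : EuclideanSpace ℝ (Fin n)) (norm_nonneg A),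
    ENNReal.mul_le_mul_iff_left (Metric.measure_closedBall_pos _ _ one_pos).ne'
      measure_closedBall_lt_top.ne, finrank_euclideanSpace_fin] at h3
  exact (ENNReal.ofReal_le_ofReal_iff (by positivity)).1 h3

theorem enorm_indicator_apply {E V : Type*} [NormedAddCommGroup V] (P : Set E) (u : E → V)
    (x : E) : ‖P.indicator u x‖ₑ = P.indicator (fun x => ‖u x‖ₑ) x := by
  by_cases hx : x ∈ P <;> simp [hx]

theorem enorm_indicator_fderiv {E F : Type*} [NormedAddCommGroup E] [NormedSpace ℝ E]
    [NormedAddCommGroup F] [NormedSpace ℝ F] (P : Set E) (u : E → F) (x : E) :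
    ‖P.indicator (fderiv ℝ u) x‖ₑ = P.indicator (fun x => ‖fderiv ℝ u x‖ₑ) x :=
  enorm_indicator_apply P (fderiv ℝ u) x

theorem hasFDerivAt_comp_coord {n : ℕ}
    {g : EuclideanSpace ℝ (Fin n) → EuclideanSpace ℝ (Fin n)} (hg : ContDiff ℝ 1 g) (i : Fin n)
    (ε : ℝ) {Ψ : ℝ → ℝ} {c : ℝ} {x : EuclideanSpace ℝ (Fin n)} (hΨ : HasDerivAt Ψ c (ε * g x i)) :
    HasFDerivAt (fun x => Ψ (ε * g x i))
      (c • ε • (EuclideanSpace.proj (𝕜 := ℝ) i).comp (fderiv ℝ g x)) x := by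
  have hgi : HasFDerivAt (fun x => g x i)
      ((EuclideanSpace.proj (𝕜 := ℝ) i).comp (fderiv ℝ g x)) x :=
    (EuclideanSpace.proj (𝕜 := ℝ) i).hasFDerivAt.comp x
      (hg.differentiable one_ne_zero x).hasFDerivAt
  exact hΨ.comp_hasFDerivAt x (hgi.const_mul ε)

theorem norm_proj_comp_le {n : ℕ} (i : Fin n)
    (A : EuclideanSpace ℝ (Fin n) →L[ℝ] EuclideanSpace ℝ (Fin n)) :
    ‖(EuclideanSpace.proj (𝕜 := ℝ) i).comp A‖ ≤ ‖A‖ :=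
  ContinuousLinearMap.opNorm_le_bound _ (norm_nonneg _) fun v =>
    (PiLp.norm_apply_le (A v) i).trans (A.le_opNorm v)

theorem eventually_rampPrimitive_eq_zero {n : ℕ}
    {g : EuclideanSpace ℝ (Fin n) → EuclideanSpace ℝ (Fin n)} (hg : Continuous g) {i : Fin n}
    {ε k h : ℝ} (hkh : k < h) {z : EuclideanSpace ℝ (Fin n)} (hz : ε * g z i < k) :
    ∀ᶠ y in nhds z, rampPrimitive k h (ε * g y i) = 0 := by
  have hc : Continuous fun y => ε * g y i := by fun_prop
  filter_upwards [hc.continuousAt.eventually (gt_mem_nhds hz)] with y hy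
  exact rampPrimitive_of_le hkh hy.le

/-- The null Lagrangian identity is used with Ψ(t) = `rampPrimitive k h (ε * t)`, which vanishes
near the frontier and has derivative ε · `ramp k h (ε * t)`. The sign ε = ±1 lets one argument give
both upper and lower bounds for a coordinate. -/
theorem setIntegral_ramp_mul_det_eq_zero {n : ℕ}
    {g : EuclideanSpace ℝ (Fin n) → EuclideanSpace ℝ (Fin n)} (hg : ContDiff ℝ 1 g) (i : Fin n)
    {P : Set (EuclideanSpace ℝ (Fin n))} (hP : IsOpen P) (hPb : Bornology.IsBounded P)
    {ε k h : ℝ} (hε : ε * ε = 1) (hkh : k < h) (hb : ∀ z ∈ frontier P, ε * g z i < k) :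
    ∫ x in P, ramp k h (ε * g x i) * (fderiv ℝ g x).det = 0 := by
  have hΨ : ContDiff ℝ 1 fun t => rampPrimitive k h (ε * t) :=
    (contDiff_rampPrimitive k h).comp (contDiff_const.mul contDiff_id)
  have h1 := setIntegral_deriv_comp_mul_det_eq_zero hg i hP hPb hΨ fun z hz =>
    eventually_rampPrimitive_eq_zero hg.continuous hkh (hb z hz)
  have h2 : ∀ t, deriv (fun t => rampPrimitive k h (ε * t)) t = ramp k h (ε * t) * ε := fun t => by
    have h3 : HasDerivAt (fun t => ε * t) ε t := by
      simpa using (hasDerivAt_id t).const_mul ε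
    exact ((hasDerivAt_rampPrimitive k h (ε * t)).comp t h3).deriv
  simp_rw [h2] at h1
  have h4 : ∀ x, ramp k h (ε * g x i) * (fderiv ℝ g x).det
      = ε * (ramp k h (ε * g x i) * ε * (fderiv ℝ g x).det) := fun x => by
    linear_combination (-(ramp k h (ε * g x i) * (fderiv ℝ g x).det)) * hε
  simp_rw [h4]
  rw [integral_const_mul, h1, mul_zero]

/-- The Gagliardo-Nirenberg-Sobolev inequality in integral form. -/
theorem exists_lintegral_rpow_le_lintegral_fderiv {n : ℕ} (hn : 2 ≤ n) {F : Type*}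
    [NormedAddCommGroup F] [NormedSpace ℝ F] [FiniteDimensional ℝ F] {p : ℝ} (hp : 1 < p) :
    ∃ C : ℝ≥0, ∀ u : EuclideanSpace ℝ (Fin n) → F, ContDiff ℝ 1 u → HasCompactSupport u →
      ∫⁻ x, ‖u x‖ₑ ^ (n * p) ≤ C * (∫⁻ x, ‖fderiv ℝ u x‖ₑ ^ (n * p / (p + 1))) ^ (p + 1) := by
  have hn0 : (0 : ℝ) < n := by positivity
  have hn2 : (2 : ℝ) ≤ n := by exact_mod_cast hn
  have hp0 : 0 < p := by linarith
  lift p to ℝ≥0 using hp0.le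
  -- The exponent s has Sobolev conjugate t = np, because 1/s - 1/n = 1/(np), and t/s = p + 1. The
  -- condition s ≥ 1 holds since n ≥ 2 and p > 1.
  set s : ℝ≥0 := n * p / (p + 1)
  set t : ℝ≥0 := n * p
  have hs1 : 1 ≤ s := by
    rw [← NNReal.coe_le_coe]
    push_cast [s]
    rw [le_div_iff₀ (by positivity)]
    nlinarith
  have ht0 : (t : ℝ) ≠ 0 := by push_cast [t]; positivity
  have hs0 : (s : ℝ) ≠ 0 := (one_pos.trans_le (NNReal.coe_le_coe.2 hs1)).ne'
  set C := SNormLESNormFDerivOfEqConst F (volume : Measure (EuclideanSpace ℝ (Fin n))) s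
  refine ⟨C ^ (t : ℝ), fun u hu huc => ?_⟩
  have hgns := eLpNorm_le_eLpNorm_fderiv_of_eq
    (volume : Measure (EuclideanSpace ℝ (Fin n))) hu huc hs1 (p' := t) (by simp; omega) (by
      rw [finrank_euclideanSpace_fin]
      push_cast [s, t]
      have : (p : ℝ) ≠ 0 := hp0.ne'
      field_simp
      ring)
  rw [eLpNorm_eq_lintegral_rpow_enorm_toReal (by simpa using ht0) ENNReal.coe_ne_top,
    eLpNorm_eq_lintegral_rpow_enorm_toReal (by simpa using hs0) ENNReal.coe_ne_top,
    ENNReal.coe_toReal, ENNReal.coe_toReal] at hgns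
  have h3 := ENNReal.rpow_le_rpow hgns t.coe_nonneg
  rw [← ENNReal.rpow_mul, one_div_mul_cancel ht0, ENNReal.rpow_one,
    ENNReal.mul_rpow_of_nonneg _ _ t.coe_nonneg, ← ENNReal.rpow_mul] at h3
  have h4 : 1 / (s : ℝ) * t = p + 1 := by
    push_cast [s, t]
    have : (p : ℝ) ≠ 0 := hp0.ne'
    field_simp
  rw [h4] at h3
  have ht : (t : ℝ) = n * p := by push_cast [t]; rfl
  have hs : (s : ℝ) = n * p / (p + 1) := by push_cast [s]; rfl
  rw [← hs, ← ht, ENNReal.coe_rpow_of_nonneg _ t.coe_nonneg]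
  exact h3

/-- The Sobolev inequality for truncations of a coordinate function vanishing near the frontier. -/
theorem exists_lintegral_rampPrimitive_le {n : ℕ} (hn : 2 ≤ n) {p : ℝ} (hp : 1 < p) :
    ∃ C : ℝ≥0, ∀ (g : EuclideanSpace ℝ (Fin n) → EuclideanSpace ℝ (Fin n)), ContDiff ℝ 1 g →
      ∀ (i : Fin n) (P : Set (EuclideanSpace ℝ (Fin n))), IsOpen P → Bornology.IsBounded P →
      ∀ (ε k h : ℝ), ε * ε = 1 → k < h → (∀ z ∈ frontier P, ε * g z i < k) →
      ∫⁻ x in P, ‖rampPrimitive k h (ε * g x i)‖ₑ ^ (n * p)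
        ≤ C * (∫⁻ x in P, (‖ramp k h (ε * g x i)‖ₑ * ‖fderiv ℝ g x‖ₑ) ^ (n * p / (p + 1)))
          ^ (p + 1) := by
  have hn0 : (0 : ℝ) < n := by positivity
  have hp0 : 0 < p := by linarith
  obtain ⟨C, hC⟩ := exists_lintegral_rpow_le_lintegral_fderiv hn (F := ℝ) hp
  refine ⟨C, fun g hg i P hP hPb ε k h hε hkh hb => ?_⟩
  have hu : ContDiff ℝ 1 fun x => rampPrimitive k h (ε * g x i) :=
    (contDiff_rampPrimitive k h).comp (contDiff_const.mul
      ((EuclideanSpace.proj (𝕜 := ℝ) i).contDiff.comp hg))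
  obtain ⟨hw, hwd⟩ := contDiff_indicator_of_frontier hu hP fun z hz =>
    eventually_rampPrimitive_eq_zero hg.continuous hkh (hb z hz)
  have hwc : HasCompactSupport (P.indicator fun x => rampPrimitive k h (ε * g x i)) :=
    hPb.isCompact_closure.of_isClosed_subset (isClosed_tsupport _)
      (closure_mono support_indicator_subset)
  refine le_trans (le_trans (le_of_eq ?_) (hC _ hw hwc))
    (mul_le_mul_right (ENNReal.rpow_le_rpow ?_ (by positivity)) _)
  · rw [← lintegral_indicator hP.measurableSet]
    refine lintegral_congr fun x => ?_
    by_cases hx : x ∈ P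
    · simp [hx]
    · simp [hx, (by positivity : (0 : ℝ) < n * p)]
  · rw [← lintegral_indicator hP.measurableSet]
    refine lintegral_mono fun x => ?_
    rw [hwd, enorm_indicator_fderiv]
    by_cases hx : x ∈ P
    · simp only [indicator_of_mem hx]
      rw [(hasFDerivAt_comp_coord hg i ε (hasDerivAt_rampPrimitive k h _)).fderiv]
      refine ENNReal.rpow_le_rpow ?_ (by positivity)
      rw [enorm_smul, enorm_smul]
      have hε1 : ‖ε‖ₑ = 1 := by
        have : |ε| * |ε| = 1 := by rw [← abs_mul, hε, abs_one]
        have : |ε| = 1 := by nlinarith [abs_nonneg ε]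
        rw [← ofReal_norm, Real.norm_eq_abs, this, ENNReal.ofReal_one]
      rw [hε1, one_mul]
      refine mul_le_mul_right ?_ _
      rw [← ofReal_norm, ← ofReal_norm]
      exact ENNReal.ofReal_le_ofReal (norm_proj_comp_le i _)
    · simp [hx, (by positivity : (0 : ℝ) < n * p / (p + 1))]

theorem ENNReal.rpow_le_one_add_pow {x : ℝ≥0∞} {s : ℝ} {n : ℕ} (hs0 : 0 ≤ s) (hsn : s ≤ n) :
    x ^ s ≤ 1 + x ^ n := by
  rcases le_total x 1 with hx | hx
  · exact (ENNReal.rpow_le_one hx hs0).trans le_self_add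
  · rw [← ENNReal.rpow_natCast]
    exact (ENNReal.rpow_le_rpow_of_exponent_le hx hsn).trans le_add_self

theorem enorm_mul_det_le {n : ℕ} {θ : ℝ} (hθ0 : 0 ≤ θ) (hθ1 : θ ≤ 1)
    (A : EuclideanSpace ℝ (Fin n) →L[ℝ] EuclideanSpace ℝ (Fin n)) :
    ‖θ * A.det‖ₑ ≤ ‖A‖ₑ ^ n := by
  rw [← ofReal_norm, ← ofReal_norm, ← ENNReal.ofReal_pow (norm_nonneg _)]
  refine ENNReal.ofReal_le_ofReal ?_
  rw [norm_mul, Real.norm_of_nonneg hθ0, Real.norm_eq_abs]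
  exact (mul_le_of_le_one_left (abs_nonneg _) hθ1).trans (abs_det_le_norm_pow A)

theorem continuous_rampPrimitive (k h : ℝ) : Continuous (rampPrimitive k h) :=
  (contDiff_rampPrimitive k h).continuous

/-! ### Passage to the limit in the truncation estimates -/

/-- A sequence of `C¹` maps on a bounded open set `P`, with differentials dominated in `Lⁿ(P)`, that
converges almost everywhere in `P` together with its differentials. -/
structure IsDominatedLimit {n : ℕ} (P : Set (EuclideanSpace ℝ (Fin n)))
    (F : ℕ → EuclideanSpace ℝ (Fin n) → EuclideanSpace ℝ (Fin n))
    (H : EuclideanSpace ℝ (Fin n) → ℝ≥0∞)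
    (f : EuclideanSpace ℝ (Fin n) → EuclideanSpace ℝ (Fin n))
    (Df : EuclideanSpace ℝ (Fin n) → EuclideanSpace ℝ (Fin n) →L[ℝ] EuclideanSpace ℝ (Fin n)) :
    Prop where
  isOpen : IsOpen P
  isBounded : Bornology.IsBounded P
  contDiff : ∀ j, ContDiff ℝ 1 (F j)
  lintegral_ne_top : ∫⁻ x in P, H x ≠ ⊤
  measurable : Measurable H
  enorm_pow_le : ∀ j, ∀ x ∈ P, ‖fderiv ℝ (F j) x‖ₑ ^ n ≤ H x
  ae_tendsto : ∀ᵐ x ∂volume.restrict P,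
    Filter.Tendsto (fun j => F j x) Filter.atTop (nhds (f x))
  ae_tendsto_fderiv : ∀ᵐ x ∂volume.restrict P,
    Filter.Tendsto (fun j => fderiv ℝ (F j) x) Filter.atTop (nhds (Df x))

namespace IsDominatedLimit

variable {n : ℕ} {P : Set (EuclideanSpace ℝ (Fin n))}
  {F : ℕ → EuclideanSpace ℝ (Fin n) → EuclideanSpace ℝ (Fin n)}
  {H : EuclideanSpace ℝ (Fin n) → ℝ≥0∞}
  {f : EuclideanSpace ℝ (Fin n) → EuclideanSpace ℝ (Fin n)}
  {Df : EuclideanSpace ℝ (Fin n) → EuclideanSpace ℝ (Fin n) →L[ℝ] EuclideanSpace ℝ (Fin n)}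

theorem comp_subseq (hL : IsDominatedLimit P F H f Df) {φ : ℕ → ℕ} (hφ : StrictMono φ) :
    IsDominatedLimit P (fun j => F (φ j)) H f Df where
  isOpen := hL.isOpen
  isBounded := hL.isBounded
  contDiff _ := hL.contDiff _
  lintegral_ne_top := hL.lintegral_ne_top
  measurable := hL.measurable
  enorm_pow_le _ := hL.enorm_pow_le _
  ae_tendsto := hL.ae_tendsto.mono fun _ hx => hx.comp hφ.tendsto_atTop
  ae_tendsto_fderiv := hL.ae_tendsto_fderiv.mono fun _ hx => hx.comp hφ.tendsto_atTop

theorem aestronglyMeasurable (hL : IsDominatedLimit P F H f Df) :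
    AEStronglyMeasurable f (volume.restrict P) :=
  aestronglyMeasurable_of_tendsto_ae Filter.atTop
    (fun j => (hL.contDiff j).continuous.aestronglyMeasurable) hL.ae_tendsto

theorem aestronglyMeasurable_fderiv (hL : IsDominatedLimit P F H f Df) :
    AEStronglyMeasurable Df (volume.restrict P) :=
  aestronglyMeasurable_of_tendsto_ae Filter.atTop
    (fun j => ((hL.contDiff j).continuous_fderiv one_ne_zero).aestronglyMeasurable)
    hL.ae_tendsto_fderiv

theorem aemeasurable_coord (hL : IsDominatedLimit P F H f Df) (i : Fin n) (ε : ℝ) :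
    AEMeasurable (fun x => ε * f x i) (volume.restrict P) :=
  (((EuclideanSpace.proj (𝕜 := ℝ) i).continuous.comp_aestronglyMeasurable
    hL.aestronglyMeasurable).aemeasurable).const_mul ε

theorem tendsto_coord {i : Fin n} {ε : ℝ} {x : EuclideanSpace ℝ (Fin n)}
    (hx : Filter.Tendsto (fun j => F j x) Filter.atTop (nhds (f x))) :
    Filter.Tendsto (fun j => ε * F j x i) Filter.atTop (nhds (ε * f x i)) := by
  have hc : Continuous fun y : EuclideanSpace ℝ (Fin n) => ε * y i := by fun_prop
  exact (hc.tendsto _).comp hx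

theorem integrable_ramp_mul_det (hL : IsDominatedLimit P F H f Df) (i : Fin n) (ε k h : ℝ) :
    IntegrableOn (fun x => ramp k h (ε * f x i) * (Df x).det) P := by
  have hm : AEStronglyMeasurable (fun x => ramp k h (ε * f x i) * (Df x).det)
      (volume.restrict P) :=
    ((continuous_ramp k h).comp_aestronglyMeasurable
      (hL.aemeasurable_coord i ε).aestronglyMeasurable).mul
      (ContinuousLinearMap.continuous_det.comp_aestronglyMeasurable
        hL.aestronglyMeasurable_fderiv)
  refine ⟨hm, ((lintegral_mono_ae ?_).trans_lt (lt_top_iff_ne_top.2 hL.lintegral_ne_top))⟩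
  filter_upwards [hL.ae_tendsto_fderiv, ae_restrict_mem hL.isOpen.measurableSet] with x hx hxP
  refine (enorm_mul_det_le (ramp_nonneg _ _ _) (ramp_le_one _ _ _) _).trans ?_
  exact le_of_tendsto' (((ENNReal.continuous_pow n).tendsto _).comp
    ((continuous_enorm.tendsto _).comp hx)) fun j => hL.enorm_pow_le j x hxP

/-- Dominated convergence: the integrands are at most |DF_j|ⁿ ≤ H. The frontier condition concerns
only the smooth maps, since f is determined merely up to null sets. -/
theorem setIntegral_ramp_mul_det_eq_zero (hL : IsDominatedLimit P F H f Df) {i : Fin n}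
    {ε k h : ℝ} (hε : ε * ε = 1) (hkh : k < h) (hb : ∀ j, ∀ z ∈ frontier P, ε * F j z i < k) :
    ∫ x in P, ramp k h (ε * f x i) * (Df x).det = 0 := by
  have hlim : Filter.Tendsto
      (fun j => ∫ x in P, ramp k h (ε * F j x i) * (fderiv ℝ (F j) x).det) Filter.atTop
      (nhds (∫ x in P, ramp k h (ε * f x i) * (Df x).det)) := by
    refine tendsto_integral_of_dominated_convergence (fun x => (H x).toReal) (fun j => ?_)
      (integrable_toReal_of_lintegral_ne_top hL.measurable.aemeasurable hL.lintegral_ne_top)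
      (fun j => ?_) ?_
    · have h1 := (hL.contDiff j).continuous
      have h2 := (hL.contDiff j).continuous_fderiv one_ne_zero
      have h3 : Continuous fun x => ε * F j x i := by fun_prop
      exact (((continuous_ramp k h).comp h3).mul
        (ContinuousLinearMap.continuous_det.comp h2)).aestronglyMeasurable
    · filter_upwards [ae_lt_top' hL.measurable.aemeasurable hL.lintegral_ne_top,
        ae_restrict_mem hL.isOpen.measurableSet] with x hx hxP
      have := (enorm_mul_det_le (ramp_nonneg k h (ε * F j x i)) (ramp_le_one _ _ _)
        (fderiv ℝ (F j) x)).trans (hL.enorm_pow_le j x hxP)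
      rw [← toReal_enorm]
      exact ENNReal.toReal_mono hx.ne this
    · filter_upwards [hL.ae_tendsto, hL.ae_tendsto_fderiv] with x hx hx'
      exact (((continuous_ramp k h).tendsto _).comp (tendsto_coord hx)).mul
        ((ContinuousLinearMap.continuous_det.tendsto _).comp hx')
  refine tendsto_nhds_unique hlim ?_
  simp_rw [fun j => _root_.setIntegral_ramp_mul_det_eq_zero (hL.contDiff j) i hL.isOpen
    hL.isBounded hε hkh (hb j)]
  exact tendsto_const_nhds

/-- Fatou's lemma passes to the limit on the left. On the right dominated convergence applies: the
exponent np/(p + 1) is at most n, so 1 + H is a majorant, integrable because P is bounded. -/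
theorem exists_lintegral_rampPrimitive_le (hn : 2 ≤ n) {p : ℝ} (hp : 1 < p) :
    ∃ C : ℝ≥0, ∀ (P : Set (EuclideanSpace ℝ (Fin n)))
      (F : ℕ → EuclideanSpace ℝ (Fin n) → EuclideanSpace ℝ (Fin n))
      (H : EuclideanSpace ℝ (Fin n) → ℝ≥0∞)
      (f : EuclideanSpace ℝ (Fin n) → EuclideanSpace ℝ (Fin n))
      (Df : EuclideanSpace ℝ (Fin n) → EuclideanSpace ℝ (Fin n) →L[ℝ] EuclideanSpace ℝ (Fin n)),
      IsDominatedLimit P F H f Df → ∀ (i : Fin n) (ε k h : ℝ), ε * ε = 1 → k < h →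
      (∀ j, ∀ z ∈ frontier P, ε * F j z i < k) →
      ∫⁻ x in P, ‖rampPrimitive k h (ε * f x i)‖ₑ ^ (n * p)
        ≤ C * (∫⁻ x in P, (‖ramp k h (ε * f x i)‖ₑ * ‖Df x‖ₑ) ^ (n * p / (p + 1))) ^ (p + 1) := by
  obtain ⟨C, hC⟩ := _root_.exists_lintegral_rampPrimitive_le hn hp
  refine ⟨C, fun P F H f Df hL i ε k h hε hkh hb => ?_⟩
  have hp0 : 0 < p := by linarith
  have hs0 : 0 ≤ n * p / (p + 1) := by positivity
  have hsn : n * p / (p + 1) ≤ n := by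
    rw [div_le_iff₀ (by positivity)]
    nlinarith [(Nat.cast_nonneg n : (0 : ℝ) ≤ n)]
  have hcF : ∀ j, Continuous fun x => ε * F j x i := fun j => by
    have := (hL.contDiff j).continuous
    fun_prop
  have hcD : ∀ j, Continuous (fderiv ℝ (F j)) := fun j =>
    (hL.contDiff j).continuous_fderiv one_ne_zero
  have hR : Filter.Tendsto (fun j => ∫⁻ x in P,
      (‖ramp k h (ε * F j x i)‖ₑ * ‖fderiv ℝ (F j) x‖ₑ) ^ (n * p / (p + 1))) Filter.atTop
      (nhds (∫⁻ x in P, (‖ramp k h (ε * f x i)‖ₑ * ‖Df x‖ₑ) ^ (n * p / (p + 1)))) := by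
    refine tendsto_lintegral_of_dominated_convergence' (fun x => 1 + H x) (fun j => ?_)
      (fun j => ?_) ?_ ?_
    · exact ((((continuous_ramp k h).comp (hcF j)).enorm.measurable.mul
        (hcD j).enorm.measurable).pow_const _).aemeasurable
    · filter_upwards [ae_restrict_mem hL.isOpen.measurableSet] with x hxP
      have h1 : ‖ramp k h (ε * F j x i)‖ₑ ≤ 1 := by
        rw [Real.enorm_of_nonneg (ramp_nonneg _ _ _)]
        simpa using ramp_le_one _ _ _
      calc _ ≤ ‖fderiv ℝ (F j) x‖ₑ ^ (n * p / (p + 1)) :=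
            ENNReal.rpow_le_rpow (mul_le_of_le_one_left zero_le h1) hs0
        _ ≤ 1 + ‖fderiv ℝ (F j) x‖ₑ ^ n := ENNReal.rpow_le_one_add_pow hs0 hsn
        _ ≤ _ := add_le_add le_rfl (hL.enorm_pow_le j x hxP)
    · rw [lintegral_add_left measurable_const, setLIntegral_one]
      exact ENNReal.add_ne_top.2 ⟨hL.isBounded.measure_lt_top.ne, hL.lintegral_ne_top⟩
    · filter_upwards [hL.ae_tendsto, hL.ae_tendsto_fderiv] with x hx hx'
      refine ((ENNReal.continuous_rpow_const).tendsto _).comp (ENNReal.Tendsto.mul ?_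
        (Or.inr enorm_ne_top) ((continuous_enorm.tendsto _).comp hx') (Or.inr enorm_ne_top))
      exact (continuous_enorm.tendsto _).comp
        (((continuous_ramp k h).tendsto _).comp (tendsto_coord hx))
  have hR' := ENNReal.Tendsto.const_mul (a := (C : ℝ≥0∞))
    (((ENNReal.continuous_rpow_const (y := p + 1)).tendsto _).comp hR) (Or.inr ENNReal.coe_ne_top)
  calc ∫⁻ x in P, ‖rampPrimitive k h (ε * f x i)‖ₑ ^ (n * p)
      = ∫⁻ x in P, Filter.liminf (fun j => ‖rampPrimitive k h (ε * F j x i)‖ₑ ^ (n * p))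
          Filter.atTop := by
        refine lintegral_congr_ae ?_
        filter_upwards [hL.ae_tendsto] with x hx
        exact (((ENNReal.continuous_rpow_const).tendsto _).comp ((continuous_enorm.tendsto _).comp
          (((continuous_rampPrimitive k h).tendsto _).comp (tendsto_coord hx)))).liminf_eq.symm
    _ ≤ Filter.liminf (fun j => ∫⁻ x in P, ‖rampPrimitive k h (ε * F j x i)‖ₑ ^ (n * p))
          Filter.atTop :=
        lintegral_liminf_le fun j =>
          (((continuous_rampPrimitive k h).comp (hcF j)).enorm.measurable).pow_const _
    _ ≤ Filter.liminf (fun j => C * (∫⁻ x in P, (‖ramp k h (ε * F j x i)‖ₑ *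
          ‖fderiv ℝ (F j) x‖ₑ) ^ (n * p / (p + 1))) ^ (p + 1)) Filter.atTop :=
        Filter.liminf_le_liminf (Filter.Eventually.of_forall fun j =>
          hC (F j) (hL.contDiff j) i P hL.isOpen hL.isBounded ε k h hε hkh (hb j))
    _ = _ := hR'.liminf_eq

end IsDominatedLimit

/-! ### Level sets under the distortion inequality -/

/-- Under the distortion inequality the Jacobian is bounded below by the defect. -/
theorem det_add_nonneg_of_distortion {n : ℕ}
    {A : EuclideanSpace ℝ (Fin n) →L[ℝ] EuclideanSpace ℝ (Fin n)} {K σ : ℝ≥0}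
    (h : ‖A‖ ^ n ≤ K * (A.det + σ)) : 0 ≤ A.det + σ := by
  by_cases hK : K = 0
  · have h0 : ‖A‖ ^ n ≤ 0 := by simpa [hK] using h
    have h1 := (abs_det_le_norm_pow A).trans h0
    rw [abs_nonpos_iff.1 h1, zero_add]
    exact σ.coe_nonneg
  · have hK' : (0 : ℝ) < K := by positivity
    exact nonneg_of_mul_nonneg_right ((by positivity : (0 : ℝ) ≤ ‖A‖ ^ n).trans h) hK'

/-- The weighted Hölder estimate provided by the distortion inequality. -/
theorem lintegral_mul_enorm_rpow_le_of_distortion {n : ℕ} (hn : 0 < n) {p : ℝ} (hp : 1 < p)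
    {μ : Measure (EuclideanSpace ℝ (Fin n))}
    {Df : EuclideanSpace ℝ (Fin n) → EuclideanSpace ℝ (Fin n) →L[ℝ] EuclideanSpace ℝ (Fin n)}
    (hDf : AEStronglyMeasurable Df μ) {K σ : EuclideanSpace ℝ (Fin n) → ℝ≥0}
    (hK : AEMeasurable K μ) (hσ : AEMeasurable σ μ)
    (hdist : ∀ᵐ x ∂μ, ‖Df x‖ ^ n ≤ K x * ((Df x).det + σ x))
    {θ : EuclideanSpace ℝ (Fin n) → ℝ} (hθ : AEMeasurable θ μ) (hθ0 : ∀ x, 0 ≤ θ x)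
    (hθ1 : ∀ x, θ x ≤ 1) :
    (∫⁻ x, (‖θ x‖ₑ * ‖Df x‖ₑ) ^ (n * p / (p + 1)) ∂μ) ^ (p + 1)
      ≤ (∫⁻ x, ENNReal.ofReal (θ x * ((Df x).det + σ x)) ∂μ) ^ p *
        ∫⁻ x, (K x : ℝ≥0∞) ^ p ∂μ := by
  have hp0 : 0 < p := by linarith
  have hW : AEMeasurable (fun x => ENNReal.ofReal (θ x * ((Df x).det + σ x))) μ :=
    (hθ.mul ((ContinuousLinearMap.continuous_det.comp_aestronglyMeasurable hDf).aemeasurable.add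
      hσ.coe_nnreal_real)).ennreal_ofReal
  have hK' : AEMeasurable (fun x => (K x : ℝ≥0∞)) μ := hK.coe_nnreal_ennreal
  set W : EuclideanSpace ℝ (Fin n) → ℝ≥0∞ := fun x =>
    ENNReal.ofReal (θ x * ((Df x).det + σ x))
  -- As 0 ≤ θ ≤ 1, θⁿ ≤ θ, so a single factor θ can be attached to J + σ. Hölder with exponents (p +
  -- 1)/p and p + 1 then separates this weight from K.
  have hpt : ∀ᵐ x ∂μ, (‖θ x‖ₑ * ‖Df x‖ₑ) ^ (n * p / (p + 1))
      ≤ W x ^ (p / (p + 1)) * (K x : ℝ≥0∞) ^ (p / (p + 1)) := by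
    filter_upwards [hdist] with x hx
    rw [← ENNReal.mul_rpow_of_nonneg _ _ (by positivity), mul_div_assoc, ENNReal.rpow_mul,
      ENNReal.rpow_natCast]
    refine ENNReal.rpow_le_rpow ?_ (by positivity)
    rw [← ofReal_norm, ← ofReal_norm, ← ENNReal.ofReal_mul (norm_nonneg _),
      ← ENNReal.ofReal_pow (by positivity), ← ENNReal.ofReal_coe_nnreal,
      ← ENNReal.ofReal_mul (mul_nonneg (hθ0 x) (det_add_nonneg_of_distortion hx))]
    refine ENNReal.ofReal_le_ofReal ?_
    rw [mul_pow, Real.norm_of_nonneg (hθ0 x)]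
    calc θ x ^ n * ‖Df x‖ ^ n ≤ θ x * (K x * ((Df x).det + σ x)) := by
          refine mul_le_mul ?_ hx (by positivity) (hθ0 x)
          exact pow_le_of_le_one (hθ0 x) (hθ1 x) hn.ne'
      _ = _ := by ring
  have hpq : ((p + 1) / p).HolderConjugate (p + 1) := by
    rw [Real.holderConjugate_iff]
    constructor
    · rw [lt_div_iff₀ hp0]; linarith
    · field_simp
  have hH := ENNReal.lintegral_mul_le_Lp_mul_Lq μ hpq (hW.pow_const (p / (p + 1)))
    (hK'.pow_const (p / (p + 1)))
  have e1 : ∀ a : ℝ≥0∞, (a ^ (p / (p + 1))) ^ ((p + 1) / p) = a := fun a => by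
    rw [← ENNReal.rpow_mul, div_mul_div_cancel₀ (by positivity), div_self hp0.ne',
      ENNReal.rpow_one]
  have e2 : ∀ a : ℝ≥0∞, (a ^ (p / (p + 1))) ^ (p + 1) = a ^ p := fun a => by
    rw [← ENNReal.rpow_mul, div_mul_cancel₀ _ (by positivity)]
  simp only [Pi.mul_apply, e1, e2, one_div_div] at hH
  calc _ ≤ ((∫⁻ x, W x ∂μ) ^ (p / (p + 1)) * (∫⁻ x, (K x : ℝ≥0∞) ^ p ∂μ) ^ (1 / (p + 1)))
        ^ (p + 1) :=
        ENNReal.rpow_le_rpow ((lintegral_mono_ae hpt).trans hH) (by positivity)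
    _ = _ := by
        rw [ENNReal.mul_rpow_of_nonneg _ _ (by positivity), e2, ← ENNReal.rpow_mul,
          one_div_mul_cancel (by positivity), ENNReal.rpow_one]

/-- The estimate of the level sets that feeds Stampacchia's iteration. -/
theorem exists_level_set_estimate {n : ℕ} (hn : 2 ≤ n) {p q : ℝ} (hp : 1 < p) (hq : 1 < q) :
    ∃ C : ℝ≥0, ∀ (P : Set (EuclideanSpace ℝ (Fin n)))
      (F : ℕ → EuclideanSpace ℝ (Fin n) → EuclideanSpace ℝ (Fin n))
      (H : EuclideanSpace ℝ (Fin n) → ℝ≥0∞)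
      (f : EuclideanSpace ℝ (Fin n) → EuclideanSpace ℝ (Fin n))
      (Df : EuclideanSpace ℝ (Fin n) → EuclideanSpace ℝ (Fin n) →L[ℝ] EuclideanSpace ℝ (Fin n))
      (K σ : EuclideanSpace ℝ (Fin n) → ℝ≥0) (v : ℝ≥0∞), IsDominatedLimit P F H f Df →
      AEMeasurable K (volume.restrict P) → AEMeasurable σ (volume.restrict P) →
      (∀ᵐ x ∂volume.restrict P, ‖Df x‖ ^ n ≤ K x * ((Df x).det + σ x)) →
      ∫⁻ x in P, (K x : ℝ≥0∞) ^ p ≤ v → ∫⁻ x in P, (σ x : ℝ≥0∞) ^ q ≤ v → v ≠ ⊤ →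
      ∀ (i : Fin n) (ε k h : ℝ), ε * ε = 1 → k < h →
      (∀ j, ∀ z ∈ frontier P, ε * F j z i < k) →
      ENNReal.ofReal (h - k) ^ (n * p) * volume.restrict P {x | h < ε * f x i}
        ≤ C * v ^ (1 + p / q) * volume.restrict P {x | k < ε * f x i} ^ (p - p / q) := by
  obtain ⟨C, hC⟩ := IsDominatedLimit.exists_lintegral_rampPrimitive_le hn hp
  -- The factor 2^{np} arises because the primitive of the ramp is only known to be at least (h -
  -- k)/2 above level h.
  refine ⟨2 ^ (n * p) * C, ?_⟩
  intro P F H f Df K σ v hL hK hσ hdist hKv hσv hv i ε k h hε hkh hb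
  have hn0 : 0 < n := by omega
  have hp0 : 0 < p := by linarith
  have hq0 : 0 < q := by linarith
  set μ := volume.restrict P
  have : IsFiniteMeasure μ := ⟨by
    rw [Measure.restrict_apply_univ]; exact hL.isBounded.measure_lt_top⟩
  set u : EuclideanSpace ℝ (Fin n) → ℝ := fun x => ε * f x i
  have hu : AEMeasurable u μ := hL.aemeasurable_coord i ε
  set θ : EuclideanSpace ℝ (Fin n) → ℝ := fun x => ramp k h (u x)
  have hθm : AEMeasurable θ μ := (continuous_ramp k h).measurable.comp_aemeasurable hu
  have hA : NullMeasurableSet {x | k < u x} μ := nullMeasurableSet_lt aemeasurable_const hu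
  have hA' : NullMeasurableSet {x | h < u x} μ := nullMeasurableSet_lt aemeasurable_const hu
  have hpq : q.HolderConjugate (q / (q - 1)) := Real.HolderConjugate.conjExponent hq
  have hσ' : AEMeasurable (fun x => (σ x : ℝ≥0∞)) μ := hσ.coe_nnreal_ennreal
  have hσA : ∀ s, ∫⁻ x in s, (σ x : ℝ≥0∞) ∂μ ≤ v ^ (1 / q) * μ s ^ (1 - 1 / q) := fun s => by
    refine (setLIntegral_le_rpow_mul_rpow_measure hσ'.restrict hpq).trans ?_
    have : 1 / (q / (q - 1)) = 1 - 1 / q := by field_simp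
    rw [this]
    gcongr
    exact (setLIntegral_le_lintegral _ _).trans hσv
  have hσint : Integrable (fun x => (σ x : ℝ)) μ := by
    refine ⟨hσ.coe_nnreal_real.aestronglyMeasurable, ?_⟩
    have h1 := hσA univ
    rw [Measure.restrict_univ] at h1
    have h2 : ∀ x, ‖(σ x : ℝ)‖ₑ = σ x := fun x => by
      rw [Real.enorm_of_nonneg (σ x).coe_nonneg, ENNReal.ofReal_coe_nnreal]
    simp only [HasFiniteIntegral, h2]
    refine h1.trans_lt (ENNReal.mul_lt_top
      (ENNReal.rpow_lt_top_of_nonneg (by positivity) hv)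
      (ENNReal.rpow_lt_top_of_nonneg ?_ (measure_ne_top _ _)))
    rw [sub_nonneg, div_le_one hq0]; exact hq.le
  have hθσint : Integrable (fun x => θ x * σ x) μ :=
    hσint.bdd_mul hθm.aestronglyMeasurable (c := 1) (Filter.Eventually.of_forall fun x => by
      rw [Real.norm_of_nonneg (ramp_nonneg _ _ _)]; exact ramp_le_one _ _ _)
  have hJint : Integrable (fun x => θ x * (Df x).det) μ := hL.integrable_ramp_mul_det i ε k h
  have hJ0 : ∫ x, θ x * (Df x).det ∂μ = 0 := hL.setIntegral_ramp_mul_det_eq_zero hε hkh hb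
  -- The Jacobian term integrates to zero, so the nonnegative function θ(J + σ) has the same
  -- integral as θσ, and θ is supported where u > k.
  have hW : ∫⁻ x, ENNReal.ofReal (θ x * ((Df x).det + σ x)) ∂μ
      ≤ v ^ (1 / q) * μ {x | k < u x} ^ (1 - 1 / q) := by
    have h1 : ∀ x, θ x * ((Df x).det + σ x) = θ x * (Df x).det + θ x * σ x := fun x => by ring
    have hnn : 0 ≤ᵐ[μ] fun x => θ x * (Df x).det + θ x * σ x := by
      filter_upwards [hdist] with x hx
      rw [← h1]
      exact mul_nonneg (ramp_nonneg _ _ _) (det_add_nonneg_of_distortion hx)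
    simp_rw [h1]
    have hadd : Integrable (fun x => θ x * (Df x).det + θ x * σ x) μ := hJint.add hθσint
    rw [← ofReal_integral_eq_lintegral_ofReal hadd hnn,
      integral_add hJint hθσint, hJ0, zero_add,
      ofReal_integral_eq_lintegral_ofReal hθσint (Filter.Eventually.of_forall fun x =>
        mul_nonneg (ramp_nonneg _ _ _) (σ x).coe_nonneg)]
    refine le_trans ?_ (hσA {x | k < u x})
    rw [← lintegral_indicator₀ hA]
    refine lintegral_mono fun x => ?_
    by_cases hx : k < u x
    · rw [indicator_of_mem (by exact hx), ← ENNReal.ofReal_coe_nnreal]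
      exact ENNReal.ofReal_le_ofReal (mul_le_of_le_one_left (σ x).coe_nonneg
        (ramp_le_one _ _ _))
    · have : θ x = 0 := ramp_of_le hkh (not_lt.1 hx)
      simp [this]
  have hmain := (hC P F H f Df hL i ε k h hε hkh hb).trans (mul_le_mul_right
    ((lintegral_mul_enorm_rpow_le_of_distortion hn0 hp hL.aestronglyMeasurable_fderiv hK hσ hdist
      hθm (fun x => ramp_nonneg _ _ _) (fun x => ramp_le_one _ _ _)).trans
      (mul_le_mul' (ENNReal.rpow_le_rpow hW hp0.le) hKv)) _)
  have hlow : ENNReal.ofReal ((h - k) / 2) ^ (n * p) * μ {x | h < u x}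
      ≤ ∫⁻ x, ‖rampPrimitive k h (u x)‖ₑ ^ (n * p) ∂μ := by
    rw [← setLIntegral_const, ← lintegral_indicator₀ hA']
    refine lintegral_mono fun x => ?_
    by_cases hx : h < u x
    · rw [indicator_of_mem (by exact hx)]
      refine ENNReal.rpow_le_rpow ?_ (by positivity)
      have h1 := le_rampPrimitive hkh hx.le
      rw [Real.enorm_of_nonneg (by linarith)]
      exact ENNReal.ofReal_le_ofReal h1
    · rw [indicator_of_notMem (by exact hx)]
      exact zero_le
  have hhalf : ENNReal.ofReal (h - k) ^ (n * p)
      = 2 ^ (n * p) * ENNReal.ofReal ((h - k) / 2) ^ (n * p) := by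
    rw [← ENNReal.mul_rpow_of_nonneg _ _ (by positivity),
      show (2 : ℝ≥0∞) = ENNReal.ofReal 2 by simp, ← ENNReal.ofReal_mul two_pos.le]
    congr 2
    ring
  rw [hhalf, mul_assoc]
  refine (mul_le_mul_right (hlow.trans hmain) _).trans (le_of_eq ?_)
  rw [ENNReal.mul_rpow_of_nonneg _ _ hp0.le, ← ENNReal.rpow_mul, ← ENNReal.rpow_mul,
    ENNReal.rpow_add_of_nonneg _ _ zero_le_one (by positivity), ENNReal.rpow_one]
  have e1 : 1 / q * p = p / q := by ring
  have e2 : (1 - 1 / q) * p = p - p / q := by ring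
  rw [e1, e2]
  push_cast [ENNReal.coe_rpow_of_nonneg (2 : ℝ≥0) (by positivity : (0 : ℝ) ≤ n * p)]
  ring

/-- Essential upper bound for a coordinate function in terms of its values on the frontier. -/
theorem exists_ae_le_of_frontier {n : ℕ} (hn : 2 ≤ n) {p q : ℝ} (hp : 1 < p) (hq : 1 < q)
    (hpq : p⁻¹ + q⁻¹ < 1) :
    ∃ C : ℝ, 0 < C ∧ ∀ (P : Set (EuclideanSpace ℝ (Fin n)))
      (F : ℕ → EuclideanSpace ℝ (Fin n) → EuclideanSpace ℝ (Fin n))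
      (H : EuclideanSpace ℝ (Fin n) → ℝ≥0∞)
      (f : EuclideanSpace ℝ (Fin n) → EuclideanSpace ℝ (Fin n))
      (Df : EuclideanSpace ℝ (Fin n) → EuclideanSpace ℝ (Fin n) →L[ℝ] EuclideanSpace ℝ (Fin n))
      (K σ : EuclideanSpace ℝ (Fin n) → ℝ≥0) (v : ℝ), IsDominatedLimit P F H f Df →
      AEMeasurable K (volume.restrict P) → AEMeasurable σ (volume.restrict P) →
      (∀ᵐ x ∂volume.restrict P, ‖Df x‖ ^ n ≤ K x * ((Df x).det + σ x)) →
      ∫⁻ x in P, (K x : ℝ≥0∞) ^ p ≤ ENNReal.ofReal v →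
      ∫⁻ x in P, (σ x : ℝ≥0∞) ^ q ≤ ENNReal.ofReal v →
      volume P ≤ ENNReal.ofReal v → 0 < v →
      ∀ (i : Fin n) (ε k : ℝ), ε * ε = 1 →
      (∃ᶠ j in Filter.atTop, ∀ z ∈ frontier P, ε * F j z i < k) →
      ∀ᵐ x ∂volume.restrict P, ε * f x i ≤ k + (C * v) ^ (1 / (n : ℝ)) := by
  obtain ⟨C, hC⟩ := exists_level_set_estimate hn hp hq
  have hn0 : (0 : ℝ) < n := by positivity
  have hp0 : 0 < p := by linarith
  have hq0 : 0 < q := by linarith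
  have hN : (0 : ℝ) < n * p := by positivity
  set β := p - p / q
  -- Multiplied by p, the hypothesis 1/p + 1/q < 1 reads 1 < p - p/q: superlinearity of the
  -- iteration is exactly the assumption on the exponents.
  have hβ : 1 < β := by
    have := mul_lt_mul_of_pos_left hpq hp0
    rw [mul_add, mul_inv_cancel₀ hp0.ne', mul_one, ← div_eq_mul_inv] at this
    simp only [β]; linarith
  set B : ℝ := C + 1
  have hB : 0 < B := by positivity
  set G : ℝ := B * 2 ^ (n * p) * 2 ^ (n * p / (β - 1))
  have hG : 0 < G := by positivity
  refine ⟨G ^ (1 / p), by positivity, ?_⟩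
  intro P F H f Df K σ v hL hK hσ hdist hKv hσv hPv hv i ε k₀ hε hfreq
  -- The boundary values of F_j need not converge, so the bound is assumed only for infinitely many
  -- j and a subsequence is taken.
  obtain ⟨φ, hφ, hφb⟩ := Filter.extraction_of_frequently_atTop hfreq
  set μ := volume.restrict P
  have hfin : IsFiniteMeasure μ := ⟨by
    rw [Measure.restrict_apply_univ]; exact hL.isBounded.measure_lt_top⟩
  set A : ℝ → ℝ := fun k => (μ {x | k < ε * f x i}).toReal
  -- The powers of v combine as (1 + p/q) + (β - 1) = p, so d^{np} is proportional to v^p and dⁿ is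
  -- linear in v. This linearity is what later lets a measure bound the oscillation.
  set d : ℝ := (G ^ (1 / p) * v) ^ (1 / (n : ℝ))
  have hd0 : 0 < d := by positivity
  have hdN : d ^ (n * p) = G * v ^ p := by
    rw [← Real.rpow_mul (by positivity), Real.mul_rpow (by positivity) hv.le,
      ← Real.rpow_mul hG.le, show 1 / (n : ℝ) * (n * p) = p by field_simp,
      one_div_mul_cancel hp0.ne', Real.rpow_one]
  have hlevel : ∀ k h, k₀ ≤ k → k < h →
      (h - k) ^ (n * p) * A h ≤ B * v ^ (1 + p / q) * A k ^ β := by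
    intro k h hk hkh
    have h1 := hC P _ H f Df K σ (ENNReal.ofReal v) (hL.comp_subseq hφ) hK hσ hdist hKv hσv
      ENNReal.ofReal_ne_top i ε k h hε hkh fun j z hz => (hφb j z hz).trans_le hk
    have h2 := ENNReal.toReal_mono (ENNReal.mul_ne_top (ENNReal.mul_ne_top ENNReal.coe_ne_top
      (ENNReal.rpow_ne_top_of_nonneg (by positivity) ENNReal.ofReal_ne_top))
      (ENNReal.rpow_ne_top_of_nonneg (by linarith) (measure_ne_top _ _))) h1
    simp only [ENNReal.toReal_mul, ← ENNReal.toReal_rpow, ENNReal.toReal_ofReal hv.le,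
      ENNReal.toReal_ofReal (sub_nonneg.2 hkh.le), ENNReal.coe_toReal] at h2
    refine h2.trans ?_
    gcongr
    simp [B]
  have hA0 : A (k₀ + d) = 0 := by
    refine stampacchia_eq_zero (N := n * p) (β := β) (B := B * v ^ (1 + p / q)) (v := v)
      (fun k => ENNReal.toReal_nonneg)
      (fun a b hab => ENNReal.toReal_mono (measure_ne_top _ _)
        (measure_mono fun x hx => lt_of_le_of_lt hab hx)) hN hβ (by positivity) hv ?_ hd0 ?_ hlevel
    · refine ENNReal.toReal_le_of_le_ofReal hv.le ((measure_mono (subset_univ _)).trans ?_)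
      rw [Measure.restrict_apply_univ]
      exact hPv
    · rw [hdN]
      have : v ^ p = v ^ (1 + p / q) * v ^ (β - 1) := by
        rw [← Real.rpow_add hv]
        congr 1
        simp only [β]; ring
      rw [this]
      simp only [G]
      ring
  have hnull : μ {x | k₀ + d < ε * f x i} = 0 :=
    ((ENNReal.toReal_eq_zero_iff _).1 hA0).resolve_right (measure_ne_top _ _)
  rw [ae_iff]
  simpa only [not_le] using hnull

/-- The reference values m_j may fail to converge, so their lower limit, the infimum of T, serves as
centre. T is neither empty nor unbounded below, for otherwise u would be infinite almost everywhere
on a nonzero measure. The slack s is needed since the infimum need not belong to T. -/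
theorem exists_ae_abs_sub_le {α : Type*} [MeasurableSpace α] {μ : Measure α} [NeZero μ]
    {u : α → ℝ} {m : ℕ → ℝ} {D s : ℝ} (hs : 0 < s)
    (h1 : ∀ k, (∃ᶠ j in Filter.atTop, m j < k) → ∀ᵐ x ∂μ, u x ≤ k + D)
    (h2 : ∀ k, (∀ᶠ j in Filter.atTop, k ≤ m j) → ∀ᵐ x ∂μ, k - D ≤ u x) :
    ∃ M, ∀ᵐ x ∂μ, |u x - M| ≤ D + s := by
  set T : Set ℝ := {k | ∃ᶠ j in Filter.atTop, m j < k}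
  have h2' : ∀ k ∉ T, ∀ᵐ x ∂μ, k - D ≤ u x := fun k hk => h2 k <| by
    have : ¬∃ᶠ j in Filter.atTop, m j < k := hk
    rw [Filter.not_frequently] at this
    exact this.mono fun j hj => not_lt.1 hj
  have hmono : ∀ k ∈ T, ∀ k', k ≤ k' → k' ∈ T := fun k hk k' hkk' =>
    Filter.Frequently.mono hk fun j hj => lt_of_lt_of_le hj hkk'
  have hne : T.Nonempty := by
    by_contra hT
    rw [not_nonempty_iff_eq_empty] at hT
    have h3 : ∀ᵐ x ∂μ, ∀ N : ℕ, (N : ℝ) - D ≤ u x :=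
      ae_all_iff.2 fun N => h2' N (by simp [hT])
    obtain ⟨x, hx⟩ := h3.exists
    obtain ⟨N, hN⟩ := exists_nat_gt (u x + D)
    linarith [hx N]
  have hbdd : BddBelow T := by
    by_contra hT
    have h3 : ∀ᵐ x ∂μ, ∀ N : ℕ, u x ≤ -(N : ℝ) + D := by
      refine ae_all_iff.2 fun N => h1 _ ?_
      rw [not_bddBelow_iff] at hT
      obtain ⟨k, hk, hkN⟩ := hT (-N)
      exact hmono k hk _ hkN.le
    obtain ⟨x, hx⟩ := h3.exists
    obtain ⟨N, hN⟩ := exists_nat_gt (D - u x)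
    linarith [hx N]
  obtain ⟨k, hk, hks⟩ := exists_lt_of_csInf_lt hne (lt_add_of_pos_right (sInf T) hs)
  have hl : sInf T - s ∉ T := fun h => by linarith [csInf_le hbdd h]
  refine ⟨sInf T, ?_⟩
  filter_upwards [h1 k hk, h2' _ hl] with x hx hx'
  rw [abs_le]
  constructor <;> linarith

/-! ### Oscillation on cubes -/

/-- The open box with corners `a` and `b`. -/
def openBox {n : ℕ} (a b : Fin n → ℝ) : Set (EuclideanSpace ℝ (Fin n)) :=
  {z | ∀ i, a i < z i ∧ z i < b i}

theorem isOpen_openBox {n : ℕ} (a b : Fin n → ℝ) : IsOpen (openBox a b) := by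
  rw [openBox, ofPred_forall]
  refine isOpen_iInter_of_finite fun i => ?_
  have hc : Continuous fun z : EuclideanSpace ℝ (Fin n) => z i := by fun_prop
  exact (isOpen_lt continuous_const hc).and (isOpen_lt hc continuous_const)

theorem exists_eq_of_mem_frontier_openBox {n : ℕ} {a b : Fin n → ℝ}
    {z : EuclideanSpace ℝ (Fin n)} (hz : z ∈ frontier (openBox a b)) :
    (∀ i, a i ≤ z i ∧ z i ≤ b i) ∧ ∃ i, z i = a i ∨ z i = b i := by
  rw [(isOpen_openBox a b).frontier_eq] at hz
  have hcl : IsClosed {z : EuclideanSpace ℝ (Fin n) | ∀ i, a i ≤ z i ∧ z i ≤ b i} := by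
    rw [ofPred_forall]
    refine isClosed_iInter fun i => ?_
    have hc : Continuous fun z : EuclideanSpace ℝ (Fin n) => z i := by fun_prop
    exact (isClosed_le continuous_const hc).and (isClosed_le hc continuous_const)
  have h1 : ∀ i, a i ≤ z i ∧ z i ≤ b i :=
    closure_minimal (fun w hw i => ⟨(hw i).1.le, (hw i).2.le⟩) hcl hz.1
  refine ⟨h1, ?_⟩
  by_contra! h
  exact hz.2 fun i => ⟨lt_of_le_of_ne (h1 i).1 (h i).1.symm, lt_of_le_of_ne (h1 i).2 (h i).2⟩

theorem EuclideanSpace.abs_apply_le_norm {n : ℕ} (z : EuclideanSpace ℝ (Fin n)) (i : Fin n) :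
    |z i| ≤ ‖z‖ := by
  simpa using PiLp.norm_apply_le z i

/-- The local oscillation of a Sobolev map subject to the distortion inequality is controlled by
the integrals of the data. -/
theorem exists_ae_norm_sub_le_of_closedCube {n : ℕ} (hn : 2 ≤ n) {p q : ℝ} (hp : 1 < p)
    (hq : 1 < q) (hpq : p⁻¹ + q⁻¹ < 1) :
    ∃ C : ℝ, 0 < C ∧ ∀ (Ω : Set (EuclideanSpace ℝ (Fin n)))
      (f : EuclideanSpace ℝ (Fin n) → EuclideanSpace ℝ (Fin n))
      (Df : EuclideanSpace ℝ (Fin n) → EuclideanSpace ℝ (Fin n) →L[ℝ] EuclideanSpace ℝ (Fin n))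
      (K σ : EuclideanSpace ℝ (Fin n) → ℝ≥0), IsOpen Ω → HasWeakDifferential Ω f Df →
      MemLpLoc Ω n f → MemLpLoc Ω n Df →
      AEMeasurable K (volume.restrict Ω) → AEMeasurable σ (volume.restrict Ω) →
      (∀ᵐ x ∂volume.restrict Ω, ‖Df x‖ ^ n ≤ K x * ((Df x).det + σ x)) →
      ∀ (x : EuclideanSpace ℝ (Fin n)) (R v : ℝ), 0 < R → 0 < v → closedCube x R ⊆ Ω →
      ∫⁻ y in closedCube x R, ‖Df y‖ₑ ^ n ≤ ENNReal.ofReal v →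
      ∫⁻ y in closedCube x R, (K y : ℝ≥0∞) ^ p ≤ ENNReal.ofReal v →
      ∫⁻ y in closedCube x R, (σ y : ℝ≥0∞) ^ q ≤ ENNReal.ofReal v →
      volume (closedCube x R) ≤ ENNReal.ofReal v →
      ∃ m, ∀ᵐ y ∂volume.restrict (Metric.closedBall x (R / 2)),
        ‖f y - m‖ ≤ C * v ^ (1 / (n : ℝ)) := by
  obtain ⟨d, rfl⟩ : ∃ d, n = d + 1 := ⟨n - 1, by omega⟩
  obtain ⟨C, hC0, hC⟩ := exists_ae_le_of_frontier hn hp hq hpq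
  obtain ⟨B, hB⟩ := exists_good_box (d := d) (by omega)
  set n := d + 1 with hnd
  have hn0 : (0 : ℝ) < n := by positivity
  set A : ℝ := B * (2 ^ n + 1)
  -- The factor 2ⁿ + 1 in A bounds the integral of H in units of v, the approximation being taken
  -- with error η = v; B comes from the good box. The leading factor n of the next constant passes
  -- from coordinates to the norm.
  have hA0 : 0 ≤ A := by positivity
  refine ⟨n * (A ^ (1 / (n : ℝ)) + 3 * C ^ (1 / (n : ℝ))), by positivity, ?_⟩
  intro Ω f Df K σ hΩ hf hfn hDfn hK hσ hdist x R v hR hv hQ hv1 hv2 hv3 hv4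
  obtain ⟨F, H, hF, hH, hHint, hHF, -, hlim, hlim'⟩ := hf.exists_smooth_approx hn hΩ hfn hDfn
    (isCompact_closedCube x hR.le) hQ (η := ENNReal.ofReal v) (by simpa using hv)
  obtain ⟨a, b, ha, hb, hab⟩ := hB x R hR H hH
  set P := openBox a b
  set s := (C * v) ^ (1 / (n : ℝ))
  set D := (A * v) ^ (1 / (n : ℝ))
  have hs : 0 < s := by positivity
  have hD : 0 ≤ D := by positivity
  have hsub : ∀ z : EuclideanSpace ℝ (Fin n), (∀ i, a i ≤ z i ∧ z i ≤ b i) →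
      z ∈ closedCube x R := fun z hz i => by
    rw [abs_le]; constructor <;> linarith [(ha i).1, (hb i).2, hz i]
  have hPQ : P ⊆ closedCube x R := fun z hz =>
    hsub z fun i => ⟨(hz i).1.le, (hz i).2.le⟩
  have hballP : Metric.closedBall x (R / 2) ⊆ P := fun z hz i => by
    have h1 := (EuclideanSpace.abs_apply_le_norm (z - x) i).trans (mem_closedBall_iff_norm.1 hz)
    rw [PiLp.sub_apply, abs_le] at h1
    constructor <;> linarith [(ha i).2, (hb i).1, h1.1, h1.2]
  have hHv : ∫⁻ w in closedCube x R, H w ≤ ENNReal.ofReal ((2 ^ n + 1) * v) := by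
    refine hHint.trans ?_
    rw [ENNReal.ofReal_mul (by positivity), ENNReal.ofReal_add (by positivity) zero_le_one,
      add_mul, ENNReal.ofReal_one, one_mul, ENNReal.ofReal_pow two_pos.le, ENNReal.ofReal_ofNat]
    exact add_le_add (mul_le_mul_right hv1 _) le_rfl
  have hL : IsDominatedLimit P F H f Df :=
    { isOpen := isOpen_openBox a b
      isBounded := (isCompact_closedCube x hR.le).isBounded.subset hPQ
      contDiff := hF
      lintegral_ne_top := ((lintegral_mono_set hPQ).trans hHv).trans_lt ENNReal.ofReal_lt_top |>.ne
      measurable := hH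
      enorm_pow_le := fun j y hy => hHF j y (hPQ hy)
      ae_tendsto := ae_restrict_of_ae_restrict_of_subset hPQ hlim
      ae_tendsto_fderiv := ae_restrict_of_ae_restrict_of_subset hPQ hlim' }
  have hPΩ : volume.restrict P ≤ volume.restrict Ω := Measure.restrict_mono (hPQ.trans hQ) le_rfl
  have key := hC P F H f Df K σ v hL (hK.mono_measure hPΩ) (hσ.mono_measure hPΩ)
    (ae_restrict_of_ae_restrict_of_subset (hPQ.trans hQ) hdist)
    ((lintegral_mono_set hPQ).trans hv2) ((lintegral_mono_set hPQ).trans hv3)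
    ((measure_mono hPQ).trans hv4) hv
  -- A corner of the box lies on its faces and provides the reference value from which the boundary
  -- values differ by at most D.
  set z₀ : EuclideanSpace ℝ (Fin n) := WithLp.toLp 2 a
  have hab' : ∀ i, a i ≤ b i := fun i => by linarith [(ha i).2, (hb i).1]
  have hz₀ : z₀ ∈ closedCube x R := hsub z₀ fun i => ⟨le_rfl, hab' i⟩
  have hosc : ∀ j i, ∀ z ∈ frontier P, |F j z i - F j z₀ i| ≤ D := by
    intro j i z hz
    obtain ⟨hz1, hz2⟩ := exists_eq_of_mem_frontier_openBox hz
    have h1 := (hab (F j) (hF j) (hHF j) z (hsub z hz1) z₀ hz₀ hz2 ⟨0, Or.inl rfl⟩).trans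
      (mul_le_mul_right hHv _)
    rw [← ofReal_norm, ← ENNReal.ofReal_pow (norm_nonneg _), ← ENNReal.ofReal_coe_nnreal,
      ← ENNReal.ofReal_mul (by positivity), ENNReal.ofReal_le_ofReal_iff (by positivity),
      ← mul_assoc] at h1
    have h2 : ‖F j z - F j z₀‖ ≤ D := by
      rw [← Real.rpow_le_rpow_iff (norm_nonneg _) hD hn0, Real.rpow_natCast]
      simp only [D]
      rw [← Real.rpow_mul (by positivity), one_div_mul_cancel hn0.ne', Real.rpow_one]
      exact h1
    exact (EuclideanSpace.abs_apply_le_norm (F j z - F j z₀) i).trans h2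
  have hne : NeZero (volume.restrict P) := ⟨by
    rw [Ne, Measure.restrict_eq_zero]
    exact ((Metric.measure_closedBall_pos volume x (half_pos hR)).trans_le
      (measure_mono hballP)).ne'⟩
  have hcoord : ∀ i, ∃ M, ∀ᵐ y ∂volume.restrict P, |f y i - M| ≤ D + 2 * s + s := by
    intro i
    refine exists_ae_abs_sub_le (m := fun j => F j z₀ i) hs (fun k hk => ?_) fun k hk => ?_
    · filter_upwards [key i 1 (k + D) (one_mul 1) (hk.mono fun j hj z hz => by
        have := (abs_le.1 (hosc j i z hz)).2
        simp only at hj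
        linarith)] with y hy
      linarith
    -- The extra s makes the frontier inequality strict, since here only k ≤ m_j is known; this
    -- accounts for the total 2s in the bound.
    · filter_upwards [key i (-1) (-k + D + s) (by norm_num) (Filter.Eventually.frequently
        (hk.mono fun j hj z hz => by
          have := (abs_le.1 (hosc j i z hz)).1
          simp only at hj
          linarith))] with y hy
      linarith
  choose M hM using hcoord
  refine ⟨WithLp.toLp 2 M, ?_⟩
  filter_upwards [ae_restrict_of_ae_restrict_of_subset hballP (ae_all_iff.2 hM)] with y hy
  have h1 : f y ∈ closedCube (WithLp.toLp 2 M) (D + 2 * s + s) := hy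
  have h2 := mem_closedBall_iff_norm.1
    (closedCube_subset_closedBall _ (by positivity) h1)
  refine h2.trans (le_of_eq ?_)
  simp only [D, s]
  rw [Real.mul_rpow hA0 hv.le, Real.mul_rpow hC0.le hv.le]
  ring

/-! ### Continuity and Lusin (N) from an oscillation bound -/

/-- The oscillation of `f` on small balls is controlled, up to null sets, by the measure `ν` of
enlarged balls. -/
def IsOscillationBound {n : ℕ} (Ω : Set (EuclideanSpace ℝ (Fin n)))
    (f : EuclideanSpace ℝ (Fin n) → EuclideanSpace ℝ (Fin n))
    (ν : Measure (EuclideanSpace ℝ (Fin n))) (L : ℝ) (C : ℝ≥0) : Prop :=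
  ∀ x r, 0 < r → Metric.closedBall x (L * r) ⊆ Ω → ∃ m,
    ∀ᵐ y ∂volume.restrict (Metric.closedBall x r),
      ‖f y - m‖ₑ ^ n ≤ C * ν (Metric.closedBall x (L * r))

namespace IsOscillationBound

variable {n : ℕ} {Ω : Set (EuclideanSpace ℝ (Fin n))}
  {f : EuclideanSpace ℝ (Fin n) → EuclideanSpace ℝ (Fin n)}
  {ν : Measure (EuclideanSpace ℝ (Fin n))} {L : ℝ} {C : ℝ≥0}

theorem congr (h : IsOscillationBound Ω f ν L C) (hL : 1 ≤ L)
    {g : EuclideanSpace ℝ (Fin n) → EuclideanSpace ℝ (Fin n)} (hfg : f =ᵐ[volume.restrict Ω] g) :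
    IsOscillationBound Ω g ν L C := by
  intro x r hr hx
  obtain ⟨m, hm⟩ := h x r hr hx
  have hsub : Metric.closedBall x r ⊆ Ω :=
    (Metric.closedBall_subset_closedBall (by nlinarith)).trans hx
  refine ⟨m, ?_⟩
  filter_upwards [hm, ae_restrict_of_ae_restrict_of_subset hsub hfg] with y hy hy'
  rwa [← hy']

/-- Shrinking closed balls decrease to a point, which is Lebesgue null in positive dimension and
hence ν-null; local finiteness gives continuity from above. -/
theorem tendsto_measure_closedBall [NeZero n] (hΩ : IsOpen Ω) (hν : ν ≪ volume)
    (hνC : ∀ D ⊆ Ω, IsCompact D → ν D ≠ ⊤) {x : EuclideanSpace ℝ (Fin n)} (hx : x ∈ Ω) :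
    Filter.Tendsto (fun r => ν (Metric.closedBall x r)) (nhdsWithin 0 (Ioi 0)) (nhds 0) := by
  have : Nontrivial (EuclideanSpace ℝ (Fin n)) :=
    Module.nontrivial_of_finrank_pos (R := ℝ) (by simpa using NeZero.pos n)
  obtain ⟨ρ, hρ, hρΩ⟩ := Metric.nhds_basis_closedBall.mem_iff.1 (hΩ.mem_nhds hx)
  have h := tendsto_measure_cthickening_of_isClosed (μ := ν) (s := {x})
    ⟨ρ, hρ, by
      rw [Metric.cthickening_singleton x hρ.le]
      exact hνC _ hρΩ (isCompact_closedBall x ρ)⟩ isClosed_singleton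
  rw [hν (measure_singleton x)] at h
  refine (h.mono_left nhdsWithin_le_nhds).congr' ?_
  filter_upwards [self_mem_nhdsWithin] with r hr
  rw [Metric.cthickening_singleton x (le_of_lt hr)]

/-- Countably many balls, with centres in a dense set and radii 1/(k + 1), have a common exceptional
null set. On its complement A, which is dense, f is Cauchy at every point of Ω because ν of small
balls tends to zero. Extension from A then gives the continuous representative. -/
theorem exists_continuousOn_ae_eq [NeZero n] (h : IsOscillationBound Ω f ν L C) (hL : 1 ≤ L)
    (hΩ : IsOpen Ω) (hν : ν ≪ volume) (hνC : ∀ D ⊆ Ω, IsCompact D → ν D ≠ ⊤) :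
    ∃ g : EuclideanSpace ℝ (Fin n) → EuclideanSpace ℝ (Fin n),
      ContinuousOn g Ω ∧ f =ᵐ[volume.restrict Ω] g := by
  obtain ⟨S, hSc, hSd⟩ := TopologicalSpace.exists_countable_dense (EuclideanSpace ℝ (Fin n))
  set ρ : ℕ → ℝ := fun k => 1 / ((k : ℝ) + 1)
  have hρ : ∀ k, 0 < ρ k := fun k => by positivity
  have hρlim : Filter.Tendsto ρ Filter.atTop (nhds 0) := tendsto_one_div_add_atTop_nhds_zero_nat
  have hex : ∀ c k, ∃ m, ∀ᵐ y, Metric.closedBall c (L * ρ k) ⊆ Ω →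
      y ∈ Metric.closedBall c (ρ k) →
      ‖f y - m‖ₑ ^ n ≤ C * ν (Metric.closedBall c (L * ρ k)) := by
    intro c k
    by_cases hc : Metric.closedBall c (L * ρ k) ⊆ Ω
    · obtain ⟨m, hm⟩ := h c (ρ k) (hρ k) hc
      refine ⟨m, ?_⟩
      rw [ae_restrict_iff' Metric.isClosed_closedBall.measurableSet] at hm
      filter_upwards [hm] with y hy _ using hy
    · exact ⟨0, Filter.Eventually.of_forall fun y hc' => absurd hc' hc⟩
  choose m hm using hex
  set A : Set (EuclideanSpace ℝ (Fin n)) := {y | ∀ c ∈ S, ∀ k,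
    Metric.closedBall c (L * ρ k) ⊆ Ω → y ∈ Metric.closedBall c (ρ k) →
      ‖f y - m c k‖ₑ ^ n ≤ C * ν (Metric.closedBall c (L * ρ k))}
  have hAae : ∀ᵐ y, y ∈ A := by
    have : ∀ᵐ y, ∀ c ∈ S, ∀ k, Metric.closedBall c (L * ρ k) ⊆ Ω →
        y ∈ Metric.closedBall c (ρ k) →
        ‖f y - m c k‖ₑ ^ n ≤ C * ν (Metric.closedBall c (L * ρ k)) :=
      (ae_ball_iff hSc).2 fun c _ => ae_all_iff.2 fun k => hm c k
    exact this
  have hAd : Dense A := Measure.dense_of_ae hAae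
  have hlim : ∀ x ∈ Ω, ∃ y, Filter.Tendsto f (nhdsWithin x A) (nhds y) := by
    intro x hx
    have : (nhdsWithin x A).NeBot := mem_closure_iff_nhdsWithin_neBot.1 (hAd x)
    rw [← cauchy_map_iff_exists_tendsto, Metric.cauchy_iff]
    refine ⟨Filter.map_neBot, fun ε hε => ?_⟩
    have hr : Filter.Tendsto (fun k => 2 * L * ρ k) Filter.atTop (nhdsWithin 0 (Ioi 0)) := by
      refine tendsto_nhdsWithin_iff.2 ⟨by simpa using hρlim.const_mul (2 * L),
        Filter.Eventually.of_forall fun k => mul_pos (by linarith) (hρ k)⟩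
    have h1 := ENNReal.Tendsto.const_mul (a := (C : ℝ≥0∞))
      ((tendsto_measure_closedBall hΩ hν hνC hx).comp hr) (Or.inr ENNReal.coe_ne_top)
    rw [mul_zero] at h1
    have hε' : (0 : ℝ≥0∞) < ENNReal.ofReal ((ε / 2) ^ n) := by
      rw [ENNReal.ofReal_pos]; positivity
    obtain ⟨δ, hδ, hδΩ⟩ := Metric.nhds_basis_closedBall.mem_iff.1 (hΩ.mem_nhds hx)
    obtain ⟨k, hk1, hk2⟩ := ((h1.eventually_lt_const hε').and
      ((tendsto_nhdsWithin_iff.1 hr).1.eventually_lt_const hδ)).exists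
    obtain ⟨c, hcS, hc⟩ := Metric.mem_closure_iff.1 (hSd x) (ρ k / 2) (half_pos (hρ k))
    -- The centre c is within ρ_k/2 of x; since L ≥ 1, doubling the radius absorbs this
    -- displacement.
    have hball : Metric.closedBall c (L * ρ k) ⊆ Metric.closedBall x (2 * L * ρ k) :=
      Metric.closedBall_subset_closedBall' (by rw [dist_comm]; nlinarith [hρ k])
    have hcΩ : Metric.closedBall c (L * ρ k) ⊆ Ω :=
      hball.trans ((Metric.closedBall_subset_closedBall hk2.le).trans hδΩ)
    have hest : ∀ y ∈ Metric.ball x (ρ k / 2) ∩ A, ‖f y - m c k‖ < ε / 2 := by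
      intro y hy
      have hyc : y ∈ Metric.closedBall c (ρ k) := by
        rw [Metric.mem_closedBall]
        linarith [dist_triangle y x c, Metric.mem_ball.1 hy.1]
      have h2 := ((hy.2 c hcS k hcΩ hyc).trans
        (mul_le_mul_right (measure_mono hball) _)).trans_lt hk1
      rw [← ofReal_norm, ← ENNReal.ofReal_pow (norm_nonneg _),
        ENNReal.ofReal_lt_ofReal_iff (by positivity)] at h2
      exact lt_of_pow_lt_pow_left₀ n (by positivity) h2
    refine ⟨f '' (Metric.ball x (ρ k / 2) ∩ A), Filter.image_mem_map
      (Filter.inter_mem (mem_nhdsWithin_of_mem_nhds (Metric.ball_mem_nhds x (half_pos (hρ k))))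
        self_mem_nhdsWithin), ?_⟩
    rintro _ ⟨y, hy, rfl⟩ _ ⟨y', hy', rfl⟩
    rw [dist_eq_norm]
    calc ‖f y - f y'‖ = ‖(f y - m c k) - (f y' - m c k)‖ := by abel_nf
      _ ≤ ‖f y - m c k‖ + ‖f y' - m c k‖ := norm_sub_le _ _
      _ < ε := by linarith [hest y hy, hest y' hy']
  refine ⟨extendFrom A f, continuousOn_extendFrom (fun x _ => hAd x) hlim, ?_⟩
  filter_upwards [ae_restrict_of_ae hAae, ae_restrict_mem hΩ.measurableSet] with x hxA hxΩ
  obtain ⟨y, hy⟩ := hlim x hxΩ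
  rw [extendFrom_eq (hAd x) hy]
  exact tendsto_nhds_unique (tendsto_pure_nhds f x)
    (hy.mono_left (pure_le_nhdsWithin hxA))

end IsOscillationBound

/-- The n-th power makes the volume bound linear in t, so that bounds for many balls can be summed.
-/
theorem EuclideanSpace.volume_setOf_enorm_sub_pow_le {n : ℕ} [NeZero n]
    (m : EuclideanSpace ℝ (Fin n)) (t : ℝ≥0∞) :
    volume {z : EuclideanSpace ℝ (Fin n) | ‖z - m‖ₑ ^ n ≤ t}
      ≤ t * volume (Metric.ball (0 : EuclideanSpace ℝ (Fin n)) 1) := by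
  have hn : (n : ℝ) ≠ 0 := by exact_mod_cast NeZero.ne n
  rcases eq_or_ne t ⊤ with rfl | ht
  · rw [ENNReal.top_mul (Metric.measure_ball_pos volume _ one_pos).ne']
    exact le_top
  · lift t to ℝ≥0 using ht
    have hsub : {z : EuclideanSpace ℝ (Fin n) | ‖z - m‖ₑ ^ n ≤ t}
        ⊆ Metric.closedBall m ((t : ℝ) ^ (1 / (n : ℝ))) := by
      intro z hz
      have hz' : ‖z - m‖ₑ ^ n ≤ t := hz
      rw [← ofReal_norm, ← ENNReal.ofReal_pow (norm_nonneg _), ← ENNReal.ofReal_coe_nnreal,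
        ENNReal.ofReal_le_ofReal_iff t.coe_nonneg, ← Real.rpow_natCast] at hz'
      rw [mem_closedBall_iff_norm, one_div]
      exact (Real.le_rpow_inv_iff_of_pos (norm_nonneg _) t.coe_nonneg
        (lt_of_le_of_ne (Nat.cast_nonneg n) hn.symm)).2 hz'
    refine (measure_mono hsub).trans (le_of_eq ?_)
    rw [Measure.addHaar_closedBall _ _ (by positivity), finrank_euclideanSpace_fin,
      ← Real.rpow_natCast, ← Real.rpow_mul t.coe_nonneg, one_div_mul_cancel hn, Real.rpow_one,
      ENNReal.ofReal_coe_nnreal]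

/-- Doubling-type radii for a measure dominating Lebesgue measure. -/
theorem exists_pow_measure_closedBall_le {n : ℕ} [NeZero n] {Ω : Set (EuclideanSpace ℝ (Fin n))}
    {ν : Measure (EuclideanSpace ℝ (Fin n))}
    (hνvol : ∀ x r, Metric.closedBall x r ⊆ Ω →
      volume (Metric.closedBall x r) ≤ ν (Metric.closedBall x r))
    {L : ℝ} (hL : 1 ≤ L) {x : EuclideanSpace ℝ (Fin n)} {ρ : ℝ} (hρ : 0 < ρ)
    (hx : Metric.closedBall x ρ ⊆ Ω) (hfin : ν (Metric.closedBall x ρ) ≠ ⊤) :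
    ∃ r, 0 < r ∧ r ≤ ρ ∧ L * r ≤ ρ ∧
      ν (Metric.closedBall x (L * r))
        ≤ ENNReal.ofReal (2 * L ^ n) * ν (Metric.closedBall x r) := by
  have hL0 : 0 < L := by linarith
  -- If every radius ρL^{-k} failed, ν of these balls would decay faster than (2Lⁿ)^{-k}, whereas
  -- domination of Lebesgue measure only allows decay like L^{-nk}. The discrepancy 2^k is
  -- unbounded.
  by_contra! hcon
  set R : ℕ → ℝ := fun k => ρ * L⁻¹ ^ k
  have hR0 : ∀ k, 0 < R k := fun k => by positivity
  have hRle : ∀ k, R k ≤ ρ := fun k =>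
    mul_le_of_le_one_right hρ.le (pow_le_one₀ (by positivity) (inv_le_one_of_one_le₀ hL))
  have hRL : ∀ k, L * R (k + 1) = R k := fun k => by
    simp only [R, pow_succ]; field_simp
  have hM0 : 0 < 2 * L ^ n := by positivity
  set a : ℕ → ℝ≥0∞ := fun k => ν (Metric.closedBall x (R k))
  have hstep : ∀ k, ENNReal.ofReal (2 * L ^ n) * a (k + 1) ≤ a k := fun k => by
    have h1 := hcon (R (k + 1)) (hR0 _) (hRle _) (by rw [hRL]; exact hRle _)
    rw [hRL] at h1
    exact h1.le
  have hiter : ∀ k, ENNReal.ofReal (2 * L ^ n) ^ k * a k ≤ a 0 := by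
    intro k
    induction k with
    | zero => simp
    | succ k ih =>
      refine le_trans ?_ ih
      rw [pow_succ, mul_assoc]
      exact mul_le_mul_right (hstep k) _
  have hlow : ∀ k, ENNReal.ofReal ((R k) ^ n) *
      volume (Metric.ball (0 : EuclideanSpace ℝ (Fin n)) 1) ≤ a k := fun k => by
    have := hνvol x (R k) ((Metric.closedBall_subset_closedBall (hRle k)).trans hx)
    rwa [Measure.addHaar_closedBall _ _ (hR0 k).le, finrank_euclideanSpace_fin] at this
  have hbound : ∀ k : ℕ, ENNReal.ofReal (2 ^ k * ρ ^ n) *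
      volume (Metric.ball (0 : EuclideanSpace ℝ (Fin n)) 1) ≤ a 0 := fun k => by
    refine le_trans (le_of_eq ?_) ((mul_le_mul_right (hlow k) _).trans (hiter k))
    rw [← mul_assoc, ← ENNReal.ofReal_pow hM0.le, ← ENNReal.ofReal_mul (by positivity)]
    congr 2
    simp only [R]
    rw [mul_pow, mul_pow, ← pow_mul, ← pow_mul, inv_pow, mul_comm k n]
    field_simp
  have ha0 : a 0 ≠ ⊤ := by simpa [a, R] using hfin
  have hω0 := (Metric.measure_ball_pos volume (0 : EuclideanSpace ℝ (Fin n)) one_pos).ne'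
  have hω1 : volume (Metric.ball (0 : EuclideanSpace ℝ (Fin n)) 1) ≠ ⊤ :=
    measure_ball_lt_top.ne
  have h2 : Filter.Tendsto (fun k : ℕ => (2 : ℝ) ^ k * ρ ^ n) Filter.atTop Filter.atTop :=
    (tendsto_pow_atTop_atTop_of_one_lt one_lt_two).atTop_mul_const (by positivity)
  obtain ⟨k, hk⟩ := (h2.eventually_gt_atTop (a 0 / volume
    (Metric.ball (0 : EuclideanSpace ℝ (Fin n)) 1)).toReal).exists
  have h3 := hbound k
  rw [← ENNReal.le_div_iff_mul_le (Or.inl hω0) (Or.inl hω1)] at h3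
  have h4 := (ENNReal.ofReal_le_iff_le_toReal (ENNReal.div_ne_top ha0 hω0)).1 h3
  linarith

namespace IsOscillationBound

variable {n : ℕ} {Ω : Set (EuclideanSpace ℝ (Fin n))}
  {g : EuclideanSpace ℝ (Fin n) → EuclideanSpace ℝ (Fin n)}
  {ν : Measure (EuclideanSpace ℝ (Fin n))} {L : ℝ} {C : ℝ≥0}

/-- For continuous g the points of the open ball violating the bound form an open null set, which is
empty. -/
theorem exists_forall_mem_ball (h : IsOscillationBound Ω g ν L C) (hL : 1 ≤ L)
    (hg : ContinuousOn g Ω) {x : EuclideanSpace ℝ (Fin n)} {r : ℝ} (hr : 0 < r)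
    (hx : Metric.closedBall x (L * r) ⊆ Ω) :
    ∃ m, ∀ y ∈ Metric.ball x r, ‖g y - m‖ₑ ^ n ≤ C * ν (Metric.closedBall x (L * r)) := by
  obtain ⟨m, hm⟩ := h x r hr hx
  refine ⟨m, ?_⟩
  have hsub : Metric.ball x r ⊆ Ω := Metric.ball_subset_closedBall.trans
    ((Metric.closedBall_subset_closedBall (by nlinarith)).trans hx)
  have hopen : IsOpen (Metric.ball x r ∩
      g ⁻¹' {z | C * ν (Metric.closedBall x (L * r)) < ‖z - m‖ₑ ^ n}) :=
    (hg.mono hsub).isOpen_inter_preimage Metric.isOpen_ball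
      (isOpen_lt continuous_const (by fun_prop))
  have hnull : volume (Metric.ball x r ∩
      g ⁻¹' {z | C * ν (Metric.closedBall x (L * r)) < ‖z - m‖ₑ ^ n}) = 0 := by
    have hm' := ae_restrict_of_ae_restrict_of_subset Metric.ball_subset_closedBall hm
    rw [ae_restrict_iff' Metric.isOpen_ball.measurableSet, ae_iff] at hm'
    refine measure_mono_null (fun y hy => ?_) hm'
    simp only [mem_ofPred_eq, Classical.not_imp, not_le]
    exact hy
  rw [hopen.measure_eq_zero_iff volume] at hnull
  intro y hy
  by_contra! hcon
  exact (hnull ▸ (⟨hy, hcon⟩ : y ∈ Metric.ball x r ∩ _) : y ∈ (∅ : Set _))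

/-- A null set is ν-null, hence has open neighbourhoods of ν-measure below ε. Balls in such a
neighbourhood are chosen with ν doubling at their radius, and Vitali's lemma selects a disjoint
subfamily whose enlargements cover. Each enlarged ball has an image of volume at most a constant
times ν of the original ball, and these sum to a multiple of ε. -/
theorem lusinN [NeZero n] (h : IsOscillationBound Ω g ν L C) (hL : 1 ≤ L)
    (hg : ContinuousOn g Ω) (hΩ : IsOpen Ω) (hν : ν ≪ volume)
    (hνvol : ∀ x r, Metric.closedBall x r ⊆ Ω →
      volume (Metric.closedBall x r) ≤ ν (Metric.closedBall x r))
    (hνC : ∀ D ⊆ Ω, IsCompact D → ν D ≠ ⊤) : LusinN Ω g := by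
  intro E hE hE0
  have hL0 : 0 < L := by linarith
  suffices hmain : ∀ x ∈ Ω, ∃ s > 0, volume (g '' (E ∩ Metric.ball x s)) = 0 by
    -- The set function A ↦ |g(A)| is an outer measure, so it vanishes on E once it vanishes
    -- locally.
    have := measure_null_of_locally_null
      (μ := OuterMeasure.comap g (volume : Measure (EuclideanSpace ℝ (Fin n))).toOuterMeasure)
      E fun x hx => by
        obtain ⟨s, hs, hs0⟩ := hmain x (hE hx)
        refine ⟨E ∩ Metric.ball x s, Filter.inter_mem self_mem_nhdsWithin
          (mem_nhdsWithin_of_mem_nhds (Metric.ball_mem_nhds x hs)), ?_⟩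
        rw [OuterMeasure.comap_apply]
        exact hs0
    rw [OuterMeasure.comap_apply] at this
    exact this
  intro x₀ hx₀
  obtain ⟨s, hs, hsΩ⟩ := Metric.nhds_basis_closedBall.mem_iff.1 (hΩ.mem_nhds hx₀)
  refine ⟨s, hs, ?_⟩
  set V := Metric.ball x₀ s
  have hVΩ : V ⊆ Ω := Metric.ball_subset_closedBall.trans hsΩ
  have hVfin : ν V < ⊤ := lt_of_le_of_lt (measure_mono Metric.ball_subset_closedBall)
    (lt_top_iff_ne_top.2 (hνC _ hsΩ (isCompact_closedBall x₀ s)))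
  have hfin : IsFiniteMeasure (ν.restrict V) := ⟨by rwa [Measure.restrict_apply_univ]⟩
  -- Doubling constant for dilation by 5L: the 5 accommodates the Vitali enlargement, and L comes
  -- from the oscillation bound.
  set M := ENNReal.ofReal (2 * (5 * L) ^ n)
  set w := volume (Metric.ball (0 : EuclideanSpace ℝ (Fin n)) 1)
  have hw1 : w ≠ ⊤ := measure_ball_lt_top.ne
  have hbound : ∀ ε : ℝ≥0∞, 0 < ε → volume (g '' (E ∩ V)) ≤ C * M * w * ε := by
    intro ε hε
    have hEV : ν.restrict V (E ∩ V) < ε := by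
      refine lt_of_le_of_lt (Measure.restrict_apply_le _ _) ?_
      rwa [measure_mono_null inter_subset_left (hν hE0)]
    obtain ⟨U', hU'E, hU'o, hU'ε⟩ := Set.exists_isOpen_lt_of_lt _ _ hEV
    rw [Measure.restrict_apply hU'o.measurableSet] at hU'ε
    set U := U' ∩ V
    have hUo : IsOpen U := hU'o.inter Metric.isOpen_ball
    have hUV : U ⊆ V := inter_subset_right
    have hrad : ∀ x : EuclideanSpace ℝ (Fin n), ∃ r, x ∈ U → 0 < r ∧ r ≤ 1 ∧
        Metric.closedBall x (5 * L * r) ⊆ U ∧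
        ν (Metric.closedBall x (5 * L * r)) ≤ M * ν (Metric.closedBall x r) := by
      intro x
      by_cases hx : x ∈ U
      · obtain ⟨ρ', hρ', hρ'U⟩ := Metric.nhds_basis_closedBall.mem_iff.1 (hUo.mem_nhds hx)
        have hρU : Metric.closedBall x (min ρ' 1) ⊆ U :=
          (Metric.closedBall_subset_closedBall (min_le_left _ _)).trans hρ'U
        obtain ⟨r, hr, hr1, hr2, hr3⟩ := exists_pow_measure_closedBall_le hνvol
          (L := 5 * L) (by linarith) (lt_min hρ' one_pos) (hρU.trans (hUV.trans hVΩ))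
          ((measure_mono (hρU.trans hUV)).trans_lt hVfin).ne
        exact ⟨r, fun _ => ⟨hr, hr1.trans (min_le_right _ _),
          (Metric.closedBall_subset_closedBall hr2).trans hρU, hr3⟩⟩
      · exact ⟨0, fun hx' => absurd hx' hx⟩
    choose r hr using hrad
    have hEU : E ∩ V ⊆ U := fun x hx => ⟨hU'E hx, hx.2⟩
    -- Enlargement by 4 places each selected closed ball of radius 4r inside the open ball of radius
    -- 5r, where the pointwise bound holds.
    obtain ⟨u, huE, hudisj, hucov⟩ :=
      Vitali.exists_disjoint_subfamily_covering_enlargement_closedBall (E ∩ V)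
        (fun x : EuclideanSpace ℝ (Fin n) => x) r 1 (fun x hx => (hr x (hEU hx)).2.1) 4
        (by norm_num)
    have huc : u.Countable := hudisj.countable_of_nonempty_interior fun x hx =>
      ⟨x, mem_interior_iff_mem_nhds.2 (Metric.closedBall_mem_nhds x (hr x (hEU (huE hx))).1)⟩
    have hm : ∀ x : EuclideanSpace ℝ (Fin n), ∃ m, x ∈ U → ∀ y ∈ Metric.ball x (5 * r x),
        ‖g y - m‖ₑ ^ n ≤ C * ν (Metric.closedBall x (5 * L * r x)) := by
      intro x
      by_cases hx : x ∈ U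
      · have he : L * (5 * r x) = 5 * L * r x := by ring
        obtain ⟨m, hm⟩ := h.exists_forall_mem_ball hL hg (x := x) (r := 5 * r x)
          (by linarith [(hr x hx).1]) (by rw [he]; exact (hr x hx).2.2.1.trans (hUV.trans hVΩ))
        rw [he] at hm
        exact ⟨m, fun _ => hm⟩
      · exact ⟨0, fun hx' => absurd hx' hx⟩
    choose m hm using hm
    have hcover : g '' (E ∩ V) ⊆ ⋃ x ∈ u, {z | ‖z - m x‖ₑ ^ n
        ≤ C * ν (Metric.closedBall x (5 * L * r x))} := by
      rintro _ ⟨y, hy, rfl⟩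
      obtain ⟨x, hxu, hx⟩ := hucov y hy
      have hxU := hEU (huE hxu)
      refine mem_biUnion hxu (hm x hxU y ?_)
      have h1 := hx (Metric.mem_closedBall_self (hr y (hEU hy)).1.le)
      exact Metric.closedBall_subset_ball (by linarith [(hr x hxU).1]) h1
    calc volume (g '' (E ∩ V)) ≤ _ := measure_mono hcover
      _ ≤ ∑' x : u, volume {z | ‖z - m x‖ₑ ^ n
          ≤ C * ν (Metric.closedBall x.1 (5 * L * r x))} := by
        have : Countable u := huc
        rw [biUnion_eq_iUnion]
        exact measure_iUnion_le _
      _ ≤ ∑' x : u, C * M * w * ν (Metric.closedBall x.1 (r x)) := by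
        refine ENNReal.tsum_le_tsum fun x => ?_
        refine (EuclideanSpace.volume_setOf_enorm_sub_pow_le _ _).trans ?_
        calc _ ≤ C * (M * ν (Metric.closedBall x.1 (r x))) * w :=
              mul_le_mul_left (mul_le_mul_right (hr x (hEU (huE x.2))).2.2.2 _) _
          _ = _ := by ring
      _ = C * M * w * ν (⋃ x ∈ u, Metric.closedBall x (r x)) := by
        rw [ENNReal.tsum_mul_left, measure_biUnion huc hudisj
          fun x _ => Metric.isClosed_closedBall.measurableSet]
      _ ≤ C * M * w * ε := by
        refine mul_le_mul_right ((measure_mono ?_).trans hU'ε.le) _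
        refine iUnion₂_subset fun x hx => ?_
        have hxU := hr x (hEU (huE hx))
        exact (Metric.closedBall_subset_closedBall (by nlinarith [hxU.1])).trans hxU.2.2.1
  have hK : C * M * w ≠ ⊤ := ENNReal.mul_ne_top
    (ENNReal.mul_ne_top ENNReal.coe_ne_top ENNReal.ofReal_ne_top) hw1
  have hlim : Filter.Tendsto (fun ε : ℝ≥0∞ => C * M * w * ε) (nhdsWithin 0 (Ioi 0)) (nhds 0) := by
    have := ENNReal.Tendsto.const_mul (a := C * M * w) (Filter.tendsto_id (α := ℝ≥0∞) (x := nhds 0))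
      (Or.inr hK)
    rw [mul_zero] at this
    exact this.mono_left nhdsWithin_le_nhds
  exact le_antisymm (ge_of_tendsto hlim (by
    filter_upwards [self_mem_nhdsWithin] with ε hε using hbound ε hε)) zero_le

end IsOscillationBound

/-! ### Sobolev solutions of the distortion inequality -/

/-- Continuity and the Lusin property for Sobolev solutions of `|Df|ⁿ ≤ K (J_f + σ)`. -/
theorem exists_continuousOn_lusinN_of_distortion {n : ℕ} (hn : 2 ≤ n) {p q : ℝ} (hp : 1 < p)
    (hq : 1 < q) (hpq : p⁻¹ + q⁻¹ < 1) {Ω : Set (EuclideanSpace ℝ (Fin n))} (hΩ : IsOpen Ω)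
    {f : EuclideanSpace ℝ (Fin n) → EuclideanSpace ℝ (Fin n)}
    {Df : EuclideanSpace ℝ (Fin n) → EuclideanSpace ℝ (Fin n) →L[ℝ] EuclideanSpace ℝ (Fin n)}
    (hf : HasWeakDifferential Ω f Df) (hfn : MemLpLoc Ω n f) (hDfn : MemLpLoc Ω n Df)
    {K σ : EuclideanSpace ℝ (Fin n) → ℝ≥0} (hK : AEMeasurable K (volume.restrict Ω))
    (hσ : AEMeasurable σ (volume.restrict Ω))
    (hdist : ∀ᵐ x ∂volume.restrict Ω, ‖Df x‖ ^ n ≤ K x * ((Df x).det + σ x))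
    (hKp : ∀ D ⊆ Ω, IsCompact D → ∫⁻ x in D, (K x : ℝ≥0∞) ^ p ≠ ⊤)
    (hσq : ∀ D ⊆ Ω, IsCompact D → ∫⁻ x in D, (σ x : ℝ≥0∞) ^ q ≠ ⊤) :
    ∃ g : EuclideanSpace ℝ (Fin n) → EuclideanSpace ℝ (Fin n),
      ContinuousOn g Ω ∧ f =ᵐ[volume.restrict Ω] g ∧ LusinN Ω g := by
  have : NeZero n := ⟨by omega⟩
  have hn0 : (0 : ℝ) < n := by positivity
  have hn1 : (1 : ℝ) ≤ n := by exact_mod_cast (by omega : 1 ≤ n)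
  obtain ⟨C, hC0, hC⟩ := exists_ae_norm_sub_le_of_closedCube hn hp hq hpq
  -- All quantities that bound the oscillation are collected in one density; the summand 1 makes ν
  -- dominate Lebesgue measure.
  set w : EuclideanSpace ℝ (Fin n) → ℝ≥0∞ := fun y =>
    ‖Df y‖ₑ ^ n + (K y : ℝ≥0∞) ^ p + (σ y : ℝ≥0∞) ^ q + 1
  set ν := (volume.restrict Ω).withDensity w
  have hνeq : ∀ D ⊆ Ω, MeasurableSet D → ν D = ∫⁻ y in D, w y := fun D hD hDm => by
    rw [withDensity_apply _ hDm, Measure.restrict_restrict hDm, inter_eq_left.2 hD]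
  have hνac : ν ≪ volume :=
    (withDensity_absolutelyContinuous _ _).trans Measure.restrict_le_self.absolutelyContinuous
  have hwsplit : ∀ D ⊆ Ω, ∫⁻ y in D, w y = (∫⁻ y in D, ‖Df y‖ₑ ^ n)
      + (∫⁻ y in D, (K y : ℝ≥0∞) ^ p) + (∫⁻ y in D, (σ y : ℝ≥0∞) ^ q) + volume D := by
    intro D hD
    have hle : volume.restrict D ≤ volume.restrict Ω := Measure.restrict_mono hD le_rfl
    have hσ' : AEMeasurable (fun y => (σ y : ℝ≥0∞) ^ q) (volume.restrict D) :=
      ((hσ.mono_measure hle).coe_nnreal_ennreal).pow_const q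
    have hK' : AEMeasurable (fun y => (K y : ℝ≥0∞) ^ p) (volume.restrict D) :=
      ((hK.mono_measure hle).coe_nnreal_ennreal).pow_const p
    simp only [w]
    rw [lintegral_add_right _ measurable_const, lintegral_add_right' _ hσ',
      lintegral_add_right' _ hK', setLIntegral_one]
  have hνC : ∀ D ⊆ Ω, IsCompact D → ν D ≠ ⊤ := by
    intro D hD hDc
    rw [hνeq D hD hDc.measurableSet, hwsplit D hD]
    refine ENNReal.add_ne_top.2 ⟨ENNReal.add_ne_top.2 ⟨ENNReal.add_ne_top.2 ⟨?_, hKp D hD hDc⟩,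
      hσq D hD hDc⟩, hDc.measure_ne_top⟩
    have h1 := (hDfn D hD hDc).2
    rw [eLpNorm_lt_top_iff_lintegral_rpow_enorm_lt_top (by exact_mod_cast NeZero.ne n)
      (ENNReal.natCast_ne_top n)] at h1
    simpa using h1.ne
  have hνvol : ∀ x r, Metric.closedBall x r ⊆ Ω →
      volume (Metric.closedBall x r) ≤ ν (Metric.closedBall x r) := fun x r hx => by
    rw [hνeq _ hx Metric.isClosed_closedBall.measurableSet, hwsplit _ hx]
    exact le_add_self
  -- The cube of half side 2r gives the bound on the ball of radius r and lies in the ball of radius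
  -- 2nr.
  have hosc : IsOscillationBound Ω f ν (2 * n) (C.toNNReal ^ n) := by
    intro x r hr hx
    set B := Metric.closedBall x (2 * n * r)
    have hQB : closedCube x (2 * r) ⊆ B := by
      have := closedCube_subset_closedBall x (R := 2 * r) (by positivity)
      rwa [show (n : ℝ) * (2 * r) = 2 * n * r by ring] at this
    have hBc : IsCompact B := isCompact_closedBall _ _
    have hBfin := hνC B hx hBc
    have hνB : ν B = (∫⁻ y in B, ‖Df y‖ₑ ^ n) + (∫⁻ y in B, (K y : ℝ≥0∞) ^ p)
        + (∫⁻ y in B, (σ y : ℝ≥0∞) ^ q) + volume B := by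
      rw [hνeq _ hx hBc.measurableSet, hwsplit _ hx]
    have hBpos : 0 < ν B :=
      (Metric.measure_closedBall_pos volume x (by positivity)).trans_le (hνvol x _ hx)
    have hv : 0 < (ν B).toReal := ENNReal.toReal_pos hBpos.ne' hBfin
    have hvB : ENNReal.ofReal (ν B).toReal = ν B := ENNReal.ofReal_toReal hBfin
    obtain ⟨m, hm⟩ := hC Ω f Df K σ hΩ hf hfn hDfn hK hσ hdist x (2 * r) (ν B).toReal
      (by positivity) hv (hQB.trans hx)
      ((lintegral_mono_set hQB).trans (by rw [hvB, hνB, add_assoc, add_assoc]; exact le_self_add))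
      ((lintegral_mono_set hQB).trans (by
        rw [hvB, hνB, add_assoc]; exact le_add_self.trans le_self_add))
      ((lintegral_mono_set hQB).trans (by rw [hvB, hνB]; exact le_add_self.trans le_self_add))
      ((measure_mono hQB).trans (by rw [hvB, hνB]; exact le_add_self))
    rw [mul_div_cancel_left₀ r two_ne_zero] at hm
    refine ⟨m, hm.mono fun y hy => ?_⟩
    have h1 : ‖f y - m‖ ^ n ≤ C ^ n * (ν B).toReal := by
      refine (pow_le_pow_left₀ (norm_nonneg _) hy n).trans (le_of_eq ?_)
      rw [mul_pow, ← Real.rpow_natCast ((ν B).toReal ^ (1 / (n : ℝ))), ← Real.rpow_mul hv.le,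
        one_div_mul_cancel hn0.ne', Real.rpow_one]
    rw [← ofReal_norm, ← ENNReal.ofReal_pow (norm_nonneg _)]
    refine (ENNReal.ofReal_le_ofReal h1).trans (le_of_eq ?_)
    rw [ENNReal.ofReal_mul (by positivity), hvB, ENNReal.ofReal_pow hC0.le]
    simp [ENNReal.ofReal]
  have hL : (1 : ℝ) ≤ 2 * n := by linarith
  obtain ⟨g, hg, hfg⟩ := hosc.exists_continuousOn_ae_eq hL hΩ hνac hνC
  exact ⟨g, hg, hfg, (hosc.congr hL hfg).lusinN hL hg hΩ hνac hνvol hνC⟩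

/-! ### Integrability of the data, uniqueness of Df, and conclusion -/

theorem ENNReal.add_pow_le_two_pow_mul (a b : ℝ≥0∞) (n : ℕ) :
    (a + b) ^ n ≤ 2 ^ n * (a ^ n + b ^ n) := by
  have h : a + b ≤ 2 * max a b := by
    rw [two_mul]
    exact add_le_add (le_max_left _ _) (le_max_right _ _)
  refine (pow_le_pow_left₀ zero_le h n).trans ?_
  rw [mul_pow]
  refine mul_le_mul_right ?_ _
  rcases le_total a b with hab | hab
  · rw [max_eq_right hab]; exact le_add_self
  · rw [max_eq_left hab]; exact le_self_add

theorem enorm_smul_add_smulRight_le {V W : Type*} [NormedAddCommGroup V] [NormedSpace ℝ V]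
    [NormedAddCommGroup W] [NormedSpace ℝ W] {c M : ℝ} (hc0 : 0 ≤ c) (hc1 : c ≤ 1)
    {l : V →L[ℝ] ℝ} (hl : ‖l‖ ≤ M) (A : V →L[ℝ] W) (y : W) :
    ‖c • A + l.smulRight y‖ₑ ≤ ‖A‖ₑ + ENNReal.ofReal M * ‖y‖ₑ := by
  have hM : 0 ≤ M := (norm_nonneg _).trans hl
  rw [← ofReal_norm, ← ofReal_norm, ← ofReal_norm, ← ENNReal.ofReal_mul hM,
    ← ENNReal.ofReal_add (norm_nonneg _) (by positivity)]
  refine ENNReal.ofReal_le_ofReal ((norm_add_le _ _).trans (add_le_add ?_ ?_))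
  · rw [norm_smul, Real.norm_of_nonneg hc0]
    exact mul_le_of_le_one_left (norm_nonneg _) hc1
  · rw [ContinuousLinearMap.norm_smulRight_apply]
    exact mul_le_mul_of_nonneg_right hl (norm_nonneg _)

open scoped Manifold in
theorem exists_contDiff_cutoff {E : Type*} [NormedAddCommGroup E] [NormedSpace ℝ E]
    [FiniteDimensional ℝ E] {D D' : Set E} (hD : IsClosed D) (hD' : IsClosed D')
    (h : D ⊆ interior D') :
    ∃ χ : E → ℝ, ContDiff ℝ 1 χ ∧ tsupport χ ⊆ D' ∧ (∀ x ∈ D, χ x = 1) ∧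
      ∀ x, 0 ≤ χ x ∧ χ x ≤ 1 := by
  obtain ⟨χ, h0, h1, h2⟩ := exists_contMDiffMap_zero_one_of_isClosed (n := 1) 𝓘(ℝ, E)
    (isClosed_compl_iff.2 (isOpen_interior (s := D'))) hD
    (disjoint_compl_left_iff_subset.2 h)
  refine ⟨χ, χ.contMDiff.contDiff, ?_, fun x hx => h1 hx, fun x => h2 x⟩
  refine closure_minimal (fun x hx => ?_) hD'
  by_contra hx'
  exact hx (h0 fun h' => hx' (interior_subset h'))

/-- Maps in `W^{1,n}_loc` are locally integrable to every power. -/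
theorem HasWeakDifferential.lintegral_enorm_rpow_ne_top {n : ℕ} (hn : 2 ≤ n)
    {Ω : Set (EuclideanSpace ℝ (Fin n))} (hΩ : IsOpen Ω)
    {f : EuclideanSpace ℝ (Fin n) → EuclideanSpace ℝ (Fin n)}
    {Df : EuclideanSpace ℝ (Fin n) → EuclideanSpace ℝ (Fin n) →L[ℝ] EuclideanSpace ℝ (Fin n)}
    (hf : HasWeakDifferential Ω f Df) (hfn : MemLpLoc Ω n f) (hDfn : MemLpLoc Ω n Df)
    {p : ℝ} (hp : 1 < p) {D : Set (EuclideanSpace ℝ (Fin n))} (hDΩ : D ⊆ Ω) (hD : IsCompact D) :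
    ∫⁻ x in D, ‖f x‖ₑ ^ (n * p) ≠ ⊤ := by
  have hn0 : (0 : ℝ) < n := by positivity
  have hp0 : 0 < p := by linarith
  obtain ⟨D', hD', hDD', hD'Ω⟩ := exists_compact_between hD hΩ hDΩ
  obtain ⟨χ, hχ, hχs, hχ1, hχ01⟩ := exists_contDiff_cutoff hD.isClosed hD'.isClosed hDD'
  have hχc : HasCompactSupport χ := hD'.of_isClosed_subset (isClosed_tsupport _) hχs
  obtain ⟨M, hM⟩ := (hχc.fderiv ℝ).exists_bound_of_continuous
    (hχ.continuous_fderiv one_ne_zero)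
  have hpowfin : ∀ {V : Type} [NormedAddCommGroup V] {u : EuclideanSpace ℝ (Fin n) → V},
      MemLp u n (volume.restrict D') → ∫⁻ x in D', ‖u x‖ₑ ^ n ≠ ⊤ := by
    intro V _ u hu
    have h1 := hu.2
    rw [eLpNorm_lt_top_iff_lintegral_rpow_enorm_lt_top (by simp; omega)
      (ENNReal.natCast_ne_top n)] at h1
    simpa using h1.ne
  obtain ⟨F, H, hF, hH, hHint, hHF, hFint, hlim, -⟩ := hf.exists_smooth_approx hn hΩ hfn hDfn
    hD' hD'Ω one_ne_zero
  obtain ⟨C, hC⟩ := exists_lintegral_rpow_le_lintegral_fderiv hn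
    (F := EuclideanSpace ℝ (Fin n)) hp
  have h2n : (2 : ℝ≥0∞) ^ n ≠ ⊤ := ENNReal.pow_ne_top ENNReal.ofNat_ne_top
  have hHfin : ∫⁻ x in D', H x ≠ ⊤ := ne_top_of_le_ne_top (ENNReal.add_ne_top.2
    ⟨ENNReal.mul_ne_top h2n (hpowfin (hDfn D' hD'Ω hD')), ENNReal.one_ne_top⟩) hHint
  set A : ℝ≥0∞ := 2 ^ n * (∫⁻ x in D', ‖f x‖ₑ ^ n) + 1
  have hA : A ≠ ⊤ := ENNReal.add_ne_top.2
    ⟨ENNReal.mul_ne_top h2n (hpowfin (hfn D' hD'Ω hD')), ENNReal.one_ne_top⟩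
  set m : ℝ≥0∞ := ENNReal.ofReal M
  set B : ℝ≥0∞ := volume D' + 2 ^ n * ((∫⁻ x in D', H x) + m ^ n * A)
  have hB : B ≠ ⊤ := ENNReal.add_ne_top.2 ⟨hD'.measure_ne_top, ENNReal.mul_ne_top h2n
    (ENNReal.add_ne_top.2 ⟨hHfin, ENNReal.mul_ne_top
      (ENNReal.pow_ne_top ENNReal.ofReal_ne_top) hA⟩)⟩
  have hs0 : 0 ≤ n * p / (p + 1) := by positivity
  have hsn : n * p / (p + 1) ≤ n := by
    rw [div_le_iff₀ (by positivity)]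
    nlinarith
  -- The Sobolev inequality for the cut-off approximations χF_j gives a bound independent of j,
  -- which Fatou's lemma transfers to f.
  have hbound : ∀ j, ∫⁻ x in D, ‖F j x‖ₑ ^ (n * p) ≤ C * B ^ (p + 1) := by
    intro j
    set u := fun x => χ x • F j x
    have hu : ContDiff ℝ 1 u := hχ.smul (hF j)
    have huc : HasCompactSupport u := hχc.smul_right
    have hus : tsupport u ⊆ D' := (tsupport_smul_subset_left χ (F j)).trans hχs
    have h1 : ∫⁻ x in D, ‖F j x‖ₑ ^ (n * p) ≤ ∫⁻ x, ‖u x‖ₑ ^ (n * p) := by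
      refine le_trans (le_of_eq (setLIntegral_congr_fun hD.measurableSet fun x hx => ?_))
        (setLIntegral_le_lintegral D _)
      simp [u, hχ1 x hx]
    refine h1.trans ((hC u hu huc).trans
      (mul_le_mul_right (ENNReal.rpow_le_rpow ?_ (by positivity)) _))
    have h2 : ∫⁻ x, ‖fderiv ℝ u x‖ₑ ^ (n * p / (p + 1))
        = ∫⁻ x in D', ‖fderiv ℝ u x‖ₑ ^ (n * p / (p + 1)) := by
      refine (setLIntegral_eq_of_support_subset ?_).symm
      intro x hx
      by_contra hxD
      refine hx ?_
      have : fderiv ℝ u x = 0 := image_eq_zero_of_notMem_tsupport fun h =>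
        hxD (hus (tsupport_fderiv_subset ℝ h))
      simp only
      rw [← ofReal_norm, this, norm_zero, ENNReal.ofReal_zero]
      exact ENNReal.zero_rpow_of_pos (by positivity)
    rw [h2]
    have h3 : ∀ x ∈ D', ‖fderiv ℝ u x‖ₑ ^ (n * p / (p + 1))
        ≤ 1 + 2 ^ n * (H x + m ^ n * ‖F j x‖ₑ ^ n) := by
      intro x hx
      refine (ENNReal.rpow_le_one_add_pow hs0 hsn).trans (add_le_add le_rfl ?_)
      have hd : fderiv ℝ u x = χ x • fderiv ℝ (F j) x + (fderiv ℝ χ x).smulRight (F j x) :=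
        fderiv_fun_smul (hχ.differentiable one_ne_zero x) ((hF j).differentiable one_ne_zero x)
      rw [hd]
      refine (pow_le_pow_left₀ zero_le (enorm_smul_add_smulRight_le (hχ01 x).1
        (hχ01 x).2 (hM x) _ _) n).trans ?_
      refine (ENNReal.add_pow_le_two_pow_mul _ _ n).trans (mul_le_mul_right ?_ _)
      rw [mul_pow]
      exact add_le_add (hHF j x hx) le_rfl
    refine (setLIntegral_mono' hD'.measurableSet h3).trans ?_
    rw [lintegral_add_left measurable_const, setLIntegral_one, lintegral_const_mul' _ _ h2n,
      lintegral_add_left hH, lintegral_const_mul' _ _ (ENNReal.pow_ne_top ENNReal.ofReal_ne_top)]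
    exact add_le_add le_rfl (mul_le_mul_right (add_le_add le_rfl (mul_le_mul_right (hFint j) _)) _)
  refine ne_top_of_le_ne_top (ENNReal.mul_ne_top (b := B ^ (p + 1)) (a := C) ENNReal.coe_ne_top
    (ENNReal.rpow_ne_top_of_nonneg (by positivity) hB)) ?_
  calc ∫⁻ x in D, ‖f x‖ₑ ^ (n * p)
      = ∫⁻ x in D, Filter.liminf (fun j => ‖F j x‖ₑ ^ (n * p)) Filter.atTop := by
        refine lintegral_congr_ae ?_
        filter_upwards [ae_restrict_of_ae_restrict_of_subset
          (hDD'.trans interior_subset) hlim] with x hx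
        exact (((ENNReal.continuous_rpow_const).tendsto _).comp
          ((continuous_enorm.tendsto _).comp hx)).liminf_eq.symm
    _ ≤ Filter.liminf (fun j => ∫⁻ x in D, ‖F j x‖ₑ ^ (n * p)) Filter.atTop :=
        lintegral_liminf_le fun j => ((hF j).continuous.enorm.measurable).pow_const _
    _ ≤ C * B ^ (p + 1) := Filter.liminf_le_of_frequently_le'
        (Filter.Eventually.of_forall hbound).frequently

/-- The weak differential is unique up to null sets. -/
theorem HasWeakDifferential.ae_eq {n : ℕ} {Ω : Set (EuclideanSpace ℝ (Fin n))} (hΩ : IsOpen Ω)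
    {f : EuclideanSpace ℝ (Fin n) → EuclideanSpace ℝ (Fin n)}
    {A B : EuclideanSpace ℝ (Fin n) → EuclideanSpace ℝ (Fin n) →L[ℝ] EuclideanSpace ℝ (Fin n)}
    (hA : HasWeakDifferential Ω f A) (hB : HasWeakDifferential Ω f B) :
    A =ᵐ[volume.restrict Ω] B := by
  have hv : ∀ v : EuclideanSpace ℝ (Fin n), ∀ᵐ x, x ∈ Ω → A x v - B x v = 0 := by
    intro v
    have hAv : LocallyIntegrableOn (fun x => A x v) Ω volume := fun x hx => by
      obtain ⟨s, hs, hs'⟩ := hA.locallyIntegrableOn_deriv x hx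
      exact ⟨s, hs, hs'.apply_continuousLinearMap v⟩
    have hBv : LocallyIntegrableOn (fun x => B x v) Ω volume := fun x hx => by
      obtain ⟨s, hs, hs'⟩ := hB.locallyIntegrableOn_deriv x hx
      exact ⟨s, hs, hs'.apply_continuousLinearMap v⟩
    refine hΩ.ae_eq_zero_of_integral_contDiff_smul_eq_zero (hAv.sub hBv) fun φ hφ hφc hφs => ?_
    have hint : ∀ {u : EuclideanSpace ℝ (Fin n) → EuclideanSpace ℝ (Fin n)},
        LocallyIntegrableOn u Ω volume → Integrable (fun x => φ x • u x) := by
      intro u hu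
      have h1 : IntegrableOn (fun x => φ x • u x) (tsupport φ) :=
        (hu.integrableOn_compact_subset hφs hφc).continuousOn_smul hφ.continuous.continuousOn hφc
      refine (integrableOn_iff_integrable_of_support_subset fun x hx => ?_).1 h1
      refine subset_tsupport φ fun h => hx ?_
      simp only [h, zero_smul]
    have hset : ∀ u : EuclideanSpace ℝ (Fin n) → EuclideanSpace ℝ (Fin n),
        ∫ x in Ω, φ x • u x = ∫ x, φ x • u x := fun u =>
      setIntegral_eq_integral_of_forall_compl_eq_zero fun x hx => by
        rw [image_eq_zero_of_notMem_tsupport fun h => hx (hφs h), zero_smul]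
    have h1 := hA.integral_eq φ hφ hφc hφs v
    rw [hB.integral_eq φ hφ hφc hφs v, neg_inj, hset, hset] at h1
    simp_rw [smul_sub]
    rw [integral_sub (hint hAv) (hint hBv), h1, sub_self]
  rw [Filter.EventuallyEq, ae_restrict_iff' hΩ.measurableSet]
  filter_upwards [ae_all_iff.2 fun i => hv (EuclideanSpace.basisFun (Fin n) ℝ i)] with x hx hxΩ
  refine ContinuousLinearMap.coe_injective
    ((EuclideanSpace.basisFun (Fin n) ℝ).toBasis.ext fun i => ?_)
  simpa using sub_eq_zero.1 (hx i hxΩ)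

/-- The gap 1 - 1/p - 1/q = 4δ is divided among the reciprocals 1/p + δ, 1/q + 2δ and 1/q + δ, so
infinite exponents need no separate case. The room between q' and r pays for the factor |f - y₀|ⁿ.
-/
theorem exists_real_exponents {p q : ℝ≥0∞} (hpq : p⁻¹ + q⁻¹ < 1) :
    ∃ p' q' r : ℝ, 1 < p' ∧ 1 < q' ∧ q' < r ∧ p'⁻¹ + q'⁻¹ < 1 ∧ ENNReal.ofReal p' ≤ p ∧
      ENNReal.ofReal r ≤ q := by
  have hsum : p⁻¹ + q⁻¹ ≠ ⊤ := (hpq.trans ENNReal.one_lt_top).ne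
  obtain ⟨hp, hq⟩ := ENNReal.add_ne_top.1 hsum
  set a := (p⁻¹).toReal
  set b := (q⁻¹).toReal
  have ha : 0 ≤ a := ENNReal.toReal_nonneg
  have hb : 0 ≤ b := ENNReal.toReal_nonneg
  have hab : a + b < 1 := by
    rw [← ENNReal.toReal_add hp hq, ← ENNReal.toReal_one]
    exact (ENNReal.toReal_lt_toReal hsum ENNReal.one_ne_top).2 hpq
  have key : ∀ (t : ℝ≥0∞) (c : ℝ), t⁻¹ ≠ ⊤ → (t⁻¹).toReal ≤ c → 0 < c →
      ENNReal.ofReal c⁻¹ ≤ t := by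
    intro t c ht htc hc
    rw [ENNReal.ofReal_inv_of_pos hc, ENNReal.inv_le_iff_inv_le]
    exact (ENNReal.le_ofReal_iff_toReal_le ht hc.le).2 htc
  set δ := (1 - a - b) / 4
  have hδ : 0 < δ := by simp only [δ]; linarith
  have hδ4 : 4 * δ = 1 - a - b := by simp only [δ]; ring
  refine ⟨(a + δ)⁻¹, (b + 2 * δ)⁻¹, (b + δ)⁻¹, ?_, ?_, ?_, ?_, ?_, ?_⟩
  · exact (one_lt_inv₀ (by linarith)).2 (by linarith)
  · exact (one_lt_inv₀ (by linarith)).2 (by linarith)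
  · exact (inv_lt_inv₀ (by linarith) (by linarith)).2 (by linarith)
  · rw [inv_inv, inv_inv]; linarith
  · exact key p _ hp (by linarith) (by linarith)
  · exact key q _ hq (by linarith) (by linarith)

theorem MemLpLoc.lintegral_enorm_rpow_ne_top {n : ℕ} {F : Type*} [TopologicalSpace F]
    [ContinuousENorm F] {Ω : Set (EuclideanSpace ℝ (Fin n))} {p : ℝ≥0∞}
    {u : EuclideanSpace ℝ (Fin n) → F} (hu : MemLpLoc Ω p u) {r : ℝ} (hr : 0 < r)
    (hrp : ENNReal.ofReal r ≤ p) {D : Set (EuclideanSpace ℝ (Fin n))} (hDΩ : D ⊆ Ω)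
    (hD : IsCompact D) : ∫⁻ x in D, ‖u x‖ₑ ^ r ≠ ⊤ := by
  have : IsFiniteMeasure (volume.restrict D) := ⟨by
    rw [Measure.restrict_apply_univ]; exact hD.measure_lt_top⟩
  have h1 := ((hu D hDΩ hD).mono_exponent hrp).2
  rw [eLpNorm_lt_top_iff_lintegral_rpow_enorm_lt_top (by simpa using hr)
    ENNReal.ofReal_ne_top, ENNReal.toReal_ofReal hr.le] at h1
  exact h1.ne

/-- A function with locally integrable powers is finite almost everywhere. -/
theorem ae_ne_top_of_lintegral_rpow_ne_top {n : ℕ} {Ω : Set (EuclideanSpace ℝ (Fin n))}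
    (hΩ : IsOpen Ω) {u : EuclideanSpace ℝ (Fin n) → ℝ≥0∞} {r : ℝ} (hr : 0 < r)
    (hum : AEMeasurable u (volume.restrict Ω))
    (hu : ∀ D ⊆ Ω, IsCompact D → ∫⁻ x in D, u x ^ r ≠ ⊤) :
    ∀ᵐ x ∂volume.restrict Ω, u x ≠ ⊤ := by
  rw [ae_restrict_iff' hΩ.measurableSet, ae_iff]
  refine measure_null_of_locally_null _ fun x hx => ?_
  simp only [mem_ofPred_eq, Classical.not_imp] at hx
  obtain ⟨ρ, hρ, hρΩ⟩ := Metric.nhds_basis_closedBall.mem_iff.1 (hΩ.mem_nhds hx.1)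
  have h1 := ae_lt_top' ((hum.mono_measure (Measure.restrict_mono hρΩ le_rfl)).pow_const r)
    (hu _ hρΩ (isCompact_closedBall x ρ))
  rw [ae_restrict_iff' Metric.isClosed_closedBall.measurableSet, ae_iff] at h1
  refine ⟨_ ∩ Metric.closedBall x ρ, Filter.inter_mem self_mem_nhdsWithin
    (mem_nhdsWithin_of_mem_nhds (Metric.closedBall_mem_nhds x hρ)),
    measure_mono_null (fun y hy => ?_) h1⟩
  obtain ⟨hy1, hy2⟩ := hy
  simp only [mem_ofPred_eq, Classical.not_imp, not_not] at hy1
  simp only [mem_ofPred_eq, Classical.not_imp]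
  exact ⟨hy2, by simp [hy1.2, hr]⟩

/-- The quotient of the data, where it is finite, turns the distortion inequality with defect into
one with a factor `K`. -/
theorem NNReal.coe_mul_toNNReal_div {K S : ℝ≥0} (h : (S : ℝ≥0∞) / K ≠ ⊤) :
    (K : ℝ) * (((S : ℝ≥0∞) / K).toNNReal : ℝ) = S := by
  have h1 : K * ((S : ℝ≥0∞) / K).toNNReal = S := by
    by_cases hK : K = 0
    · subst hK
      by_cases hS : S = 0
      · simp [hS]
      · exact absurd (by rw [ENNReal.coe_zero, ENNReal.div_zero (by simpa using hS)]) h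
    · rw [← ENNReal.coe_inj, ENNReal.coe_mul, ENNReal.coe_toNNReal h]
      exact ENNReal.mul_div_cancel (by simpa using hK) ENNReal.coe_ne_top
  exact_mod_cast h1

/-- Young's inequality with exponents r/q and r/(r - q), its denominators being at least 1. It puts
a product in L^q when one factor is in L^r and the other is integrable to a high power. -/
theorem ENNReal.mul_rpow_le_rpow_add_rpow {a b : ℝ≥0∞} {q r : ℝ} (hq : 0 < q) (hqr : q < r) :
    (a * b) ^ q ≤ a ^ r + b ^ (q * r / (r - q)) := by
  have hr : 0 < r := hq.trans hqr
  have hc : (r / q).HolderConjugate (r / (r - q)) := by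
    rw [Real.holderConjugate_iff]
    refine ⟨(one_lt_div hq).2 hqr, ?_⟩
    have : r - q ≠ 0 := by linarith
    field_simp
    ring
  rw [ENNReal.mul_rpow_of_nonneg _ _ hq.le]
  refine (ENNReal.young_inequality (a ^ q) (b ^ q) hc).trans (add_le_add ?_ ?_)
  · rw [← ENNReal.rpow_mul, mul_div_cancel₀ _ hq.ne']
    refine ENNReal.div_le_of_le_mul (le_mul_of_one_le_right zero_le ?_)
    simpa using hc.lt.le
  · rw [← ENNReal.rpow_mul, ← mul_div_assoc]
    refine ENNReal.div_le_of_le_mul (le_mul_of_one_le_right zero_le ?_)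
    simpa using hc.symm.lt.le

/-- The quotient `S / K` is taken in `[0, ∞]`, where `0 / 0 = 0` and `s / 0 = ∞` for `s > 0`.
The Lusin (N) property of a Sobolev map is that of its continuous representative `g`. -/
theorem theorem1p3 {n : ℕ} (hn : 2 ≤ n) (Ω : Set (EuclideanSpace ℝ (Fin n)))
    (hΩ : IsOpen Ω) (hΩc : IsConnected Ω)
    (p q : ℝ≥0∞) (hp : 1 ≤ p) (hq : 1 ≤ q) (hpq : p⁻¹ + q⁻¹ < 1)
    (f : EuclideanSpace ℝ (Fin n) → EuclideanSpace ℝ (Fin n))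
    (hf : MemSobolevLoc Ω (n : ℝ≥0∞) f)
    (K S : EuclideanSpace ℝ (Fin n) → ℝ≥0)
    (hK : AEMeasurable K (volume.restrict Ω)) (hS : AEMeasurable S (volume.restrict Ω))
    (hfKS : SatisfiesDistortionWithDefect Ω K S f ∨ ∃ y₀, HasValueOfFiniteDistortion Ω K S f y₀)
    (hKp : MemLpLoc Ω p (fun x => (K x : ℝ)))
    (hSKq : MemLpLoc Ω q (fun x => (S x : ℝ≥0∞) / (K x : ℝ≥0∞))) :
    ∃ g : EuclideanSpace ℝ (Fin n) → EuclideanSpace ℝ (Fin n),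
      ContinuousOn g Ω ∧ f =ᵐ[volume.restrict Ω] g ∧ LusinN Ω g := by
  obtain ⟨hfn, Df, hfD, hDfn⟩ := hf
  obtain ⟨p', q', r, hp', hq', hqr, hpq', hpp, hrq⟩ := exists_real_exponents hpq
  have hr : 0 < r := by linarith
  -- Infinite values of the quotient become 0, which is harmless because local integrability makes
  -- it finite almost everywhere.
  set σ : EuclideanSpace ℝ (Fin n) → ℝ≥0 := fun x => ((S x : ℝ≥0∞) / K x).toNNReal
  have hSKm : AEMeasurable (fun x => (S x : ℝ≥0∞) / K x) (volume.restrict Ω) :=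
    hS.coe_nnreal_ennreal.div hK.coe_nnreal_ennreal
  have hσ : AEMeasurable σ (volume.restrict Ω) := hSKm.ennreal_toNNReal
  have hKp' : ∀ D ⊆ Ω, IsCompact D → ∫⁻ x in D, (K x : ℝ≥0∞) ^ p' ≠ ⊤ := fun D hDΩ hD => by
    simpa [Real.enorm_of_nonneg] using
      hKp.lintegral_enorm_rpow_ne_top (by linarith) hpp hDΩ hD
  have hSK : ∀ s, 0 < s → s ≤ r → ∀ D ⊆ Ω, IsCompact D →
      ∫⁻ x in D, ((S x : ℝ≥0∞) / K x) ^ s ≠ ⊤ := fun s hs hsr D hDΩ hD => by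
    simpa using hSKq.lintegral_enorm_rpow_ne_top hs
      ((ENNReal.ofReal_le_ofReal hsr).trans hrq) hDΩ hD
  have hσs : ∀ s, 0 < s → s ≤ r → ∀ D ⊆ Ω, IsCompact D →
      ∫⁻ x in D, (σ x : ℝ≥0∞) ^ s ≠ ⊤ := fun s hs hsr D hDΩ hD =>
    ne_top_of_le_ne_top (hSK s hs hsr D hDΩ hD) (lintegral_mono fun x =>
      ENNReal.rpow_le_rpow ENNReal.coe_toNNReal_le_self hs.le)
  have hfin := ae_ne_top_of_lintegral_rpow_ne_top hΩ hr hSKm (hSK r hr le_rfl)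
  -- The distortion hypothesis supplies its own weak differential, identified almost everywhere with
  -- the one from the Sobolev hypothesis by uniqueness.
  rcases hfKS with ⟨Df', hfD', hdist⟩ | ⟨y₀, Df', hfD', hdist⟩
  · refine exists_continuousOn_lusinN_of_distortion hn hp' hq' hpq' hΩ hfD hfn hDfn hK hσ ?_
      hKp' (hσs q' (by linarith) hqr.le)
    filter_upwards [hdist, hfin, hfD.ae_eq hΩ hfD'] with x hx hx' hxD
    rw [hxD, mul_add, NNReal.coe_mul_toNNReal_div hx']
    exact hx
  · have hfm : AEStronglyMeasurable f (volume.restrict Ω) :=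
      hfD.locallyIntegrableOn.aestronglyMeasurable
    set b : EuclideanSpace ℝ (Fin n) → ℝ≥0 := fun x => ‖f x - y₀‖₊ ^ n
    have hb : AEMeasurable b (volume.restrict Ω) :=
      ((hfm.sub aestronglyMeasurable_const).nnnorm.aemeasurable).pow_const n
    refine exists_continuousOn_lusinN_of_distortion hn hp' hq' hpq' hΩ hfD hfn hDfn hK
      (hσ.mul hb) ?_ hKp' fun D hDΩ hD => ?_
    · filter_upwards [hdist, hfin, hfD.ae_eq hΩ hfD'] with x hx hx' hxD
      have h1 : ((σ * b) x : ℝ≥0) = σ x * b x := rfl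
      rw [hxD, mul_add, h1, NNReal.coe_mul, ← mul_assoc, NNReal.coe_mul_toNNReal_div hx']
      exact hx
    -- This is the power of |f - y₀|ⁿ left by Young's inequality. Since q' > 1 it exceeds 1, so
    -- |f|^{nt} is covered by the higher integrability of W^{1,n}_loc maps.
    · set t := q' * r / (r - q')
      have ht : 1 < t := by
        rw [one_lt_div (by linarith)]
        nlinarith
      have hle : volume.restrict D ≤ volume.restrict Ω := Measure.restrict_mono hDΩ le_rfl
      have hbt : ∫⁻ x in D, (b x : ℝ≥0∞) ^ t ≠ ⊤ := by
        have h1 : ∀ x, (b x : ℝ≥0∞) ^ t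
            ≤ 2 ^ (n * t - 1) * (‖f x‖ₑ ^ (n * t) + ‖y₀‖ₑ ^ (n * t)) := fun x => by
          have h2 : (b x : ℝ≥0∞) = ‖f x - y₀‖ₑ ^ n := by simp [b, enorm_eq_nnnorm]
          rw [h2, ← ENNReal.rpow_natCast, ← ENNReal.rpow_mul]
          have hn1 : (1 : ℝ) ≤ n := by exact_mod_cast (by omega : 1 ≤ n)
          exact (ENNReal.rpow_le_rpow enorm_sub_le (by positivity)).trans
            (ENNReal.rpow_add_le_mul_rpow_add_rpow _ _ (by nlinarith))
        refine ne_top_of_le_ne_top ?_ (lintegral_mono h1)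
        have h3 : (2 : ℝ≥0∞) ^ (n * t - 1) ≠ ⊤ := by simp
        rw [lintegral_const_mul' _ _ h3, lintegral_add_right _ measurable_const,
          setLIntegral_const]
        refine ENNReal.mul_ne_top h3 (ENNReal.add_ne_top.2
          ⟨hfD.lintegral_enorm_rpow_ne_top hn hΩ hfn hDfn ht hDΩ hD, ENNReal.mul_ne_top
            (ENNReal.rpow_ne_top_of_nonneg (by positivity) enorm_ne_top) hD.measure_ne_top⟩)
      refine ne_top_of_le_ne_top (ENNReal.add_ne_top.2 ⟨hσs r hr le_rfl D hDΩ hD, hbt⟩) ?_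
      rw [← lintegral_add_left' ((hσ.mono_measure hle).coe_nnreal_ennreal.pow_const r)]
      refine lintegral_mono fun x => ?_
      rw [Pi.mul_apply, ENNReal.coe_mul]
      exact ENNReal.mul_rpow_le_rpow_add_rpow (by linarith) hqr
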